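/- Let $M$ be a connected (Hausdorff) smooth surface, $g$ a smooth Riemannian metric on $M$ of constant sectional curvature, and $\tau$ a smooth 1-form on $M$ with $|\tau|_g<1$ at every point. Suppose that for some constant $c\in\mathbb R$ we have $d\tau=c\cdot \mathrm{Vol}_g$, where $\mathrm{Vol}_g=\sqrt{\det g}\,dx\wedge dy$ is the volume form of $g$; that is, every point of $M$ has a coordinate neighbourhood in whose coordinates $(x,y)$ one has $d\tau=c\sqrt{\det g}\,dx\wedge dy$. Consider the Randers Finsler metric $F(x,y)=F_{g,\tau}(x,y)=\sqrt{g_x(y,y)}+\tau_x(y)$ and its (in general nonsymmetric) distance $$d(p,q)=\inf\Big\{\int_0^1F(\gamma(t),\gamma'(t))\,dt \;:\; \gamma\in C^1([0,1];M),\ \gamma(0)=p,\ \gamma(1)=q\Big\},$$ and put $T(p,q,r)=d(p,q)+d(q,r)-d(p,r)$. A diffeomorphism $\phi:W\to W'$ between open subsets of $M$ is called an almost isometry if $T(\phi(p),\phi(q),\phi(r))=T(p,q,r)$ for all $p,q,r\in W$. A smooth vector field $K$ on an open set $U\subseteq M$ is called almost Killing if its local flow acts by almost isometries, i.e. if each point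 of $U$ has an open neighbourhood $W\subseteq U$ and an $\varepsilon>0$ such that for $|t|<\varepsilon$ the flow $\phi_t$ of $K$ is defined on $W$, with values in $U$, and is an almost isometry from $W$ onto its image. Then, locally, the almost Killing vector fields of $F_{g,\tau}$ form a 3-dimensional space: every point $p\in M$ has an open neighbourhood $U_0$ such that, for every nonempty connected open set $U\subseteq U_0$, the set of almost Killing vector fields on $U$ is a real vector space of dimension exactly $3$. -/

import Mathlib

open Set TopologicalSpace
open scoped Manifold ContDiff Bundle

noncomputable section

namespace AlmostKilling

/-- The model space of surfaces. -/
abbrev Plane : Type := EuclideanSpace ℝ (Fin 2)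

/-- Smooth Riemannian metrics on a surface. -/
abbrev SurfaceMetric (M : Type*) [TopologicalSpace M] [ChartedSpace Plane M]
    [IsManifold (𝓡 2) ∞ M] : Type _ :=
  Bundle.ContMDiffRiemannianMetric (𝓡 2) ∞ Plane (fun x : M => TangentSpace (𝓡 2) x)

/-- Smooth 1-forms on a surface: smooth sections of the cotangent bundle. -/
abbrev OneForm (M : Type*) [TopologicalSpace M] [ChartedSpace Plane M]
    [IsManifold (𝓡 2) ∞ M] : Type _ :=
  ContMDiffSection (𝓡 2) (Plane →L[ℝ] ℝ) ∞ (fun x : M => TangentSpace (𝓡 2) x →L[ℝ] ℝ)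

/-! ### Local coordinates -/

/-- The `i`-th partial derivative of a function on the plane. -/
def partialD (i : Fin 2) (f : Plane → ℝ) (z : Plane) : ℝ :=
  fderiv ℝ f z (EuclideanSpace.single i 1)

/-- The coordinate vector `∂ᵢ` of the chart `e` at the point with coordinates `z`. -/
def coordVec {M : Type*} [TopologicalSpace M] [ChartedSpace Plane M]
    (e : OpenPartialHomeomorph M Plane) (i : Fin 2) (z : Plane) :
    TangentSpace (𝓡 2) (e.symm z) :=
  mfderiv (𝓡 2) (𝓡 2) e.symm z (EuclideanSpace.single i (1 : ℝ) : Plane)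

/-- The matrix `gᵢⱼ` of the metric in the chart `e`, as a function of the coordinates. -/
def metricMatrix {M : Type*} [TopologicalSpace M] [ChartedSpace Plane M]
    [IsManifold (𝓡 2) ∞ M] (g : SurfaceMetric M) (e : OpenPartialHomeomorph M Plane)
    (z : Plane) : Matrix (Fin 2) (Fin 2) ℝ :=
  Matrix.of fun i j => g.inner (e.symm z) (coordVec e i z) (coordVec e j z)

/-- The component `τᵢ` of a 1-form in the chart `e`, as a function of the coordinates. -/
def formCoeff {M : Type*} [TopologicalSpace M] [ChartedSpace Plane M]
    [IsManifold (𝓡 2) ∞ M] (τ : OneForm M) (e : OpenPartialHomeomorph M Plane)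
    (i : Fin 2) (z : Plane) : ℝ :=
  τ (e.symm z) (coordVec e i z)

/-! ### Curvature and the volume form -/

/-- The Christoffel symbol `Γᵏᵢⱼ = ½ ∑ₗ gᵏˡ (∂ᵢ gⱼₗ + ∂ⱼ gᵢₗ - ∂ₗ gᵢⱼ)`. -/
def christoffel (G : Plane → Matrix (Fin 2) (Fin 2) ℝ) (k i j : Fin 2) (z : Plane) : ℝ :=
  (1 / 2) * ∑ l : Fin 2, (G z)⁻¹ k l *
    (partialD i (fun w => G w j l) z + partialD j (fun w => G w i l) z
      - partialD l (fun w => G w i j) z)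

/-- The `l`-th component of `R(∂ᵢ, ∂ⱼ)∂ₖ = ∇ᵢ∇ⱼ∂ₖ - ∇ⱼ∇ᵢ∂ₖ` for the Levi-Civita connection. -/
def riemannTensor (G : Plane → Matrix (Fin 2) (Fin 2) ℝ) (l i j k : Fin 2) (z : Plane) : ℝ :=
  partialD i (christoffel G l j k) z - partialD j (christoffel G l i k) z
    + ∑ m : Fin 2, (christoffel G m j k z * christoffel G l i m z
        - christoffel G m i k z * christoffel G l j m z)

/-- The sectional curvature `g(R(∂₀, ∂₁)∂₁, ∂₀) / (g₀₀ g₁₁ - g₀₁²)` of the tangent plane. -/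
def sectionalCurvature (G : Plane → Matrix (Fin 2) (Fin 2) ℝ) (z : Plane) : ℝ :=
  (∑ l : Fin 2, G z l 0 * riemannTensor G l 0 1 1 z) / (G z).det

/-- The metric `g` has constant sectional curvature (evaluated in arbitrary smooth charts, the
value being independent of the chart). -/
def HasConstantCurvature {M : Type*} [TopologicalSpace M] [ChartedSpace Plane M]
    [IsManifold (𝓡 2) ∞ M] (g : SurfaceMetric M) : Prop :=
  ∃ κ : ℝ, ∀ e ∈ IsManifold.maximalAtlas (𝓡 2) ∞ M, ∀ z ∈ e.target,
    sectionalCurvature (metricMatrix g e) z = κ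

/-- `dτ = c · Vol_g`. The volume form is determined only by a local choice of orientation, that
is, of a chart: around each point there is a smooth chart in which
`dτ = (∂₀ τ₁ - ∂₁ τ₀) dx ∧ dy` is equal to `c √(det g) dx ∧ dy`. On an oriented surface it
suffices to have this in the positively oriented charts; no global orientation is assumed. -/
def ExtDerivEqSmulVol {M : Type*} [TopologicalSpace M] [ChartedSpace Plane M]
    [IsManifold (𝓡 2) ∞ M] (g : SurfaceMetric M) (τ : OneForm M) (c : ℝ) : Prop :=
  ∀ x : M, ∃ e ∈ IsManifold.maximalAtlas (𝓡 2) ∞ M, x ∈ e.source ∧ ∀ z ∈ e.target,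
    partialD 0 (formCoeff τ e 1) z - partialD 1 (formCoeff τ e 0) z
      = c * Real.sqrt (metricMatrix g e z).det

/-! ### Randers metrics, distance, almost isometries -/

/-- The pointwise dual norm `|τ|_g` of a 1-form at `x`. -/
def oneFormNorm {M : Type*} [TopologicalSpace M] [ChartedSpace Plane M]
    [IsManifold (𝓡 2) ∞ M] (g : SurfaceMetric M) (τ : OneForm M) (x : M) : ℝ :=
  sSup {s : ℝ | ∃ v : TangentSpace (𝓡 2) x, g.inner x v v ≤ 1 ∧ s = |τ x v|}

/-- The Randers metric `F_{g,τ}(x, y) = √(g_x(y, y)) + τ_x(y)`. -/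
def randers {M : Type*} [TopologicalSpace M] [ChartedSpace Plane M]
    [IsManifold (𝓡 2) ∞ M] (g : SurfaceMetric M) (τ : OneForm M)
    (x : M) (y : TangentSpace (𝓡 2) x) : ℝ :=
  Real.sqrt (g.inner x y y) + τ x y

/-- The (in general nonsymmetric) distance of a Finsler metric `F`: the infimum of
`∫₀¹ F(γ(t), γ'(t)) dt` over `C¹` curves `γ : [0, 1] → M` from `p` to `q`. -/
def finslerDist {M : Type*} [TopologicalSpace M] [ChartedSpace Plane M]
    (F : (x : M) → TangentSpace (𝓡 2) x → ℝ) (p q : M) : ℝ :=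
  sInf {L : ℝ | ∃ γ : ℝ → M, ContMDiffOn 𝓘(ℝ, ℝ) (𝓡 2) 1 γ (Icc 0 1) ∧ γ 0 = p ∧ γ 1 = q ∧
    L = ∫ t in (0 : ℝ)..1,
      F (γ t) (mfderivWithin 𝓘(ℝ, ℝ) (𝓡 2) γ (Icc 0 1) t (1 : ℝ))}

/-- The triangular function `T(p, q, r) = d(p, q) + d(q, r) - d(p, r)`. -/
def triangular {M : Type*} [TopologicalSpace M] [ChartedSpace Plane M]
    (F : (x : M) → TangentSpace (𝓡 2) x → ℝ) (p q r : M) : ℝ :=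
  finslerDist F p q + finslerDist F q r - finslerDist F p r

/-- An almost isometry: a diffeomorphism between open subsets (`φ.source` and `φ.target`) which
preserves the triangular function. -/
def IsAlmostIsometry {M : Type*} [TopologicalSpace M] [ChartedSpace Plane M]
    (F : (x : M) → TangentSpace (𝓡 2) x → ℝ) (φ : OpenPartialHomeomorph M M) : Prop :=
  ContMDiffOn (𝓡 2) (𝓡 2) ∞ φ φ.source ∧ ContMDiffOn (𝓡 2) (𝓡 2) ∞ φ.symm φ.target ∧
    ∀ p ∈ φ.source, ∀ q ∈ φ.source, ∀ r ∈ φ.source,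
      triangular F p q r = triangular F (φ p) (φ q) (φ r)

/-- `K` is an almost Killing vector field on the open set `U`: it is smooth and its local flow
acts by almost isometries, that is, each point of `U` has a neighbourhood `W ⊆ U` on which the
flow `Φ t` of `K` is defined for `|t| < ε`, stays in `U`, and is an almost isometry from `W` onto
its image. -/
def IsAlmostKilling {M : Type*} [TopologicalSpace M] [ChartedSpace Plane M]
    [IsManifold (𝓡 2) ∞ M] (F : (x : M) → TangentSpace (𝓡 2) x → ℝ) (U : Opens M)
    (K : (x : U) → TangentSpace (𝓡 2) (x : M)) : Prop :=
  ContMDiff (𝓡 2) (𝓡 2).tangent ∞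
      (fun x : U => (⟨(x : M), K x⟩ : TangentBundle (𝓡 2) M)) ∧
    ∀ x₀ ∈ U, ∃ W : Opens M, x₀ ∈ W ∧ W ≤ U ∧ ∃ ε : ℝ, 0 < ε ∧
      ∃ Φ : ℝ → OpenPartialHomeomorph M M,
        (∀ x ∈ W, Φ 0 x = x) ∧
        (∀ t ∈ Ioo (-ε) ε, ∀ x ∈ W, ∃ h : Φ t x ∈ U,
          HasMFDerivAt 𝓘(ℝ, ℝ) (𝓡 2) (fun s : ℝ => Φ s x) t
            ((1 : ℝ →L[ℝ] ℝ).smulRight (K ⟨Φ t x, h⟩))) ∧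
        ∀ t ∈ Ioo (-ε) ε, (Φ t).source = (W : Set M) ∧ IsAlmostIsometry F (Φ t)

end AlmostKilling

end

/-! The almost Killing fields of `F` are locally the Killing fields of `g`, and a flat connection of
rank 3 counts the latter.

Almost Killing implies Killing. Since d(p,p) = 0, T(p,q,p) = d(p,q) + d(q,p). At small scale d is
the Minkowski norm of `F` at a nearby point (`abs_finslerDist_sub_le`), and the linear term τ
cancels in the symmetrised sum, so T(p,q,p) is to first order twice the g-length of the
displacement. A map preserving T therefore preserves g (`metricForm_eq_of_triangular`).
Differentiating along the flow gives L_K g = 0 (`isKillingOn_of_isAlmostKilling`).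

Killing implies almost Killing. The flow φ of a Killing field preserves g and, being connected to
the identity, also the area form. Since dτ = c·Vol, the form φ*τ − τ is closed, hence equal to df on
a ball (`exists_primitive_pullback`), and φ*F = F + df. Lengths of curves change only by an end
point term. Short distances are approximated by curves that stay in the chart, so d(φp, φq) = d(p,q)
+ f(q) − f(p) (`exists_triangular_flow`), and f telescopes out of T.

Dimension. A Killing field is encoded by its dual 1-form u and the normalised curl w. The triple
(u₀, u₁, w) solves a linear total differential system (`IsKillingOn.killingJet_system`) whose
integrability condition says that the curvature is a constant κ (`IsMetricOn.killingCoeff_flat`).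
The linear Frobenius theorem produces all initial values on a small ball, and uniqueness on
connected sets makes the jet at one point a linear isomorphism onto ℝ³ (`finrank_killingSubmodule`).

The Frobenius theorem and the smoothness of flows are derived from the Picard–Lindelöf theorem and
Gronwall estimates. -/

open scoped Topology

noncomputable section

namespace AlmostKilling

/-! ### Linear total differential equations in Banach spaces -/

section Frobenius

set_option maxSynthPendingDepth 3

variable {E : Type*} [NormedAddCommGroup E] [NormedSpace ℝ E]
  {S : Type*} [NormedAddCommGroup S] [NormedSpace ℝ S]

/-- A solution of a linear total differential equation which vanishes at a point of a connected
open set vanishes on the whole set. -/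
theorem eq_zero_of_hasFDerivAt_flip {Ω : Set E} (hΩ : IsOpen Ω) (hc : IsPreconnected Ω)
    {θ : E → E →L[ℝ] S →L[ℝ] S} (hθ : ContinuousOn θ Ω) {s : E → S}
    (hs : ∀ z ∈ Ω, HasFDerivAt s ((θ z).flip (s z)) z) {p : E} (hp : p ∈ Ω) (hsp : s p = 0) :
    ∀ z ∈ Ω, s z = 0 := by
  have hloc : ∀ q ∈ Ω, s q = 0 → ∀ᶠ z in 𝓝 q, s z = 0 := by
    intro q hq hsq
    have h1 : ∀ᶠ z in 𝓝 q, z ∈ Ω ∧ ‖θ z‖ < ‖θ q‖ + 1 :=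
      (hΩ.eventually_mem hq).and ((hθ.continuousAt (hΩ.mem_nhds hq)).norm.eventually_lt
        continuousAt_const (by simp))
    obtain ⟨r, hr, hball⟩ := Metric.eventually_nhds_iff_ball.1 h1
    refine Metric.eventually_nhds_iff_ball.2 ⟨r, hr, fun z hz => ?_⟩
    have hmem : ∀ t ∈ Icc (0 : ℝ) 1, q + t • (z - q) ∈ Metric.ball q r := fun t ht =>
      (convex_ball q r).add_smul_sub_mem (Metric.mem_ball_self hr) hz ht
    have hder : ∀ t ∈ Icc (0 : ℝ) 1, HasDerivAt (fun t : ℝ => s (q + t • (z - q)))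
        (θ (q + t • (z - q)) (z - q) (s (q + t • (z - q)))) t := by
      intro t ht
      have h2 : HasDerivAt (fun t : ℝ => q + t • (z - q)) (z - q) t := by
        simpa using ((hasDerivAt_id t).smul_const (z - q)).const_add q
      exact (hs _ (hball _ (hmem t ht)).1).comp_hasDerivAt t h2
    have := eq_zero_of_abs_deriv_le_mul_abs_self_of_eq_zero_right
      (f := fun t : ℝ => s (q + t • (z - q)))
      (f' := fun t : ℝ => θ (q + t • (z - q)) (z - q) (s (q + t • (z - q))))
      (K := (‖θ q‖ + 1) * ‖z - q‖) (a := 0) (b := 1)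
      (fun t ht => (hder t ht).continuousAt.continuousWithinAt)
      (fun t ht => (hder t (Ico_subset_Icc_self ht)).hasDerivWithinAt) (by simpa using hsq)
      (fun t ht => by
        refine (ContinuousLinearMap.le_opNorm₂ _ _ _).trans ?_
        gcongr
        exact (hball _ (hmem t (Ico_subset_Icc_self ht))).2.le) 1 (by simp)
    simpa using this
  have hsub := hc.subset_of_closure_inter_subset (u := {z | z ∈ Ω ∧ s z = 0})
    (isOpen_iff_mem_nhds.2 fun q hq => by
      filter_upwards [hΩ.mem_nhds hq.1, hloc q hq.1 hq.2] with z h1 h2 using ⟨h1, h2⟩)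
    ⟨p, hp, hp, hsp⟩ (by
      rintro q ⟨hq, hqΩ⟩
      refine ⟨hqΩ, ?_⟩
      have hcont : ContinuousAt s q := (hs q hqΩ).continuousAt
      by_contra hne
      have := mem_closure_iff_nhds.1 hq _ (hcont.eventually_ne hne)
      obtain ⟨y, hy1, hy2⟩ := this
      exact hy1 hy2.2)
  exact fun z hz => (hsub hz).2

/-- Mean value inequality for f minus its linear part, on the part of U within distance ‖y − x‖ of
x, where the derivative differs from its value at x by at most K‖y − x‖. -/
theorem norm_sub_sub_fderiv_le {F : Type*} [NormedAddCommGroup F] [NormedSpace ℝ F]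
    {f : E → F} {U : Set E} (hU : Convex ℝ U) (hf : ∀ x ∈ U, DifferentiableAt ℝ f x)
    {K : NNReal} (hK : LipschitzOnWith K (fderiv ℝ f) U) {x y : E} (hx : x ∈ U) (hy : y ∈ U) :
    ‖f y - f x - fderiv ℝ f x (y - x)‖ ≤ K * ‖y - x‖ ^ 2 := by
  have hs : Convex ℝ (U ∩ Metric.closedBall x ‖y - x‖) := hU.inter (convex_closedBall _ _)
  have := hs.norm_image_sub_le_of_norm_hasFDerivWithin_le' (f := f) (f' := fderiv ℝ f)
    (φ := fderiv ℝ f x) (C := K * ‖y - x‖) (x := x) (y := y)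
    (fun z hz => (hf z hz.1).hasFDerivAt.hasFDerivWithinAt)
    (fun z hz => by
      have h1 := hK.dist_le_mul z hz.1 x hx
      rw [dist_eq_norm] at h1
      have h2 := mem_closedBall_iff_norm.1 hz.2
      rw [dist_eq_norm] at h1
      exact h1.trans (by gcongr))
    ⟨hx, by simp⟩ ⟨hy, by simp [dist_eq_norm]⟩
  calc _ ≤ _ := this
    _ = _ := by ring

/-- The bound 1/2 lets one Picard–Lindelöf step cover the whole of [0, 1]: on the ball of radius
‖s₀‖ + 1 about s₀ the field is at most (2‖s₀‖ + 1)/2. Gronwall gives a bound that does not depend on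
A. -/
theorem exists_radial_solution [CompleteSpace S] {A : ℝ → S →L[ℝ] S}
    (hA : ContinuousOn A (Icc 0 1)) (hb : ∀ t ∈ Icc (0 : ℝ) 1, ‖A t‖ ≤ 1 / 2) (s₀ : S) :
    ∃ s : ℝ → S, s 0 = s₀ ∧
      (∀ t ∈ Icc (0 : ℝ) 1, HasDerivWithinAt s (A t (s t)) (Icc 0 1) t) ∧
      ∀ t ∈ Icc (0 : ℝ) 1, ‖s t‖ ≤ ‖s₀‖ * Real.exp 1 := by
  have hPL : IsPicardLindelof (fun t x => A t x) (tmin := 0) (tmax := 1) ⟨0, by simp⟩ s₀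
      (‖s₀‖₊ + 1) 0 (‖s₀‖₊ + 1) 1 := by
    constructor
    · intro t ht
      refine LipschitzOnWith.of_dist_le_mul fun x _ y _ => ?_
      rw [dist_eq_norm, dist_eq_norm, ← map_sub]
      refine ((A t).le_opNorm _).trans ?_
      have := hb t ht
      gcongr
      push_cast
      linarith
    · intro x _
      exact hA.clm_apply continuousOn_const
    · intro t ht x hx
      have h1 : ‖x‖ ≤ ‖s₀‖ + (‖s₀‖ + 1) := by
        have := mem_closedBall_iff_norm.1 hx
        have h2 : ‖x‖ ≤ ‖s₀‖ + ‖x - s₀‖ := by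
          simpa using norm_add_le s₀ (x - s₀)
        push_cast at this
        linarith
      calc ‖A t x‖ ≤ ‖A t‖ * ‖x‖ := (A t).le_opNorm _
        _ ≤ 1 / 2 * (‖s₀‖ + (‖s₀‖ + 1)) := by
          gcongr
          exact hb t ht
        _ ≤ _ := by push_cast; linarith [norm_nonneg s₀]
    · simp
  obtain ⟨s, hs0, hs⟩ := hPL.exists_eq_forall_mem_Icc_hasDerivWithinAt₀
  refine ⟨s, hs0, hs, fun t ht => ?_⟩
  have := norm_le_gronwallBound_of_norm_deriv_right_le (f := s) (f' := fun t => A t (s t))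
    (δ := ‖s₀‖) (K := 1 / 2) (ε := 0) (a := 0) (b := 1)
    (fun t ht => (hs t ht).continuousWithinAt)
    (fun t ht => (hs t (Ico_subset_Icc_self ht)).mono_of_mem_nhdsWithin
      (Icc_mem_nhdsGE_of_mem ht)) (by simp only at hs0; rw [hs0])
    (fun t ht => by
      have := hb t (Ico_subset_Icc_self ht)
      rw [add_zero]
      exact ((A t).le_opNorm _).trans (by gcongr)) t ht
  rw [gronwallBound_ε0] at this
  refine this.trans ?_
  gcongr
  simp only [sub_zero]
  linarith [ht.1, ht.2]

set_option maxHeartbeats 1000000 in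
/-- Linear version of the Frobenius theorem: the total differential equation `ds = θ s` can be
solved near `p` with arbitrary initial values if `θ` is flat. -/
theorem exists_hasFDerivAt_flip_of_flat [CompleteSpace S] {θ : E → E →L[ℝ] S →L[ℝ] S} {p : E}
    (hθ : ContDiffAt ℝ 2 θ p)
    (hflat : ∀ᶠ z in 𝓝 p, ∀ a b : E, fderiv ℝ θ z a b + θ z b * θ z a
      = fderiv ℝ θ z b a + θ z a * θ z b) :
    ∀ᶠ r in 𝓝[>] (0 : ℝ), ∀ s₀ : S, ∃ s : E → S, s p = s₀ ∧
      ∀ z ∈ Metric.ball p r, HasFDerivAt s ((θ z).flip (s z)) z := by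
  have hd1 : ContDiffAt ℝ 1 (fderiv ℝ θ) p := hθ.fderiv_right (by norm_num)
  obtain ⟨K, t, ht, hK⟩ := hd1.exists_lipschitzOnWith
  set C : ℝ := ‖θ p‖ + ‖fderiv ℝ θ p‖ + 1 with hC
  have hC0 : 0 < C := by positivity
  have hev : ∀ᶠ z in 𝓝 p, DifferentiableAt ℝ θ z ∧ ‖θ z‖ < C ∧ ‖fderiv ℝ θ z‖ < C ∧ z ∈ t ∧
      ∀ a b : E, fderiv ℝ θ z a b + θ z b * θ z a = fderiv ℝ θ z b a + θ z a * θ z b := by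
    filter_upwards [hθ.eventually (by simp),
      hθ.continuousAt.norm.eventually_lt continuousAt_const
        (show ‖θ p‖ < C by rw [hC]; linarith [norm_nonneg (fderiv ℝ θ p)]),
      hd1.continuousAt.norm.eventually_lt continuousAt_const
        (show ‖fderiv ℝ θ p‖ < C by rw [hC]; linarith [norm_nonneg (θ p)]), ht, hflat]
      with z h1 h2 h3 h4 h5
    exact ⟨h1.differentiableAt (by simp), h2, h3, h4, h5⟩
  obtain ⟨r₀, hr₀, hball⟩ := Metric.eventually_nhds_iff_ball.1 hev
  -- The second bound forces C·r ≤ 1/2, as needed to solve the equation along every ray from p up to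
  -- time 1.
  have hpos : 0 < min r₀ (1 / (2 * C)) := by positivity
  filter_upwards [Ioo_mem_nhdsGT hpos] with r hr s₀
  have hrr : r ≤ r₀ := hr.2.le.trans (min_le_left _ _)
  have hCr : C * r ≤ 1 / 2 := by
    have := hr.2.le.trans (min_le_right _ _)
    rw [le_div_iff₀ (by positivity)] at this
    linarith
  have hsub : Metric.ball p r ⊆ Metric.ball p r₀ := Metric.ball_subset_ball hrr
  have hr0 : 0 < r := hr.1
  have hmem : ∀ z ∈ Metric.ball p r, ∀ t ∈ Icc (0 : ℝ) 1, p + t • (z - p) ∈ Metric.ball p r :=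
    fun z hz t ht => (convex_ball p r).add_smul_sub_mem (Metric.mem_ball_self hr0) hz ht
  have hdc : ∀ (z : E) (t : ℝ), HasDerivAt (fun t : ℝ => p + t • (z - p)) (z - p) t := fun z t => by
    simpa using ((hasDerivAt_id t).smul_const (z - p)).const_add p
  have hnz : ∀ z ∈ Metric.ball p r, ‖z - p‖ ≤ r := fun z hz => (mem_ball_iff_norm.1 hz).le
  have hθn : ∀ z ∈ Metric.ball p r, ∀ t ∈ Icc (0 : ℝ) 1, ∀ y ∈ Metric.ball p r,
      ‖θ (p + t • (z - p)) (y - p)‖ ≤ 1 / 2 := by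
    intro z hz t ht y hy
    refine ((θ _).le_opNorm _).trans (le_trans ?_ hCr)
    gcongr
    · exact (hball _ (hsub (hmem z hz t ht))).2.1.le
    · exact hnz y hy
  have hsol : ∀ z ∈ Metric.ball p r, ∃ s : ℝ → S, s 0 = s₀ ∧
      (∀ t ∈ Icc (0 : ℝ) 1,
        HasDerivWithinAt s (θ (p + t • (z - p)) (z - p) (s t)) (Icc 0 1) t) ∧
      ∀ t ∈ Icc (0 : ℝ) 1, ‖s t‖ ≤ ‖s₀‖ * Real.exp 1 := by
    intro z hz
    refine exists_radial_solution (fun t ht => ?_) (fun t ht => hθn z hz t ht z hz) s₀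
    have h1 : ContinuousAt θ (p + t • (z - p)) :=
      (hball _ (hsub (hmem z hz t ht))).1.continuousAt
    have h2 : ContinuousAt (fun t : ℝ => θ (p + t • (z - p))) t :=
      ContinuousAt.comp (f := fun t : ℝ => p + t • (z - p)) h1 (hdc z t).continuousAt
    exact (h2.clm_apply continuousAt_const).continuousWithinAt
  choose! σ hσ0 hσ hσn using hsol
  -- The candidate solution at z is the time 1 value of the equation solved along the ray from p to
  -- z.
  set B : ℝ := ‖s₀‖ * Real.exp 1 with hB
  have hB0 : 0 ≤ B := by positivity
  have hpp : p ∈ Metric.ball p r := Metric.mem_ball_self hr0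
  refine ⟨fun z => σ z 1, ?_, fun z hz => ?_⟩
  · have h := (convex_Icc (0 : ℝ) 1).norm_image_sub_le_of_norm_hasDerivWithin_le
      (f := σ p) (f' := fun t => θ (p + t • (p - p)) (p - p) (σ p t)) (C := 0)
      (x := 0) (y := 1) (hσ p hpp) (fun t _ => by simp) (by simp) (by simp)
    rw [hσ0 p hpp] at h
    simpa [sub_eq_zero] using h
  set Q : ℝ := K * r * B + C * B + C * r * C * B + C * C * B with hQ
  have hQ0 : 0 ≤ Q := by positivity
  have key : ∀ y ∈ Metric.ball p r, ‖σ y 1 - σ z 1 - (θ z).flip (σ z 1) (y - z)‖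
      ≤ gronwallBound 0 (1 / 2) Q 1 * ‖y - z‖ ^ 2 := by
    intro y hy
    set h : E := y - z with hh
    -- At time t the rays to y and z are t • h apart, so the expected first order difference of the
    -- solutions is t • θ(h)σ. The error e should be quadratic in h.
    set e : ℝ → S := fun t => σ y t - σ z t - t • θ (p + t • (z - p)) h (σ z t) with he
    set e' : ℝ → S := fun t => θ (p + t • (y - p)) (y - p) (σ y t)
      - θ (p + t • (z - p)) (z - p) (σ z t)
      - (t • (fderiv ℝ θ (p + t • (z - p)) (z - p) h (σ z t)
          + θ (p + t • (z - p)) h (θ (p + t • (z - p)) (z - p) (σ z t)))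
        + (1 : ℝ) • θ (p + t • (z - p)) h (σ z t)) with he'
    have hder : ∀ t ∈ Icc (0 : ℝ) 1, HasDerivWithinAt e (e' t) (Icc 0 1) t := by
      intro t ht
      have h1 : HasDerivWithinAt (fun t : ℝ => θ (p + t • (z - p)))
          (fderiv ℝ θ (p + t • (z - p)) (z - p)) (Icc 0 1) t :=
        ((hball _ (hsub (hmem z hz t ht))).1.hasFDerivAt.comp_hasDerivAt t
          (hdc z t)).hasDerivWithinAt
      have h2 : HasDerivWithinAt (fun t : ℝ => θ (p + t • (z - p)) h)
          (fderiv ℝ θ (p + t • (z - p)) (z - p) h) (Icc 0 1) t := by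
        simpa using h1.clm_apply (hasDerivWithinAt_const t _ h)
      have h3 := h2.clm_apply (hσ z hz t ht)
      exact ((hσ y hy t ht).sub (hσ z hz t ht)).sub ((hasDerivWithinAt_id t _).smul h3)
    have hbd : ∀ t ∈ Icc (0 : ℝ) 1, ‖e' t‖ ≤ 1 / 2 * ‖e t‖ + Q * ‖h‖ ^ 2 := by
      intro t ht
      set x := p + t • (z - p) with hx
      have hxm := hmem z hz t ht
      rw [← hx] at hxm
      have hym := hmem y hy t ht
      obtain ⟨-, hx2, hx3, hx4, hx5⟩ := hball x (hsub hxm)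
      have hyx : p + t • (y - p) - x = t • h := by
        rw [hx, hh]; module
      have hflat := congrArg (fun T : S →L[ℝ] S => T (σ z t)) (hx5 (z - p) h)
      simp only [add_apply, mul_apply_eq_comp] at hflat
      have hT := norm_sub_sub_fderiv_le (f := θ) (convex_ball p r)
        (fun u hu => (hball u (hsub hu)).1)
        (hK.mono fun u hu => (hball u (hsub hu)).2.2.2.1) hxm hym
      have hM := (convex_ball p r).norm_image_sub_le_of_norm_fderiv_le (f := θ) (C := C)
        (fun u hu => (hball u (hsub hu)).1) (fun u hu => (hball u (hsub hu)).2.2.1.le) hxm hym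
      rw [hyx] at hT hM
      have ht1 : ‖t • h‖ ≤ ‖h‖ := by
        rw [norm_smul, Real.norm_of_nonneg ht.1]
        exact mul_le_of_le_one_left (norm_nonneg _) ht.2
      set Y := p + t • (y - p) with hY
      -- Flatness swaps the two arguments of the derivative of θ. After that, everything except the
      -- term linear in e is of second order in h, and Gronwall applies.
      have hsplit : e' t = θ Y (y - p) (e t)
          + (θ Y - θ x - fderiv ℝ θ x (t • h)) (y - p) (σ z t)
          + t • (fderiv ℝ θ x h h (σ z t))
          + t • ((θ Y - θ x) (y - p) (θ x h (σ z t)))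
          + t • (θ x h (θ x h (σ z t))) := by
        have hyp : y - p = (z - p) + h := by rw [hh]; abel
        simp only [he', he, ← hx, ← hY]
        rw [hyp, hflat]
        generalize z - p = a
        simp only [map_add, map_sub, map_smul, add_apply, sub_apply, smul_apply]
        module
      have n1 : ‖θ Y (y - p) (e t)‖ ≤ 1 / 2 * ‖e t‖ :=
        ((θ Y (y - p)).le_opNorm _).trans (by gcongr; exact hθn y hy t ht y hy)
      have hσz := hσn z hz t ht
      have n2 : ‖(θ Y - θ x - fderiv ℝ θ x (t • h)) (y - p) (σ z t)‖ ≤ K * ‖h‖ ^ 2 * r * B := by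
        refine (ContinuousLinearMap.le_opNorm₂ _ _ _).trans ?_
        gcongr
        · exact hT.trans (by gcongr)
        · exact hnz y hy
      have n3 : ‖t • (fderiv ℝ θ x h h (σ z t))‖ ≤ C * ‖h‖ * ‖h‖ * B := by
        rw [norm_smul, Real.norm_of_nonneg ht.1]
        refine (mul_le_of_le_one_left (norm_nonneg _) ht.2).trans ?_
        refine (ContinuousLinearMap.le_opNorm₂ _ _ _).trans ?_
        gcongr
        exact ((fderiv ℝ θ x).le_opNorm _).trans (by gcongr)
      have nθ : ‖θ x h‖ ≤ C * ‖h‖ := ((θ x).le_opNorm _).trans (by gcongr)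
      have n0 : ‖θ x h (σ z t)‖ ≤ C * ‖h‖ * B :=
        ((θ x h).le_opNorm _).trans (by gcongr)
      have n4 : ‖t • ((θ Y - θ x) (y - p) (θ x h (σ z t)))‖ ≤ C * ‖h‖ * r * (C * ‖h‖ * B) := by
        rw [norm_smul, Real.norm_of_nonneg ht.1]
        refine (mul_le_of_le_one_left (norm_nonneg _) ht.2).trans ?_
        refine (ContinuousLinearMap.le_opNorm₂ _ _ _).trans ?_
        gcongr
        · exact hM.trans (by gcongr)
        · exact hnz y hy
      have n5 : ‖t • (θ x h (θ x h (σ z t)))‖ ≤ C * ‖h‖ * (C * ‖h‖ * B) := by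
        rw [norm_smul, Real.norm_of_nonneg ht.1]
        refine (mul_le_of_le_one_left (norm_nonneg _) ht.2).trans ?_
        exact ((θ x h).le_opNorm _).trans (by gcongr)
      rw [hsplit]
      calc _ ≤ 1 / 2 * ‖e t‖ + K * ‖h‖ ^ 2 * r * B + C * ‖h‖ * ‖h‖ * B
            + C * ‖h‖ * r * (C * ‖h‖ * B) + C * ‖h‖ * (C * ‖h‖ * B) :=
          norm_add_le_of_le (norm_add_le_of_le (norm_add_le_of_le (norm_add_le_of_le n1 n2) n3)
            n4) n5
        _ = 1 / 2 * ‖e t‖ + Q * ‖h‖ ^ 2 := by rw [hQ]; ring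
    have hgr := norm_le_gronwallBound_of_norm_deriv_right_le (f := e) (f' := e')
      (δ := 0) (K := 1 / 2) (ε := Q * ‖h‖ ^ 2) (a := 0) (b := 1)
      (fun t ht => (hder t ht).continuousWithinAt)
      (fun t ht => (hder t (Ico_subset_Icc_self ht)).mono_of_mem_nhdsWithin
        (Icc_mem_nhdsGE_of_mem ht))
      (by simp [he, hσ0 y hy, hσ0 z hz]) (fun t ht => hbd t (Ico_subset_Icc_self ht)) 1 (by simp)
    have h1 : e 1 = σ y 1 - σ z 1 - (θ z).flip (σ z 1) h := by
      simp [he]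
    rw [h1] at hgr
    refine hgr.trans (le_of_eq ?_)
    rw [gronwallBound_of_K_ne_0 (by norm_num), gronwallBound_of_K_ne_0 (by norm_num)]
    ring_nf
  rw [hasFDerivAt_iff_isLittleO]
  refine Asymptotics.IsBigO.trans_isLittleO (g := fun y => ‖y - z‖ ^ 2) ?_ ?_
  · refine Asymptotics.IsBigO.of_bound (gronwallBound 0 (1 / 2) Q 1) ?_
    filter_upwards [Metric.isOpen_ball.mem_nhds hz] with y hy
    simpa using key y hy
  · have h0 : Filter.Tendsto (fun y : E => y - z) (𝓝 z) (𝓝 0) := by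
      have : ContinuousAt (fun y : E => y - z) z := by fun_prop
      simpa [ContinuousAt] using this
    have h2 := (Asymptotics.isLittleO_norm_pow_id (E' := E) (n := 2) (by norm_num)).comp_tendsto h0
    exact h2

end Frobenius

/-! ### Linear systems for three functions on the plane -/

section PlaneFrobenius

set_option maxSynthPendingDepth 3

theorem fderiv_plane_apply (f : Plane → ℝ) (z v : Plane) :
    fderiv ℝ f z v = v 0 * partialD 0 f z + v 1 * partialD 1 f z := by
  have hv : v = v 0 • EuclideanSpace.single 0 (1 : ℝ) + v 1 • EuclideanSpace.single 1 (1 : ℝ) := by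
    ext i; fin_cases i <;> simp
  conv_lhs => rw [hv]
  simp [partialD]

/-- The elementary matrix-valued 1-forms on the plane. -/
def elemForm (i : Fin 2) (j k : Fin 3) : Plane →L[ℝ] (Fin 3 → ℝ) →L[ℝ] (Fin 3 → ℝ) :=
  (EuclideanSpace.proj i : Plane →L[ℝ] ℝ).smulRight
    ((ContinuousLinearMap.proj k : (Fin 3 → ℝ) →L[ℝ] ℝ).smulRight (Pi.single j (1 : ℝ)))

/-- The matrix-valued 1-form with the given coefficients. -/
def connForm (a : Fin 2 → Fin 3 → Fin 3 → Plane → ℝ) (z : Plane) :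
    Plane →L[ℝ] (Fin 3 → ℝ) →L[ℝ] (Fin 3 → ℝ) :=
  ∑ i, ∑ j, ∑ k, a i j k z • elemForm i j k

theorem connForm_apply (a : Fin 2 → Fin 3 → Fin 3 → Plane → ℝ) (z v : Plane) (s : Fin 3 → ℝ)
    (j : Fin 3) : connForm a z v s j
      = v 0 * ∑ k, a 0 j k z * s k + v 1 * ∑ k, a 1 j k z * s k := by
  have h : ∀ i l k, elemForm i l k v s j = v i * (s k * (Pi.single l (1 : ℝ) : Fin 3 → ℝ) j) :=
    fun i l k => rfl
  have hsum : connForm a z v s j = ∑ i, ∑ l, ∑ k, a i l k z * elemForm i l k v s j := by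
    simp only [connForm, Fin.sum_univ_two, Fin.sum_univ_three]
    rfl
  simp_rw [hsum, h]
  simp only [Fin.sum_univ_two, Fin.sum_univ_three]
  fin_cases j <;> simp <;> ring

variable {a : Fin 2 → Fin 3 → Fin 3 → Plane → ℝ}

theorem contDiffAt_connForm {n : WithTop ℕ∞} {z : Plane}
    (ha : ∀ i j k, ContDiffAt ℝ n (a i j k) z) : ContDiffAt ℝ n (connForm a) z := by
  unfold connForm
  exact ContDiffAt.sum fun i _ => ContDiffAt.sum fun j _ => ContDiffAt.sum fun k _ =>
    (ha i j k).smul contDiffAt_const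

theorem fderiv_connForm {z : Plane} (ha : ∀ i j k, DifferentiableAt ℝ (a i j k) z) (v : Plane) :
    fderiv ℝ (connForm a) z v = connForm (fun i j k z => fderiv ℝ (a i j k) z v) z := by
  have h : HasFDerivAt (connForm a)
      (∑ i, ∑ j, ∑ k, (fderiv ℝ (a i j k) z).smulRight (elemForm i j k)) z := by
    unfold connForm
    exact HasFDerivAt.fun_sum fun i _ => HasFDerivAt.fun_sum fun j _ => HasFDerivAt.fun_sum
      fun k _ => (ha i j k).hasFDerivAt.smul_const _
  rw [h.fderiv]
  simp [connForm, sum_apply]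

theorem hasFDerivAt_of_partialD {s : Plane → Fin 3 → ℝ} {z : Plane}
    (hd : ∀ j, DifferentiableAt ℝ (fun z => s z j) z)
    (hp : ∀ i j, partialD i (fun z => s z j) z = ∑ k, a i j k z * s z k) :
    HasFDerivAt s ((connForm a z).flip (s z)) z := by
  rw [hasFDerivAt_pi']
  intro j
  refine (hd j).hasFDerivAt.congr_fderiv ?_
  ext v
  rw [fderiv_plane_apply, hp, hp]
  simp [connForm_apply]

/-- A solution of a linear system on the plane which vanishes at a point of a connected open set
vanishes on the whole set. -/
theorem eq_zero_of_partialD_eq {Ω : Set Plane} (hΩ : IsOpen Ω) (hc : IsPreconnected Ω)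
    (ha : ∀ i j k, ContinuousOn (a i j k) Ω) {s : Plane → Fin 3 → ℝ}
    (hd : ∀ z ∈ Ω, ∀ j, DifferentiableAt ℝ (fun z => s z j) z)
    (hp : ∀ z ∈ Ω, ∀ i j, partialD i (fun z => s z j) z = ∑ k, a i j k z * s z k)
    {p : Plane} (hpΩ : p ∈ Ω) (hsp : s p = 0) : ∀ z ∈ Ω, s z = 0 := by
  refine eq_zero_of_hasFDerivAt_flip hΩ hc (θ := connForm a) ?_
    (fun z hz => hasFDerivAt_of_partialD (hd z hz) (hp z hz)) hpΩ hsp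
  unfold connForm
  exact continuousOn_finsetSum _ fun i _ => continuousOn_finsetSum _ fun j _ =>
    continuousOn_finsetSum _ fun k _ => (ha i j k).smul continuousOn_const

/-- A flat linear system on the plane can be solved near `p` with arbitrary initial values. -/
theorem exists_partialD_eq {p : Plane} (ha : ∀ i j k, ContDiffAt ℝ 2 (a i j k) p)
    (hflat : ∀ᶠ z in 𝓝 p, ∀ j k,
      partialD 0 (a 1 j k) z + ∑ l, a 1 j l z * a 0 l k z
        = partialD 1 (a 0 j k) z + ∑ l, a 0 j l z * a 1 l k z) :
    ∀ᶠ r in 𝓝[>] (0 : ℝ), ∀ s₀ : Fin 3 → ℝ, ∃ s : Plane → Fin 3 → ℝ, s p = s₀ ∧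
      ∀ z ∈ Metric.ball p r, ∀ j, DifferentiableAt ℝ (fun z => s z j) z ∧
        ∀ i, partialD i (fun z => s z j) z = ∑ k, a i j k z * s z k := by
  have hev : ∀ᶠ z in 𝓝 p, ∀ i j k, DifferentiableAt ℝ (a i j k) z := by
    simp only [Filter.eventually_all]
    intro i j k
    filter_upwards [(ha i j k).eventually (by simp)] with z hz
    exact hz.differentiableAt (by simp)
  have hfl : ∀ᶠ z in 𝓝 p, ∀ u v : Plane,
      fderiv ℝ (connForm a) z u v + connForm a z v * connForm a z u
        = fderiv ℝ (connForm a) z v u + connForm a z u * connForm a z v := by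
    filter_upwards [hev, hflat] with z hz hfl u v
    rw [fderiv_connForm hz, fderiv_connForm hz]
    ext s j
    simp only [add_apply, mul_apply_eq_comp, Pi.add_apply, connForm_apply, fderiv_plane_apply]
    have h := fun k => hfl j k
    simp only [Fin.sum_univ_three] at h ⊢
    -- The curvature is alternating in (u, v), so on the plane the single coefficient identity for
    -- ∂₀, ∂₁ suffices.
    linear_combination (u 0 * v 1 - u 1 * v 0) * (s 0 * h 0 + s 1 * h 1 + s 2 * h 2)
  filter_upwards [exists_hasFDerivAt_flip_of_flat (contDiffAt_connForm ha) hfl] with r hr s₀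
  obtain ⟨s, hs0, hs⟩ := hr s₀
  refine ⟨s, hs0, fun z hz j => ?_⟩
  have h := hasFDerivAt_pi'.1 (hs z hz) j
  refine ⟨h.differentiableAt, fun i => ?_⟩
  rw [partialD, h.fderiv]
  simp only [ContinuousLinearMap.comp_apply, ContinuousLinearMap.flip_apply,
    ContinuousLinearMap.proj_apply, connForm_apply]
  fin_cases i <;> simp

end PlaneFrobenius

/-! ### Global flows of compactly supported fields and their smoothness -/

section Flow

set_option maxSynthPendingDepth 3

universe u

/-- A bounded Lipschitz vector field has global integral curves. -/
theorem exists_global_solution {E : Type u} [NormedAddCommGroup E] [NormedSpace ℝ E]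
    [CompleteSpace E] {f : E → E} {K L : NNReal} (hK : LipschitzWith K f) (hL : ∀ x, ‖f x‖ ≤ L)
    (x : E) : ∃ γ : ℝ → E, γ 0 = x ∧ ∀ t, HasDerivAt γ (f (γ t)) t := by
  have hloc : ∀ n : ℕ, ∃ γ : ℝ → E, γ 0 = x ∧
      ∀ t ∈ Ioo (-((n : ℝ) + 1)) (n + 1), HasDerivAt γ (f (γ t)) t := by
    intro n
    have h0 : (0 : ℝ) ∈ Icc (-((n : ℝ) + 1)) (n + 1) := ⟨by linarith, by positivity⟩
    have hPL : IsPicardLindelof (fun _ => f) (tmin := -((n : ℝ) + 1)) (tmax := n + 1) ⟨0, h0⟩ x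
        (L * (n + 1)) 0 L K :=
      IsPicardLindelof.of_time_independent (fun y _ => hL y) hK.lipschitzOnWith (by simp)
    obtain ⟨γ, hγ0, hγ⟩ := hPL.exists_eq_forall_mem_Icc_hasDerivWithinAt₀
    exact ⟨γ, hγ0, fun t ht => (hγ t (Ioo_subset_Icc_self ht)).hasDerivAt
      (Icc_mem_nhds ht.1 ht.2)⟩
  choose γ hγ0 hγ using hloc
  have heq : ∀ k m : ℕ, k ≤ m → EqOn (γ k) (γ m) (Ioo (-((k : ℝ) + 1)) (k + 1)) := by
    intro k m hkm
    have hkm' : (k : ℝ) ≤ m := by exact_mod_cast hkm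
    refine ODE_solution_unique_of_mem_Ioo (v := fun _ => f) (s := fun _ => univ) (K := K)
      (t₀ := 0) (fun t _ => hK.lipschitzOnWith) ⟨by linarith, by positivity⟩
      (fun t ht => ⟨hγ k t ht, mem_univ _⟩)
      (fun t ht => ⟨hγ m t ⟨by linarith [ht.1], by linarith [ht.2]⟩, mem_univ _⟩)
      (by rw [hγ0, hγ0])
  have hmem : ∀ t : ℝ, t ∈ Ioo (-((⌊|t|⌋₊ : ℝ) + 1)) (⌊|t|⌋₊ + 1) := fun t =>
    abs_lt.1 (Nat.lt_floor_add_one _)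
  -- The index ⌊|t|⌋ names an interval containing t. Points s of that interval have index at most
  -- ⌊|t|⌋, so the nested curves agree there and the glued curve is differentiable.
  refine ⟨fun t => γ ⌊|t|⌋₊ t, hγ0 _, fun t => (hγ _ t (hmem t)).congr_of_eventuallyEq ?_⟩
  filter_upwards [Ioo_mem_nhds (hmem t).1 (hmem t).2] with s hs
  refine heq _ _ ?_ (hmem s)
  have h1 : |s| < ⌊|t|⌋₊ + 1 := abs_lt.2 hs
  have : ⌊|s|⌋₊ < ⌊|t|⌋₊ + 1 := (Nat.floor_lt (abs_nonneg _)).2 (by exact_mod_cast h1)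
  omega

variable {E : Type u} [NormedAddCommGroup E] [NormedSpace ℝ E]

theorem exists_lipschitz_bound [FiniteDimensional ℝ E] {F : Type*} [NormedAddCommGroup F]
    [NormedSpace ℝ F] {f : E → F} (hf : ContDiff ℝ 1 f) (hc : HasCompactSupport f) :
    (∃ K, LipschitzWith K f) ∧ ∃ L : NNReal, ∀ x, ‖f x‖ ≤ L := by
  refine ⟨hf.lipschitzWith_of_hasCompactSupport hc one_ne_zero, ?_⟩
  obtain ⟨C, hC⟩ := hc.exists_bound_of_continuous hf.continuous
  exact ⟨C.toNNReal, fun x => (hC x).trans (Real.le_coe_toNNReal C)⟩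

/-- `ψ` is the flow of the vector field `f`. -/
structure IsFlowOf (ψ : ℝ → E → E) (f : E → E) : Prop where
  zero : ∀ x, ψ 0 x = x
  deriv : ∀ t x, HasDerivAt (fun s => ψ s x) (f (ψ t x)) t

theorem exists_isFlowOf [FiniteDimensional ℝ E] {f : E → E} (hf : ContDiff ℝ 1 f)
    (hc : HasCompactSupport f) : ∃ ψ, IsFlowOf ψ f := by
  have := FiniteDimensional.complete ℝ E
  obtain ⟨⟨K, hK⟩, L, hL⟩ := exists_lipschitz_bound hf hc
  choose γ h0 h using exists_global_solution hK hL
  exact ⟨fun t x => γ x t, h0, fun t x => h x t⟩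

theorem IsFlowOf.eq_of_hasDerivAt {f : E → E} {K : NNReal} (hK : LipschitzWith K f)
    {ψ : ℝ → E → E} (hψ : IsFlowOf ψ f) {γ : ℝ → E} (hγ : ∀ t, HasDerivAt γ (f (γ t)) t) (t : ℝ) :
    γ t = ψ t (γ 0) := by
  have := ODE_solution_unique_univ (v := fun _ => f) (s := fun _ => univ) (K := K) (t₀ := 0)
    (f := γ) (g := fun s => ψ s (γ 0)) (fun t => hK.lipschitzOnWith)
    (fun t => ⟨hγ t, mem_univ _⟩) (fun t => ⟨hψ.deriv t _, mem_univ _⟩) (hψ.zero _).symm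
  exact congrFun this t

theorem IsFlowOf.add {f : E → E} {K : NNReal} (hK : LipschitzWith K f)
    {ψ : ℝ → E → E} (hψ : IsFlowOf ψ f) (s t : ℝ) (x : E) : ψ (s + t) x = ψ s (ψ t x) := by
  have := hψ.eq_of_hasDerivAt hK (γ := fun s => ψ (s + t) x)
    (fun s => (hψ.deriv (s + t) x).comp_add_const s t) s
  simpa using this

theorem IsFlowOf.neg {f : E → E} {ψ : ℝ → E → E} (hψ : IsFlowOf ψ f) :
    IsFlowOf (fun t => ψ (-t)) (fun x => -f x) :=
  ⟨fun x => by simpa using hψ.zero x, fun t x => by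
    have h : HasDerivAt ((fun s => ψ s x) ∘ Neg.neg) (-f (ψ (-t) x)) t := by
      simpa using (hψ.deriv (-t) x).scomp t (hasDerivAt_neg t)
    exact h⟩

/-- The derivative of a flow in the initial value is obtained from the flow of a prolonged vector
field. -/
theorem IsFlowOf.exists_prolongation [FiniteDimensional ℝ E] {f : E → E} (hf : ContDiff ℝ ∞ f)
    (hc : HasCompactSupport f) {ψ : ℝ → E → E} (hψ : IsFlowOf ψ f) (T : ℝ) :
    ∃ (F : E × (E →L[ℝ] E) → E × (E →L[ℝ] E)) (Ψ : ℝ → E × (E →L[ℝ] E) → E × (E →L[ℝ] E)),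
      ContDiff ℝ ∞ F ∧ HasCompactSupport F ∧ IsFlowOf Ψ F ∧ ∀ t ∈ Icc 0 T, ∀ x,
        HasFDerivAt (ψ t) (Ψ t (x, 1)).2 x ∧
        HasDerivAt (fun s => (Ψ s (x, 1)).2) ((fderiv ℝ f (ψ t x)).comp (Ψ t (x, 1)).2) t := by
  have hf1 : ContDiff ℝ ∞ (fderiv ℝ f) := hf.fderiv_right (by simp)
  have hc1 : HasCompactSupport (fderiv ℝ f) := hc.fderiv ℝ
  obtain ⟨⟨K₀, hK₀⟩, -⟩ := exists_lipschitz_bound (hf.of_le (by simp)) hc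
  obtain ⟨⟨K₂, hK₂⟩, K, hK⟩ := exists_lipschitz_bound (hf1.of_le (by simp)) hc1
  -- The prolonged field (f(x), Df(x)∘A) is linear in A, hence not compactly supported. It is cut
  -- off in A beyond radius R, which exceeds the Gronwall bound for the solution starting at A = 1
  -- up to time T. Since χ ≤ 1, that bound also holds for the cut-off field, so the cut-off is never
  -- felt.
  set R : ℝ := Real.exp (K * T) * ‖(1 : E →L[ℝ] E)‖ + 1 with hR
  have hR0 : 0 < R := by positivity
  set χ : ContDiffBump (0 : E →L[ℝ] E) := ⟨R, R + 1, hR0, by linarith⟩ with hχ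
  set F : E × (E →L[ℝ] E) → E × (E →L[ℝ] E) := fun p =>
    χ p.2 • (f p.1, (fderiv ℝ f p.1).comp p.2) with hF
  have hFs : ContDiff ℝ ∞ F := by
    refine (χ.contDiff.comp contDiff_snd).smul ((hf.comp contDiff_fst).prodMk ?_)
    exact (hf1.comp contDiff_fst).clm_comp contDiff_snd
  have hFc : HasCompactSupport F := by
    refine HasCompactSupport.intro (hc.isCompact.prod (isCompact_closedBall (0 : E →L[ℝ] E) (R + 1)))
      fun p hp => ?_
    rw [Set.mem_prod, not_and_or] at hp
    rcases hp with hp | hp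
    · have h1 : f p.1 = 0 := image_eq_zero_of_notMem_tsupport hp
      have h2 : fderiv ℝ f p.1 = 0 :=
        image_eq_zero_of_notMem_tsupport fun h => hp (tsupport_fderiv_subset ℝ h)
      simp [hF, h1, h2]
    · have : χ p.2 = 0 := by
        apply χ.zero_of_le_dist
        simp only [Metric.mem_closedBall, not_le] at hp
        exact hp.le
      simp [hF, this]
  obtain ⟨Ψ, hΨ⟩ := exists_isFlowOf (hFs.of_le (by simp)) hFc
  refine ⟨F, Ψ, hFs, hFc, hΨ, ?_⟩
  have hd1 : ∀ t x, HasDerivAt (fun s => (Ψ s (x, 1)).1) (F (Ψ t (x, 1))).1 t := fun t x =>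
    (hΨ.deriv t (x, 1)).fst
  have hd2 : ∀ t x, HasDerivAt (fun s => (Ψ s (x, 1)).2) (F (Ψ t (x, 1))).2 t := fun t x =>
    (hΨ.deriv t (x, 1)).snd
  have hbd : ∀ x, ∀ t ∈ Icc 0 T, ‖(Ψ t (x, 1)).2‖ ≤ R := by
    intro x t ht
    have := norm_le_gronwallBound_of_norm_deriv_right_le (f := fun s => (Ψ s (x, 1)).2)
      (f' := fun s => (F (Ψ s (x, 1))).2) (δ := ‖(1 : E →L[ℝ] E)‖) (K := K) (ε := 0) (a := 0) (b := T)
      (fun t _ => (hd2 t x).continuousAt.continuousWithinAt)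
      (fun t _ => (hd2 t x).hasDerivWithinAt) (by simp [hΨ.zero])
      (fun t _ => by
        simp only [hF, Prod.smul_snd, norm_smul, add_zero]
        rw [Real.norm_of_nonneg χ.nonneg]
        refine (mul_le_of_le_one_left (norm_nonneg _) χ.le_one).trans ?_
        exact (ContinuousLinearMap.opNorm_comp_le _ _).trans (by gcongr; exact hK _)) t ht
    rw [gronwallBound_ε0, sub_zero] at this
    have h2 : Real.exp (K * t) ≤ Real.exp (K * T) := by
      gcongr
      exact ht.2
    have h3 := mul_le_mul_of_nonneg_left h2 (norm_nonneg (1 : E →L[ℝ] E))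
    linarith
  have hχ1 : ∀ x, ∀ t ∈ Icc 0 T, χ (Ψ t (x, 1)).2 = 1 := fun x t ht =>
    χ.one_of_mem_closedBall (by simpa using hbd x t ht)
  have hX : ∀ x, ∀ t ∈ Icc 0 T, (Ψ t (x, 1)).1 = ψ t x := by
    intro x
    refine ODE_solution_unique (v := fun _ => f) (K := K₀) (fun _ => hK₀)
      (fun t _ => (hd1 t x).continuousAt.continuousWithinAt) (fun t ht => ?_)
      (fun t _ => (hψ.deriv t x).continuousAt.continuousWithinAt)
      (fun t _ => (hψ.deriv t x).hasDerivWithinAt) (by rw [hΨ.zero, hψ.zero])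
    have := (hd1 t x).hasDerivWithinAt (s := Ici t)
    simpa only [hF, hχ1 x t (Ico_subset_Icc_self ht), one_smul] using this
  have hd2' : ∀ x, ∀ t ∈ Icc 0 T,
      HasDerivAt (fun s => (Ψ s (x, 1)).2) ((fderiv ℝ f (ψ t x)).comp (Ψ t (x, 1)).2) t := by
    intro x t ht
    have := hd2 t x
    simpa only [hF, hχ1 x t ht, one_smul, hX x t ht] using this
  intro t ht x
  refine ⟨?_, hd2' x t ht⟩
  have hsep : ∀ y, ∀ s ∈ Icc 0 T, ‖ψ s y - ψ s x‖ ≤ ‖y - x‖ * Real.exp (K₀ * T) := by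
    intro y s hs
    have := dist_le_of_trajectories_ODE (v := fun _ => f) (K := K₀) (f := fun s => ψ s y)
      (g := fun s => ψ s x) (a := 0) (b := T) (δ := ‖y - x‖) (fun _ => hK₀)
      (fun t _ => (hψ.deriv t y).continuousAt.continuousWithinAt)
      (fun t _ => (hψ.deriv t y).hasDerivWithinAt)
      (fun t _ => (hψ.deriv t x).continuousAt.continuousWithinAt)
      (fun t _ => (hψ.deriv t x).hasDerivWithinAt) (by rw [hψ.zero, hψ.zero, dist_eq_norm]) s hs
    rw [dist_eq_norm, sub_zero] at this
    refine this.trans ?_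
    gcongr
    exact hs.2
  set Q : ℝ := K₂ * Real.exp (K₀ * T) ^ 2 with hQ
  have key : ∀ y, ‖ψ t y - ψ t x - (Ψ t (x, 1)).2 (y - x)‖
      ≤ gronwallBound 0 K Q t * ‖y - x‖ ^ 2 := by
    intro y
    -- The error of the linear approximation solves e' = Df(ψ)e up to a Taylor remainder, which is
    -- quadratic in y − x because trajectories separate at most exponentially.
    set e : ℝ → E := fun s => ψ s y - ψ s x - (Ψ s (x, 1)).2 (y - x) with he
    set e' : ℝ → E := fun s => f (ψ s y) - f (ψ s x)
      - fderiv ℝ f (ψ s x) ((Ψ s (x, 1)).2 (y - x)) with he'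
    have hder : ∀ s ∈ Icc 0 T, HasDerivAt e (e' s) s := by
      intro s hs
      have h1 : HasDerivAt (fun s => (Ψ s (x, 1)).2 (y - x))
          (fderiv ℝ f (ψ s x) ((Ψ s (x, 1)).2 (y - x))) s := by
        simpa using (hd2' x s hs).clm_apply (hasDerivAt_const s (y - x))
      exact ((hψ.deriv s y).sub (hψ.deriv s x)).sub h1
    have hb : ∀ s ∈ Icc 0 T, ‖e' s‖ ≤ K * ‖e s‖ + Q * ‖y - x‖ ^ 2 := by
      intro s hs
      have h1 : e' s = fderiv ℝ f (ψ s x) (e s)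
          + (f (ψ s y) - f (ψ s x) - fderiv ℝ f (ψ s x) (ψ s y - ψ s x)) := by
        simp only [he, he', map_sub]
        abel
      have h2 := norm_sub_sub_fderiv_le (f := f) convex_univ
        (fun z _ => (hf.differentiable (by simp)) z) hK₂.lipschitzOnWith
        (mem_univ (ψ s x)) (mem_univ (ψ s y))
      rw [h1]
      refine norm_add_le_of_le (((fderiv ℝ f _).le_opNorm _).trans (by gcongr; exact hK _))
        (h2.trans ?_)
      calc (K₂ : ℝ) * ‖ψ s y - ψ s x‖ ^ 2 ≤ K₂ * (‖y - x‖ * Real.exp (K₀ * T)) ^ 2 := by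
            gcongr
            exact hsep y s hs
        _ = _ := by rw [hQ]; ring
    have hgr := norm_le_gronwallBound_of_norm_deriv_right_le (f := e) (f' := e')
      (δ := 0) (K := K) (ε := Q * ‖y - x‖ ^ 2) (a := 0) (b := T)
      (fun s hs => (hder s hs).continuousAt.continuousWithinAt)
      (fun s hs => (hder s (Ico_subset_Icc_self hs)).hasDerivWithinAt)
      (by simp [he, hψ.zero, hΨ.zero]) (fun s hs => hb s (Ico_subset_Icc_self hs)) t ht
    refine hgr.trans (le_of_eq ?_)
    rw [sub_zero]
    by_cases hK0 : (K : ℝ) = 0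
    · rw [hK0, gronwallBound_K0, gronwallBound_K0]
      ring
    · rw [gronwallBound_of_K_ne_0 hK0, gronwallBound_of_K_ne_0 hK0]
      ring
  rw [hasFDerivAt_iff_isLittleO]
  refine Asymptotics.IsBigO.trans_isLittleO (g := fun y => ‖y - x‖ ^ 2) ?_ ?_
  · refine Asymptotics.IsBigO.of_bound (gronwallBound 0 K Q t) (.of_forall fun y => ?_)
    simpa using key y
  · have h0 : Filter.Tendsto (fun y : E => y - x) (𝓝 x) (𝓝 0) := by
      have : ContinuousAt (fun y : E => y - x) x := by fun_prop
      simpa [ContinuousAt] using this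
    exact (Asymptotics.isLittleO_norm_pow_id (E' := E) (n := 2) (by norm_num)).comp_tendsto h0

/-- The derivative of a flow in its initial value is a component of a flow of the same kind on E ×
L(E, E). The induction on n therefore runs over all spaces at once. -/
theorem IsFlowOf.contDiff_nat (n : ℕ) : ∀ {E : Type u} [NormedAddCommGroup E] [NormedSpace ℝ E]
    [FiniteDimensional ℝ E] {f : E → E}, ContDiff ℝ ∞ f → HasCompactSupport f →
    ∀ {ψ : ℝ → E → E}, IsFlowOf ψ f → ∀ t, 0 ≤ t → ContDiff ℝ n (ψ t) := by
  induction n with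
  | zero =>
    intro E _ _ _ f hf hc ψ hψ t ht
    obtain ⟨F, Ψ, -, -, -, h⟩ := hψ.exists_prolongation hf hc t
    exact contDiff_zero.2 (continuous_iff_continuousAt.2 fun x =>
      (h t ⟨ht, le_rfl⟩ x).1.continuousAt)
  | succ n ih =>
    intro E _ _ _ f hf hc ψ hψ t ht
    obtain ⟨F, Ψ, hF, hFc, hΨ, h⟩ := hψ.exists_prolongation hf hc t
    have hd := fun x => (h t ⟨ht, le_rfl⟩ x).1
    push_cast
    rw [contDiff_succ_iff_fderiv]
    refine ⟨fun x => (hd x).differentiableAt, by simp, ?_⟩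
    have heq : fderiv ℝ (ψ t) = fun x => (Ψ t (x, 1)).2 := funext fun x => (hd x).fderiv
    rw [heq]
    exact contDiff_snd.comp ((ih hF hFc hΨ t ht).comp (contDiff_id.prodMk contDiff_const))

/-- The flow of a smooth vector field with compact support is smooth. -/
theorem IsFlowOf.contDiff [FiniteDimensional ℝ E] {f : E → E} (hf : ContDiff ℝ ∞ f)
    (hc : HasCompactSupport f) {ψ : ℝ → E → E} (hψ : IsFlowOf ψ f) (t : ℝ) :
    ContDiff ℝ ∞ (ψ t) := by
  refine contDiff_infty.2 fun n => ?_
  rcases le_total 0 t with ht | ht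
  · exact hψ.contDiff_nat n hf hc t ht
  · have := hψ.neg.contDiff_nat n hf.neg hc.neg (-t) (by linarith)
    simpa using this

/-- The variational equation. -/
theorem IsFlowOf.hasDerivAt_fderiv [FiniteDimensional ℝ E] {f : E → E} (hf : ContDiff ℝ ∞ f)
    (hc : HasCompactSupport f) {ψ : ℝ → E → E} (hψ : IsFlowOf ψ f) (t : ℝ) (x v : E) :
    HasDerivAt (fun s => fderiv ℝ (ψ s) x v) (fderiv ℝ f (ψ t x) (fderiv ℝ (ψ t) x v)) t := by
  obtain ⟨⟨K, hK⟩, -⟩ := exists_lipschitz_bound (hf.of_le (by simp)) hc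
  have hpos : ∀ t, 0 < t → ∀ x v, HasDerivAt (fun s => fderiv ℝ (ψ s) x v)
      (fderiv ℝ f (ψ t x) (fderiv ℝ (ψ t) x v)) t := by
    intro t ht x v
    obtain ⟨F, Ψ, -, -, -, h⟩ := hψ.exists_prolongation hf hc (t + 1)
    have h1 : HasDerivAt (fun s => (Ψ s (x, 1)).2 v)
        (fderiv ℝ f (ψ t x) ((Ψ t (x, 1)).2 v)) t := by
      simpa using (h t ⟨ht.le, by linarith⟩ x).2.clm_apply (hasDerivAt_const t v)
    rw [(h t ⟨ht.le, by linarith⟩ x).1.fderiv]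
    refine h1.congr_of_eventuallyEq ?_
    filter_upwards [Ioo_mem_nhds ht (lt_add_one t)] with s hs
    rw [(h s ⟨hs.1.le, hs.2.le⟩ x).1.fderiv]
  -- The prolongation only covers nonnegative times. Writing ψ_s = ψ_{s+N} ∘ ψ_{−N} moves the
  -- differentiation in time to t + N > 0.
  set N : ℝ := |t| + 1 with hN
  have hdiff : ∀ s y, DifferentiableAt ℝ (ψ s) y := fun s y =>
    (hψ.contDiff hf hc s).differentiable (by simp) y
  have hcomp : ∀ s, fderiv ℝ (ψ s) x v
      = fderiv ℝ (ψ (s + N)) (ψ (-N) x) (fderiv ℝ (ψ (-N)) x v) := by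
    intro s
    have h1 : ψ s = ψ (s + N) ∘ ψ (-N) := by
      funext y
      rw [Function.comp_apply, ← hψ.add hK]
      simp
    conv_lhs => rw [h1]
    rw [fderiv_comp _ (hdiff _ _) (hdiff _ _)]
    rfl
  have h2 := (hpos (t + N) (by linarith [neg_abs_le t]) (ψ (-N) x)
    (fderiv ℝ (ψ (-N)) x v)).comp_add_const t N
  have h3 : ψ (t + N) (ψ (-N) x) = ψ t x := by
    rw [← hψ.add hK]; simp
  rw [h3, ← hcomp t] at h2
  exact h2.congr_of_eventuallyEq (.of_forall fun s => hcomp s)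

end Flow

/-! ### Calculus of partial derivatives -/

section PartialD

variable {f f' : Plane → ℝ} {z : Plane} (i j : Fin 2)

theorem partialD_add (hf : DifferentiableAt ℝ f z) (hf' : DifferentiableAt ℝ f' z) :
    partialD i (fun w => f w + f' w) z = partialD i f z + partialD i f' z := by
  simp [partialD, fderiv_fun_add hf hf']

theorem partialD_sub (hf : DifferentiableAt ℝ f z) (hf' : DifferentiableAt ℝ f' z) :
    partialD i (fun w => f w - f' w) z = partialD i f z - partialD i f' z := by
  simp [partialD, fderiv_fun_sub hf hf']

theorem partialD_mul (hf : DifferentiableAt ℝ f z) (hf' : DifferentiableAt ℝ f' z) :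
    partialD i (fun w => f w * f' w) z = partialD i f z * f' z + f z * partialD i f' z := by
  simp [partialD, fderiv_fun_mul hf hf']
  ring

theorem partialD_congr (h : f =ᶠ[𝓝 z] f') : partialD i f z = partialD i f' z := by
  rw [partialD, h.fderiv_eq, partialD]

@[simp]
theorem partialD_const (c : ℝ) : partialD i (fun _ => c) z = 0 := by
  simp [partialD]

theorem partialD_neg : partialD i (fun w => -f w) z = -partialD i f z := by
  simp [partialD]

theorem partialD_sqrt (hf : DifferentiableAt ℝ f z) (h0 : 0 < f z) :
    partialD i (fun w => √(f w)) z = partialD i f z / (2 * √(f z)) := by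
  rw [partialD, (hf.hasFDerivAt.sqrt h0.ne').fderiv]
  simp [partialD]
  ring

theorem partialD_div (hf : DifferentiableAt ℝ f z) (hf' : DifferentiableAt ℝ f' z)
    (h0 : f' z ≠ 0) :
    partialD i (fun w => f w / f' w) z
      = (partialD i f z * f' z - f z * partialD i f' z) / f' z ^ 2 := by
  have h1 : HasFDerivAt (fun w => (f' w)⁻¹) (-(f' z ^ 2)⁻¹ • fderiv ℝ f' z) z := by
    exact (hasDerivAt_inv h0).comp_hasFDerivAt z hf'.hasFDerivAt
  have h2 : (fun w => f w / f' w) = fun w => f w * (f' w)⁻¹ := funext fun w => div_eq_mul_inv _ _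
  rw [h2, partialD_mul i hf h1.differentiableAt]
  have h3 : partialD i (fun w => (f' w)⁻¹) z = -(f' z ^ 2)⁻¹ * partialD i f' z := by
    rw [partialD, h1.fderiv]
    simp [partialD]
  rw [h3]
  field_simp
  ring

theorem ContDiffAt.partialD (hf : ContDiffAt ℝ ∞ f z) : ContDiffAt ℝ ∞ (partialD i f) z := by
  unfold AlmostKilling.partialD
  exact (hf.fderiv_right (m := ∞) (by simp)).clm_apply contDiffAt_const

theorem partialD_comm (hf : ContDiffAt ℝ ∞ f z) :
    partialD i (partialD j f) z = partialD j (partialD i f) z := by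
  have h1 : DifferentiableAt ℝ (fderiv ℝ f) z :=
    (hf.fderiv_right (m := ∞) (by simp)).differentiableAt (by simp)
  have h2 : ∀ a b : Fin 2, partialD a (partialD b f) z
      = fderiv ℝ (fderiv ℝ f) z (EuclideanSpace.single a 1) (EuclideanSpace.single b 1) := by
    intro a b
    have h3 : HasFDerivAt (partialD b f)
        ((fderiv ℝ (fderiv ℝ f) z).flip (EuclideanSpace.single b 1)) z := by
      unfold partialD
      simpa using h1.hasFDerivAt.clm_apply (hasFDerivAt_const (EuclideanSpace.single b (1 : ℝ)) z)
    rw [partialD, h3.fderiv]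
    rfl
  rw [h2, h2]
  exact (hf.isSymmSndFDerivAt (by simpa using WithTop.coe_le_coe.2 (le_top (a := (2 : ℕ∞))))).eq _ _

end PartialD

/-! ### Levi-Civita connection and curvature of a planar metric -/

section MetricAlgebra

/-- A smooth Riemannian metric on an open subset of the plane. -/
structure IsMetricOn (G : Plane → Matrix (Fin 2) (Fin 2) ℝ) (Ω : Set Plane) : Prop where
  isOpen : IsOpen Ω
  smooth : ∀ z ∈ Ω, ∀ i j, ContDiffAt ℝ ∞ (fun w => G w i j) z
  symm : ∀ z i j, G z i j = G z j i
  det_pos : ∀ z ∈ Ω, 0 < (G z).det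

variable {G : Plane → Matrix (Fin 2) (Fin 2) ℝ} {Ω : Set Plane}

theorem IsMetricOn.mono (hG : IsMetricOn G Ω) {Ω' : Set Plane} (h : Ω' ⊆ Ω) (ho : IsOpen Ω') :
    IsMetricOn G Ω' :=
  ⟨ho, fun z hz => hG.smooth z (h hz), hG.symm, fun z hz => hG.det_pos z (h hz)⟩

theorem IsMetricOn.differentiableAt (hG : IsMetricOn G Ω) {z : Plane} (hz : z ∈ Ω) (i j : Fin 2) :
    DifferentiableAt ℝ (fun w => G w i j) z :=
  (hG.smooth z hz i j).differentiableAt (by simp)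

theorem IsMetricOn.partialD_symm (hG : IsMetricOn G Ω) (m i j : Fin 2) (z : Plane) :
    partialD m (fun w => G w i j) z = partialD m (fun w => G w j i) z := by
  simp_rw [hG.symm _ i j]

theorem IsMetricOn.det_eq (hG : IsMetricOn G Ω) (z : Plane) :
    (G z).det = G z 0 0 * G z 1 1 - G z 0 1 ^ 2 := by
  rw [Matrix.det_fin_two, hG.symm z 1 0]
  ring

theorem IsMetricOn.contDiffAt_det (hG : IsMetricOn G Ω) {z : Plane} (hz : z ∈ Ω) :
    ContDiffAt ℝ ∞ (fun w => (G w).det) z := by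
  simp_rw [Matrix.det_fin_two]
  have := hG.smooth z hz
  exact ((this 0 0).mul (this 1 1)).sub ((this 0 1).mul (this 1 0))

theorem IsMetricOn.contDiffAt_inv (hG : IsMetricOn G Ω) {z : Plane} (hz : z ∈ Ω) (i j : Fin 2) :
    ContDiffAt ℝ ∞ (fun w => (G w)⁻¹ i j) z := by
  have hd := (hG.contDiffAt_det hz).inv (hG.det_pos z hz).ne'
  have := hG.smooth z hz
  simp_rw [Matrix.inv_def, Matrix.adjugate_fin_two, Ring.inverse_eq_inv', Matrix.smul_apply,
    smul_eq_mul]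
  fin_cases i <;> fin_cases j <;> simp <;>
    first
    | exact hd.mul (this _ _)
    | exact (hd.mul (this _ _)).neg

theorem IsMetricOn.contDiffAt_christoffel (hG : IsMetricOn G Ω) {z : Plane} (hz : z ∈ Ω)
    (k i j : Fin 2) : ContDiffAt ℝ ∞ (christoffel G k i j) z := by
  unfold christoffel
  have h := fun a b c => ContDiffAt.partialD c (hG.smooth z hz a b)
  refine contDiffAt_const.mul (ContDiffAt.sum fun l _ => (hG.contDiffAt_inv hz k l).mul ?_)
  exact ((h _ _ _).add (h _ _ _)).sub (h _ _ _)

theorem IsMetricOn.christoffel_symm (hG : IsMetricOn G Ω) (k i j : Fin 2) (z : Plane) :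
    christoffel G k i j z = christoffel G k j i z := by
  simp only [christoffel]
  congr 1
  refine Finset.sum_congr rfl fun l _ => ?_
  rw [hG.partialD_symm l i j]
  ring

/-- The Christoffel symbols with lowered index. -/
theorem IsMetricOn.sum_mul_christoffel (hG : IsMetricOn G Ω) {z : Plane} (hz : z ∈ Ω)
    (l i j : Fin 2) : G z l 0 * christoffel G 0 i j z + G z l 1 * christoffel G 1 i j z
      = 1 / 2 * (partialD i (fun w => G w j l) z + partialD j (fun w => G w i l) z
          - partialD l (fun w => G w i j) z) := by
  have h : G z * (G z)⁻¹ = 1 :=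
    Matrix.mul_nonsing_inv _ (isUnit_iff_ne_zero.2 (hG.det_pos z hz).ne')
  have e := fun a b => congrFun (congrFun h a) b
  simp only [Matrix.mul_apply, Fin.sum_univ_two] at e
  simp only [christoffel, Fin.sum_univ_two]
  have e0 := e l 0
  have e1 := e l 1
  obtain rfl | rfl : l = 0 ∨ l = 1 := by omega
  · simp at e0 e1 ⊢
    linear_combination (1 / 2) * (partialD i (fun w => G w j 0) z
      + partialD j (fun w => G w i 0) z - partialD 0 (fun w => G w i j) z) * e0
      + (1 / 2) * (partialD i (fun w => G w j 1) z
      + partialD j (fun w => G w i 1) z - partialD 1 (fun w => G w i j) z) * e1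
  · simp at e0 e1 ⊢
    linear_combination (1 / 2) * (partialD i (fun w => G w j 0) z
      + partialD j (fun w => G w i 0) z - partialD 0 (fun w => G w i j) z) * e0
      + (1 / 2) * (partialD i (fun w => G w j 1) z
      + partialD j (fun w => G w i 1) z - partialD 1 (fun w => G w i j) z) * e1

/-- The Levi-Civita connection is metric. -/
theorem IsMetricOn.partialD_eq (hG : IsMetricOn G Ω) {z : Plane} (hz : z ∈ Ω) (m i j : Fin 2) :
    partialD m (fun w => G w i j) z
      = christoffel G 0 m i z * G z 0 j + christoffel G 1 m i z * G z 1 j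
        + (christoffel G 0 m j z * G z i 0 + christoffel G 1 m j z * G z i 1) := by
  have h1 := hG.sum_mul_christoffel hz j m i
  have h2 := hG.sum_mul_christoffel hz i m j
  rw [hG.symm z j 0, hG.symm z j 1] at h1
  rw [hG.partialD_symm m j i, hG.partialD_symm j m i, hG.partialD_symm i m j] at *
  linear_combination -h1 - h2

/-- The lowered curvature is skew in its last two indices: differentiate metric compatibility once
more and use that the second partial derivatives of gᵢⱼ commute. -/
theorem IsMetricOn.riemann_antisymm (hG : IsMetricOn G Ω) {z : Plane} (hz : z ∈ Ω)
    (i j : Fin 2) :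
    G z 0 j * riemannTensor G 0 0 1 i z + G z 1 j * riemannTensor G 1 0 1 i z
      + (G z i 0 * riemannTensor G 0 0 1 j z + G z i 1 * riemannTensor G 1 0 1 j z) = 0 := by
  have hc := fun k a b => (hG.contDiffAt_christoffel hz k a b).differentiableAt (n := ∞) (by simp)
  have hg := fun a b => hG.differentiableAt hz a b
  have hd : ∀ n m, partialD n (partialD m (fun w => G w i j)) z
      = partialD n (christoffel G 0 m i) z * G z 0 j
        + christoffel G 0 m i z * partialD n (fun w => G w 0 j) z
        + (partialD n (christoffel G 1 m i) z * G z 1 j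
        + christoffel G 1 m i z * partialD n (fun w => G w 1 j) z)
        + (partialD n (christoffel G 0 m j) z * G z i 0
        + christoffel G 0 m j z * partialD n (fun w => G w i 0) z
        + (partialD n (christoffel G 1 m j) z * G z i 1
        + christoffel G 1 m j z * partialD n (fun w => G w i 1) z)) := by
    intro n m
    have h1 : partialD m (fun w => G w i j) =ᶠ[𝓝 z] fun z =>
        christoffel G 0 m i z * G z 0 j + christoffel G 1 m i z * G z 1 j
        + (christoffel G 0 m j z * G z i 0 + christoffel G 1 m j z * G z i 1) := by
      filter_upwards [hG.isOpen.mem_nhds hz] with w hw using hG.partialD_eq hw m i j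
    rw [partialD_congr n h1, partialD_add n (((hc _ _ _).fun_mul (hg _ _)).fun_add ((hc _ _ _).fun_mul (hg _ _)))
      (((hc _ _ _).fun_mul (hg _ _)).fun_add ((hc _ _ _).fun_mul (hg _ _))),
      partialD_add n ((hc _ _ _).fun_mul (hg _ _)) ((hc _ _ _).fun_mul (hg _ _)),
      partialD_add n ((hc _ _ _).fun_mul (hg _ _)) ((hc _ _ _).fun_mul (hg _ _)),
      partialD_mul n (hc _ _ _) (hg _ _), partialD_mul n (hc _ _ _) (hg _ _),
      partialD_mul n (hc _ _ _) (hg _ _), partialD_mul n (hc _ _ _) (hg _ _)]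
  have hcomm := partialD_comm 0 1 (hG.smooth z hz i j)
  rw [hd 0 1, hd 1 0] at hcomm
  simp only [riemannTensor, Fin.sum_univ_two]
  have p := fun m a b => hG.partialD_eq hz m a b
  rw [p 0 0 j, p 0 1 j, p 0 i 0, p 0 i 1, p 1 0 j, p 1 1 j, p 1 i 0, p 1 i 1] at hcomm
  have s := fun k => hG.christoffel_symm k 1 0 z
  simp only [s] at hcomm ⊢
  linear_combination hcomm

/-- The curvature tensor of a metric of constant curvature. -/
theorem IsMetricOn.riemann_eq (hG : IsMetricOn G Ω) {z : Plane} (hz : z ∈ Ω) {κ : ℝ}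
    (hκ : sectionalCurvature G z = κ) (k : Fin 2) :
    riemannTensor G 0 0 1 k z = κ * G z 1 k ∧ riemannTensor G 1 0 1 k z = -(κ * G z 0 k) := by
  have hD := hG.det_pos z hz
  rw [sectionalCurvature, div_eq_iff hD.ne', Fin.sum_univ_two] at hκ
  have hDe := hG.det_eq z
  rw [hDe] at hκ hD
  -- Skewness leaves one independent lowered component, and that one is κ·det g. Raising the index
  -- amounts to inverting the metric, here cleared of its denominator det g.
  have a00 := hG.riemann_antisymm hz 0 0
  have a01 := hG.riemann_antisymm hz 0 1
  have a11 := hG.riemann_antisymm hz 1 1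
  have hs := hG.symm z 1 0
  simp only [hs] at hκ a00 a01 a11
  obtain rfl | rfl : k = 0 ∨ k = 1 := by omega
  · rw [hs]
    constructor <;> apply mul_left_cancel₀ hD.ne'
    · linear_combination (G z 1 1 / 2) * a00 - G z 0 1 * a01 + G z 0 1 * hκ
    · linear_combination G z 0 0 * a01 - (G z 0 1 / 2) * a00 - G z 0 0 * hκ
  · constructor <;> apply mul_left_cancel₀ hD.ne'
    · linear_combination G z 1 1 * hκ - (G z 0 1 / 2) * a11
    · linear_combination (G z 0 0 / 2) * a11 - G z 0 1 * hκ

end MetricAlgebra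

/-! ### The prolonged Killing system and its flatness -/

section KillingSystem

/-- The density of the volume form. -/
def volDensity (G : Plane → Matrix (Fin 2) (Fin 2) ℝ) (z : Plane) : ℝ := √(G z).det

/-- The coefficients of the linear system satisfied by `(u₀, u₁, w)`, where `u` is the 1-form dual
to a Killing field and `w` is half its curl. -/
def killingCoeff (G : Plane → Matrix (Fin 2) (Fin 2) ℝ) (κ : ℝ) :
    Fin 2 → Fin 3 → Fin 3 → Plane → ℝ :=
  ![![![christoffel G 0 0 0, christoffel G 1 0 0, fun _ => 0],
      ![christoffel G 0 0 1, christoffel G 1 0 1, volDensity G],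
      ![fun z => κ * G z 1 0 / volDensity G z, fun z => -κ * G z 0 0 / volDensity G z, fun _ => 0]],
    ![![christoffel G 0 1 0, christoffel G 1 1 0, fun z => -volDensity G z],
      ![christoffel G 0 1 1, christoffel G 1 1 1, fun _ => 0],
      ![fun z => κ * G z 1 1 / volDensity G z, fun z => -κ * G z 0 1 / volDensity G z,
        fun _ => 0]]]

variable {G : Plane → Matrix (Fin 2) (Fin 2) ℝ} {Ω : Set Plane}

theorem IsMetricOn.volDensity_pos (hG : IsMetricOn G Ω) {z : Plane} (hz : z ∈ Ω) :
    0 < volDensity G z := Real.sqrt_pos.2 (hG.det_pos z hz)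

theorem IsMetricOn.volDensity_sq (hG : IsMetricOn G Ω) {z : Plane} (hz : z ∈ Ω) :
    volDensity G z ^ 2 = G z 0 0 * G z 1 1 - G z 0 1 ^ 2 := by
  rw [volDensity, Real.sq_sqrt (hG.det_pos z hz).le, hG.det_eq]

theorem IsMetricOn.contDiffAt_volDensity (hG : IsMetricOn G Ω) {z : Plane} (hz : z ∈ Ω) :
    ContDiffAt ℝ ∞ (volDensity G) z :=
  (hG.contDiffAt_det hz).sqrt (hG.det_pos z hz).ne'

/-- The trace identity ∂ᵢ log √(det g) = Γᵏᵢₖ, i.e. the area form is parallel. -/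
theorem IsMetricOn.partialD_volDensity (hG : IsMetricOn G Ω) {z : Plane} (hz : z ∈ Ω)
    (i : Fin 2) : partialD i (volDensity G) z
      = (christoffel G 0 i 0 z + christoffel G 1 i 1 z) * volDensity G z := by
  have hμ := hG.volDensity_pos hz
  have hsq := hG.volDensity_sq hz
  have h1 : volDensity G = fun w => √(G w 0 0 * G w 1 1 - G w 0 1 * G w 0 1) := by
    funext w
    rw [volDensity, hG.det_eq, sq]
  have hg := fun a b => hG.differentiableAt hz a b
  have hpos : 0 < G z 0 0 * G z 1 1 - G z 0 1 * G z 0 1 := by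
    rw [← sq, ← hG.det_eq]
    exact hG.det_pos z hz
  have h2 : √(G z 0 0 * G z 1 1 - G z 0 1 * G z 0 1) = volDensity G z := by rw [h1]
  conv_lhs => rw [h1]
  rw [partialD_sqrt i (((hg _ _).fun_mul (hg _ _)).fun_sub ((hg _ _).fun_mul (hg _ _))) hpos,
    partialD_sub i ((hg _ _).fun_mul (hg _ _)) ((hg _ _).fun_mul (hg _ _)),
    partialD_mul i (hg _ _) (hg _ _), partialD_mul i (hg _ _) (hg _ _), h2,
    div_eq_iff (by positivity), hG.partialD_eq hz, hG.partialD_eq hz, hG.partialD_eq hz]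
  have hs := hG.symm z 1 0
  simp only [hs]
  linear_combination -2 * (christoffel G 0 i 0 z + christoffel G 1 i 1 z) * hsq

theorem IsMetricOn.contDiffAt_killingCoeff (hG : IsMetricOn G Ω) {z : Plane} (hz : z ∈ Ω) (κ : ℝ)
    (i : Fin 2) (j k : Fin 3) : ContDiffAt ℝ ∞ (killingCoeff G κ i j k) z := by
  have hμ := hG.contDiffAt_volDensity hz
  have hμ0 := (hG.volDensity_pos hz).ne'
  have hΓ := hG.contDiffAt_christoffel hz
  have hg := hG.smooth z hz
  have hq : ∀ (c : ℝ) a b, ContDiffAt ℝ ∞ (fun z => c * G z a b / volDensity G z) z :=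
    fun c a b => (contDiffAt_const.mul (hg a b)).div hμ hμ0
  have h0 : ContDiffAt ℝ ∞ (fun _ : Plane => (0 : ℝ)) z := contDiffAt_const
  obtain rfl | rfl : i = 0 ∨ i = 1 := by omega
  all_goals
    obtain rfl | rfl | rfl : j = 0 ∨ j = 1 ∨ j = 2 := by omega
    all_goals
      obtain rfl | rfl | rfl : k = 0 ∨ k = 1 ∨ k = 2 := by omega
      all_goals first | exact hΓ _ _ _ | exact hμ | exact hμ.neg | exact hq _ _ _ | exact h0

theorem IsMetricOn.partialD_quotient (hG : IsMetricOn G Ω) {z : Plane} (hz : z ∈ Ω) (c : ℝ)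
    (n a b : Fin 2) : partialD n (fun z => c * G z a b / volDensity G z) z
      = c * (partialD n (fun z => G z a b) z
          - G z a b * (christoffel G 0 n 0 z + christoffel G 1 n 1 z)) / volDensity G z := by
  have hμ := hG.volDensity_pos hz
  have hd : DifferentiableAt ℝ (volDensity G) z :=
    (hG.contDiffAt_volDensity hz).differentiableAt (by simp)
  have hg := hG.differentiableAt hz a b
  have hc : DifferentiableAt ℝ (fun _ : Plane => c) z := differentiableAt_const c
  rw [partialD_div n (hc.fun_mul hg) hd hμ.ne', partialD_mul n hc hg,
    hG.partialD_volDensity hz, partialD_const]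
  field_simp
  ring

/-- For j, k < 2 the condition is the curvature formula `IsMetricOn.riemann_eq`: the product of the
±√(det g) entries with the κ-entries cancels the curvature of Γ. The entries involving the index 2
express that the metric and the area form are parallel and that κ is constant. -/
theorem IsMetricOn.killingCoeff_flat (hG : IsMetricOn G Ω) {z : Plane} (hz : z ∈ Ω) {κ : ℝ}
    (hκ : sectionalCurvature G z = κ) (j k : Fin 3) :
    partialD 0 (killingCoeff G κ 1 j k) z
        + ∑ l, killingCoeff G κ 1 j l z * killingCoeff G κ 0 l k z
      = partialD 1 (killingCoeff G κ 0 j k) z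
        + ∑ l, killingCoeff G κ 0 j l z * killingCoeff G κ 1 l k z := by
  have hμ := hG.volDensity_pos hz
  have r0 := hG.riemann_eq hz hκ 0
  have r1 := hG.riemann_eq hz hκ 1
  have hv := hG.partialD_volDensity hz
  have hq := hG.partialD_quotient hz
  have hs := hG.symm z 1 0
  have hp := hG.partialD_eq hz
  have hΓ := fun k => hG.christoffel_symm k 1 0
  have hΓ' : ∀ k, christoffel G k 1 0 = christoffel G k 0 1 := fun k => funext fun z => hΓ k z
  simp only [riemannTensor, Fin.sum_univ_two, hΓ'] at r0 r1
  obtain ⟨r00, r10⟩ := r0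
  obtain ⟨r01, r11⟩ := r1
  rw [Fin.sum_univ_three, Fin.sum_univ_three]
  obtain rfl | rfl | rfl : j = 0 ∨ j = 1 ∨ j = 2 := by omega
  all_goals
    obtain rfl | rfl | rfl : k = 0 ∨ k = 1 ∨ k = 2 := by omega
    all_goals
      simp only [killingCoeff, Matrix.cons_val_zero, Matrix.cons_val_one, Matrix.cons_val, hΓ',
        hq, hv, partialD_neg, partialD_const, hp, hs] at r00 r01 r10 r11 ⊢
      field_simp
      first
      | ring1
      | linear_combination r00
      | linear_combination r01
      | linear_combination r10
      | linear_combination r11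
      | linear_combination volDensity G z * r00
      | linear_combination volDensity G z * r01
      | linear_combination volDensity G z * r10
      | linear_combination volDensity G z * r11

end KillingSystem

/-! ### Killing fields as solutions of the flat system -/

section KillingFields

set_option maxSynthPendingDepth 3

/-- The component `(L_k g)ᵢⱼ` of the Lie derivative of the metric. -/
def lieMetric (G : Plane → Matrix (Fin 2) (Fin 2) ℝ) (k : Plane → Plane) (i j : Fin 2)
    (z : Plane) : ℝ :=
  k z 0 * partialD 0 (fun w => G w i j) z + k z 1 * partialD 1 (fun w => G w i j) z
    + (G z 0 j * partialD i (fun w => k w 0) z + G z 1 j * partialD i (fun w => k w 1) z)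
    + (G z i 0 * partialD j (fun w => k w 0) z + G z i 1 * partialD j (fun w => k w 1) z)

/-- `k` is a smooth Killing field of the metric `G` on `Ω`. -/
structure IsKillingOn (G : Plane → Matrix (Fin 2) (Fin 2) ℝ) (k : Plane → Plane) (Ω : Set Plane) :
    Prop where
  smooth : ∀ z ∈ Ω, ContDiffAt ℝ ∞ k z
  lie_eq : ∀ z ∈ Ω, ∀ i j, lieMetric G k i j z = 0

/-- The components of the 1-form dual to a vector field. -/
def lowered (G : Plane → Matrix (Fin 2) (Fin 2) ℝ) (k : Plane → Plane) (j : Fin 2) (z : Plane) :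
    ℝ := G z j 0 * k z 0 + G z j 1 * k z 1

/-- The 1-jet of a Killing field: the dual 1-form and half its curl. -/
def killingJet (G : Plane → Matrix (Fin 2) (Fin 2) ℝ) (k : Plane → Plane) (z : Plane) :
    Fin 3 → ℝ :=
  ![lowered G k 0 z, lowered G k 1 z,
    (partialD 0 (lowered G k 1) z - partialD 1 (lowered G k 0) z) / (2 * volDensity G z)]

variable {G : Plane → Matrix (Fin 2) (Fin 2) ℝ} {Ω : Set Plane} {k : Plane → Plane} {κ : ℝ}

theorem differentiableAt_coord {z : Plane} (hk : ContDiffAt ℝ ∞ k z) (i : Fin 2) :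
    DifferentiableAt ℝ (fun w => k w i) z :=
  ((contDiffAt_piLp 2).1 hk i).differentiableAt (by simp)

theorem IsMetricOn.contDiffAt_lowered (hG : IsMetricOn G Ω) {z : Plane} (hz : z ∈ Ω)
    (hk : ContDiffAt ℝ ∞ k z) (j : Fin 2) : ContDiffAt ℝ ∞ (lowered G k j) z := by
  have hk' := (contDiffAt_piLp 2).1 hk
  exact ((hG.smooth z hz _ _).mul (hk' 0)).add ((hG.smooth z hz _ _).mul (hk' 1))

theorem IsMetricOn.partialD_lowered (hG : IsMetricOn G Ω) {z : Plane} (hz : z ∈ Ω)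
    (hk : ContDiffAt ℝ ∞ k z) (i j : Fin 2) : partialD i (lowered G k j) z
      = partialD i (fun w => G w j 0) z * k z 0 + G z j 0 * partialD i (fun w => k w 0) z
        + (partialD i (fun w => G w j 1) z * k z 1 + G z j 1 * partialD i (fun w => k w 1) z) := by
  have hk' := differentiableAt_coord hk
  have hg := hG.differentiableAt hz
  unfold lowered
  rw [partialD_add i ((hg _ _).fun_mul (hk' _)) ((hg _ _).fun_mul (hk' _)),
    partialD_mul i (hg _ _) (hk' _), partialD_mul i (hg _ _) (hk' _)]

/-- This is L_k g = ∇ᵢuⱼ + ∇ⱼuᵢ for the dual 1-form u, the form in which the Killing equation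
becomes a condition on partial derivatives of u alone. -/
theorem IsMetricOn.lieMetric_eq (hG : IsMetricOn G Ω) {z : Plane} (hz : z ∈ Ω)
    (hk : ContDiffAt ℝ ∞ k z) (i j : Fin 2) : lieMetric G k i j z
      = partialD i (lowered G k j) z + partialD j (lowered G k i) z
        - 2 * (christoffel G 0 i j z * lowered G k 0 z + christoffel G 1 i j z * lowered G k 1 z) := by
  rw [hG.partialD_lowered hz hk, hG.partialD_lowered hz hk, lieMetric, lowered, lowered]
  have h0 := hG.sum_mul_christoffel hz 0 i j
  have h1 := hG.sum_mul_christoffel hz 1 i j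
  rw [hG.symm z 0 j, hG.symm z 1 j]
  have hs := hG.symm z 1 0
  simp only [hs] at h0 h1 ⊢
  linear_combination 2 * k z 0 * h0 + 2 * k z 1 * h1

/-- The jet of a Killing field satisfies a linear system. -/
theorem IsKillingOn.killingJet_system (hG : IsMetricOn G Ω)
    (hκ : ∀ z ∈ Ω, sectionalCurvature G z = κ) (hk : IsKillingOn G k Ω) :
    (∀ z ∈ Ω, ∀ j, DifferentiableAt ℝ (fun z => killingJet G k z j) z) ∧
    ∀ z ∈ Ω, ∀ i j, partialD i (fun z => killingJet G k z j) z
      = ∑ l, killingCoeff G κ i j l z * killingJet G k z l := by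
  have hlow : ∀ z ∈ Ω, ∀ j, ContDiffAt ℝ ∞ (lowered G k j) z := fun z hz j =>
    hG.contDiffAt_lowered hz (hk.smooth z hz) j
  have hsm : ∀ z ∈ Ω, ∀ j, ContDiffAt ℝ ∞ (fun z => killingJet G k z j) z := by
    intro z hz j
    obtain rfl | rfl | rfl : j = 0 ∨ j = 1 ∨ j = 2 := by omega
    · exact hlow z hz 0
    · exact hlow z hz 1
    · exact ((ContDiffAt.partialD 0 (hlow z hz 1)).sub (ContDiffAt.partialD 1 (hlow z hz 0))).div
        (contDiffAt_const.mul (hG.contDiffAt_volDensity hz))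
        (mul_ne_zero two_ne_zero (hG.volDensity_pos hz).ne')
  have hdiff : ∀ z ∈ Ω, ∀ j, DifferentiableAt ℝ (fun z => killingJet G k z j) z := fun z hz j =>
    (hsm z hz j).differentiableAt (by simp)
  -- The Killing equation determines the symmetric part of ∂ᵢuⱼ, and the third jet component is by
  -- definition its skew part.
  have hsys : ∀ i, ∀ j : Fin 2, ∀ z ∈ Ω, partialD i (lowered G k j) z
      = ∑ l, killingCoeff G κ i j.castSucc l z * killingJet G k z l := by
    intro i j z hz
    have h00 := hk.lie_eq z hz 0 0
    have h01 := hk.lie_eq z hz 0 1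
    have h11 := hk.lie_eq z hz 1 1
    rw [hG.lieMetric_eq hz (hk.smooth z hz)] at h00 h01 h11
    have hμ := hG.volDensity_pos hz
    have hΓ : ∀ l, christoffel G l 1 0 z = christoffel G l 0 1 z := fun l =>
      hG.christoffel_symm l 1 0 z
    have hj0 : killingJet G k z 0 = lowered G k 0 z := rfl
    have hj1 : killingJet G k z 1 = lowered G k 1 z := rfl
    have hj2 : volDensity G z * killingJet G k z 2
        = (partialD 0 (lowered G k 1) z - partialD 1 (lowered G k 0) z) / 2 := by
      simp only [killingJet, Matrix.cons_val]
      field_simp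
    rw [Fin.sum_univ_three, hj0, hj1]
    obtain rfl | rfl : i = 0 ∨ i = 1 := by omega
    all_goals
      obtain rfl | rfl : j = 0 ∨ j = 1 := by omega
      all_goals
        simp only [killingCoeff, Fin.castSucc_zero, Fin.castSucc_one,
          Matrix.cons_val_zero, Matrix.cons_val_one, Matrix.cons_val, hΓ]
        linarith
  refine ⟨hdiff, fun z hz i j => ?_⟩
  obtain rfl | rfl | rfl : j = 0 ∨ j = 1 ∨ j = 2 := by omega
  · exact hsys i 0 z hz
  · exact hsys i 1 z hz
  have hμ := hG.volDensity_pos hz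
  have hc := fun i j l => (hG.contDiffAt_killingCoeff hz κ i j l).differentiableAt (n := ∞) (by simp)
  have hexp : ∀ n i (j : Fin 2), partialD n (partialD i (lowered G k j)) z
      = ∑ l, (partialD n (killingCoeff G κ i j.castSucc l) z * killingJet G k z l
        + killingCoeff G κ i j.castSucc l z * partialD n (fun z => killingJet G k z l) z) := by
    intro n i j
    have h1 : partialD i (lowered G k j) =ᶠ[𝓝 z] fun z =>
        killingCoeff G κ i j.castSucc 0 z * killingJet G k z 0
        + killingCoeff G κ i j.castSucc 1 z * killingJet G k z 1
        + killingCoeff G κ i j.castSucc 2 z * killingJet G k z 2 := by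
      filter_upwards [hG.isOpen.mem_nhds hz] with w hw
      rw [hsys i j w hw, Fin.sum_univ_three]
    have hm := fun l => (hc i j.castSucc l).fun_mul (hdiff z hz l)
    rw [partialD_congr n h1, partialD_add n ((hm 0).fun_add (hm 1)) (hm 2),
      partialD_add n (hm 0) (hm 1), partialD_mul n (hc _ _ _) (hdiff z hz _),
      partialD_mul n (hc _ _ _) (hdiff z hz _), partialD_mul n (hc _ _ _) (hdiff z hz _),
      Fin.sum_univ_three]
  -- The equation for w is forced: ∂₀∂₁u₀ = ∂₁∂₀u₀ contains ∂₀w with factor −√(det g), and the same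
  -- identity for u₁ contains ∂₁w. Flatness evaluates all remaining terms.
  have hcomm := fun j : Fin 2 => partialD_comm 0 1 (hlow z hz j)
  have hfl := hG.killingCoeff_flat hz (hκ z hz)
  have hs0 : ∀ i, partialD i (fun z => killingJet G k z 0) z = _ := fun i => hsys i 0 z hz
  have hs1 : ∀ i, partialD i (fun z => killingJet G k z 1) z = _ := fun i => hsys i 1 z hz
  simp only [hexp, Fin.sum_univ_three, hs0, hs1] at hcomm hfl ⊢
  have e002 : killingCoeff G κ 0 0 2 z = 0 := rfl
  have e102 : killingCoeff G κ 1 0 2 z = -volDensity G z := rfl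
  have e012 : killingCoeff G κ 0 1 2 z = volDensity G z := rfl
  have e112 : killingCoeff G κ 1 1 2 z = 0 := rfl
  have c0 := hcomm 0
  have c1 := hcomm 1
  simp only [Fin.castSucc_zero, Fin.castSucc_one, e002, e102, e012, e112] at c0 c1
  have f0 := hfl 0
  have f1 := hfl 1
  simp only [e002, e102, e012, e112] at f0 f1
  have f02 := f0 2
  have f12 := f1 2
  simp only [e002, e102, e012, e112] at f02 f12
  apply mul_left_cancel₀ hμ.ne'
  obtain rfl | rfl : i = 0 ∨ i = 1 := by omega
  · linear_combination -c0 + f0 0 * killingJet G k z 0 + f0 1 * killingJet G k z 1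
      + f02 * killingJet G k z 2
  · linear_combination -c1 + f1 0 * killingJet G k z 0 + f1 1 * killingJet G k z 1
      + f12 * killingJet G k z 2

/-- Bootstrapping: ds = θs expresses the derivative of s through s itself, so each order of
regularity yields the next. -/
theorem contDiffAt_of_system {a : Fin 2 → Fin 3 → Fin 3 → Plane → ℝ} (hΩ : IsOpen Ω)
    (ha : ∀ z ∈ Ω, ∀ i j k, ContDiffAt ℝ ∞ (a i j k) z) {s : Plane → Fin 3 → ℝ}
    (hd : ∀ z ∈ Ω, ∀ j, DifferentiableAt ℝ (fun z => s z j) z)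
    (hp : ∀ z ∈ Ω, ∀ i j, partialD i (fun z => s z j) z = ∑ k, a i j k z * s z k) :
    ∀ z ∈ Ω, ContDiffAt ℝ ∞ s z := by
  have hs : ∀ z ∈ Ω, HasFDerivAt s ((connForm a z).flip (s z)) z := fun z hz =>
    hasFDerivAt_of_partialD (hd z hz) (hp z hz)
  have hcon : ContDiffOn ℝ ∞ (connForm a) Ω := fun z hz =>
    (contDiffAt_connForm (ha z hz)).contDiffWithinAt
  have hn : ∀ n : ℕ, ContDiffOn ℝ n s Ω := by
    intro n
    induction n with
    | zero =>
      exact contDiffOn_zero.2 fun z hz => (hs z hz).continuousAt.continuousWithinAt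
    | succ n ih =>
      push_cast
      rw [contDiffOn_succ_iff_fderiv_of_isOpen hΩ]
      refine ⟨fun z hz => (hs z hz).differentiableAt.differentiableWithinAt, by simp, ?_⟩
      have h1 : ContDiffOn ℝ n (fun z => (connForm a z).flip (s z)) Ω := by
        refine ContDiffOn.clm_apply ?_ ih
        exact ((ContinuousLinearMap.flipₗᵢ ℝ Plane (Fin 3 → ℝ)
          (Fin 3 → ℝ)).toContinuousLinearEquiv.contDiff.comp_contDiffOn (hcon.of_le (mod_cast le_top)))
      exact h1.congr fun z hz => (hs z hz).fderiv
  exact fun z hz => ((contDiffOn_infty.2 hn) z hz).contDiffAt (hΩ.mem_nhds hz)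

/-- The vector field dual to the first two components of `s`. -/
def raised (G : Plane → Matrix (Fin 2) (Fin 2) ℝ) (s : Plane → Fin 3 → ℝ) (z : Plane) : Plane :=
  !₂[(G z 1 1 * s z 0 - G z 0 1 * s z 1) / (G z).det,
    (G z 0 0 * s z 1 - G z 0 1 * s z 0) / (G z).det]

/-- A solution of the linear system is the jet of a Killing field. -/
theorem isKillingOn_raised (hG : IsMetricOn G Ω) {s : Plane → Fin 3 → ℝ}
    (hd : ∀ z ∈ Ω, ∀ j, DifferentiableAt ℝ (fun z => s z j) z)
    (hp : ∀ z ∈ Ω, ∀ i j, partialD i (fun z => s z j) z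
      = ∑ l, killingCoeff G κ i j l z * s z l) :
    IsKillingOn G (raised G s) Ω ∧ ∀ z ∈ Ω, killingJet G (raised G s) z = s z := by
  have hs := contDiffAt_of_system hG.isOpen
    (fun z hz => hG.contDiffAt_killingCoeff hz κ) hd hp
  have hk : ∀ z ∈ Ω, ContDiffAt ℝ ∞ (raised G s) z := by
    intro z hz
    have hs' := contDiffAt_pi.1 (hs z hz)
    have hg := hG.smooth z hz
    have hdet := hG.contDiffAt_det hz
    have hdet0 := (hG.det_pos z hz).ne'
    refine (contDiffAt_piLp 2).2 fun i => ?_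
    obtain rfl | rfl : i = 0 ∨ i = 1 := by omega
    · exact (((hg 1 1).mul (hs' 0)).sub ((hg 0 1).mul (hs' 1))).div hdet hdet0
    · exact (((hg 0 0).mul (hs' 1)).sub ((hg 0 1).mul (hs' 0))).div hdet hdet0
  have hlow0 : ∀ z ∈ Ω, lowered G (raised G s) 0 z = s z 0 := by
    intro z hz
    have hdet := hG.det_eq z
    have hdet0 := (hG.det_pos z hz).ne'
    simp only [lowered, raised, PiLp.toLp_apply, Matrix.cons_val_zero, Matrix.cons_val_one]
    field_simp
    rw [hdet]
    ring
  have hlow1 : ∀ z ∈ Ω, lowered G (raised G s) 1 z = s z 1 := by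
    intro z hz
    have hdet := hG.det_eq z
    have hdet0 := (hG.det_pos z hz).ne'
    have hsy := hG.symm z 1 0
    simp only [lowered, raised, PiLp.toLp_apply, Matrix.cons_val_zero, Matrix.cons_val_one]
    field_simp
    rw [hdet, hsy]
    ring
  have hd0 : ∀ i, ∀ z ∈ Ω, partialD i (lowered G (raised G s) 0) z
      = ∑ l, killingCoeff G κ i 0 l z * s z l := fun i z hz => by
    rw [← hp z hz]
    exact partialD_congr i (by filter_upwards [hG.isOpen.mem_nhds hz] using hlow0)
  have hd1 : ∀ i, ∀ z ∈ Ω, partialD i (lowered G (raised G s) 1) z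
      = ∑ l, killingCoeff G κ i 1 l z * s z l := fun i z hz => by
    rw [← hp z hz]
    exact partialD_congr i (by filter_upwards [hG.isOpen.mem_nhds hz] using hlow1)
  refine ⟨⟨hk, fun z hz i j => ?_⟩, fun z hz => ?_⟩
  · rw [hG.lieMetric_eq hz (hk z hz), hlow0 z hz, hlow1 z hz]
    have hΓ : ∀ l, christoffel G l 1 0 z = christoffel G l 0 1 z := fun l =>
      hG.christoffel_symm l 1 0 z
    obtain rfl | rfl : i = 0 ∨ i = 1 := by omega
    all_goals
      obtain rfl | rfl : j = 0 ∨ j = 1 := by omega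
      all_goals
        simp only [hd0 _ z hz, hd1 _ z hz, Fin.sum_univ_three, killingCoeff,
          Matrix.cons_val_zero, Matrix.cons_val_one, Matrix.cons_val, hΓ]
        ring
  · have hμ := hG.volDensity_pos hz
    have hΓ : ∀ l, christoffel G l 1 0 z = christoffel G l 0 1 z := fun l =>
      hG.christoffel_symm l 1 0 z
    ext j
    obtain rfl | rfl | rfl : j = 0 ∨ j = 1 ∨ j = 2 := by omega
    · exact hlow0 z hz
    · exact hlow1 z hz
    · simp only [killingJet, hd0 _ z hz, hd1 _ z hz, Fin.sum_univ_three, killingCoeff,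
        Matrix.cons_val_zero, Matrix.cons_val_one, Matrix.cons_val, hΓ]
      field_simp
      ring

/-- A Killing field whose jet vanishes at a point of a connected open set vanishes there. -/
theorem IsKillingOn.eq_zero (hG : IsMetricOn G Ω) (hc : IsPreconnected Ω)
    (hκ : ∀ z ∈ Ω, sectionalCurvature G z = κ) (hk : IsKillingOn G k Ω) {q : Plane} (hq : q ∈ Ω)
    (h0 : killingJet G k q = 0) : ∀ z ∈ Ω, k z = 0 := by
  obtain ⟨h1, h2⟩ := hk.killingJet_system hG hκ
  intro z hz
  have h := eq_zero_of_partialD_eq hG.isOpen hc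
    (fun i j l z hz => (hG.contDiffAt_killingCoeff hz κ i j l).continuousAt.continuousWithinAt)
    h1 h2 hq h0 z hz
  have l0 : lowered G k 0 z = 0 := congrFun h 0
  have l1 : lowered G k 1 z = 0 := congrFun h 1
  have hdet := hG.det_pos z hz
  rw [hG.det_eq] at hdet
  have hsy := hG.symm z 1 0
  simp only [lowered] at l0 l1
  rw [hsy] at l1
  ext i
  obtain rfl | rfl : i = 0 ∨ i = 1 := by omega
  · apply mul_left_cancel₀ hdet.ne'
    simp only [PiLp.zero_apply]
    linear_combination G z 1 1 * l0 - G z 0 1 * l1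
  · apply mul_left_cancel₀ hdet.ne'
    simp only [PiLp.zero_apply]
    linear_combination G z 0 0 * l1 - G z 0 1 * l0

/-- On small balls there are Killing fields with arbitrary jet at an arbitrary point. -/
theorem IsMetricOn.exists_isKillingOn (hG : IsMetricOn G Ω)
    (hκ : ∀ z ∈ Ω, sectionalCurvature G z = κ) {p : Plane} (hp : p ∈ Ω) :
    ∀ᶠ r in 𝓝[>] (0 : ℝ), ∀ q ∈ Metric.ball p r, ∀ c : Fin 3 → ℝ,
      ∃ k, IsKillingOn G k (Metric.ball p r) ∧ killingJet G k q = c := by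
  obtain ⟨r₀, hr₀, hball⟩ := Metric.isOpen_iff.1 hG.isOpen p hp
  have hex := exists_partialD_eq (a := killingCoeff G κ) (p := p)
    (fun i j l => (hG.contDiffAt_killingCoeff hp κ i j l).of_le (by
      simpa using WithTop.coe_le_coe.2 (le_top (a := (2 : ℕ∞)))))
    (by filter_upwards [hG.isOpen.mem_nhds hp] with z hz using hG.killingCoeff_flat hz (hκ z hz))
  filter_upwards [hex, Ioo_mem_nhdsGT hr₀] with r hr hr0 q hq c
  have hsub : Metric.ball p r ⊆ Ω := (Metric.ball_subset_ball hr0.2.le).trans hball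
  have hG' := hG.mono hsub Metric.isOpen_ball
  have hpb : p ∈ Metric.ball p r := Metric.mem_ball_self hr0.1
  have hpre : IsPreconnected (Metric.ball p r) := (convex_ball p r).isPreconnected
  choose σ hσ0 hσ using fun i : Fin 3 => hr (Pi.single i 1)
  set sol : (Fin 3 → ℝ) → Plane → Fin 3 → ℝ := fun b z => ∑ i, b i • σ i z with hsol
  have hval : ∀ b z j, sol b z j = b 0 * σ 0 z j + b 1 * σ 1 z j + b 2 * σ 2 z j := fun b z j => by
    simp [hsol, Fin.sum_univ_three]
  have hsold : ∀ b, ∀ z ∈ Metric.ball p r, ∀ j,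
      DifferentiableAt ℝ (fun z => sol b z j) z := by
    intro b z hz j
    simp only [hval]
    have h := fun i => (hσ i z hz j).1
    exact (((h 0).const_mul _).fun_add ((h 1).const_mul _)).fun_add ((h 2).const_mul _)
  have hsolp : ∀ b, ∀ z ∈ Metric.ball p r, ∀ i j, partialD i (fun z => sol b z j) z
      = ∑ l, killingCoeff G κ i j l z * sol b z l := by
    intro b z hz i j
    simp only [hval]
    have h := fun i => (hσ i z hz j).1
    have hc := fun a : ℝ => differentiableAt_const (𝕜 := ℝ) (E := Plane) (x := z) a
    have hm := fun l => (hc (b l)).fun_mul (h l)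
    rw [partialD_add i ((hm 0).fun_add (hm 1)) (hm 2), partialD_add i (hm 0) (hm 1),
      partialD_mul i (hc _) (h _), partialD_mul i (hc _) (h _), partialD_mul i (hc _) (h _),
      (hσ 0 z hz j).2, (hσ 1 z hz j).2, (hσ 2 z hz j).2]
    simp only [partialD_const, Fin.sum_univ_three]
    ring
  -- Frobenius prescribes values at the centre p only. Evaluation at another point q of the ball is
  -- injective on the solutions by uniqueness, hence bijective for dimension reasons. The radius
  -- thus works for all q simultaneously.
  set ev : (Fin 3 → ℝ) →ₗ[ℝ] (Fin 3 → ℝ) :=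
    { toFun := fun b => sol b q
      map_add' := fun b b' => by ext j; simp only [hval, Pi.add_apply]; ring
      map_smul' := fun a b => by
        ext j; simp only [hval, Pi.smul_apply, smul_eq_mul, RingHom.id_apply]; ring } with hev
  have hinj : Function.Injective ev := by
    rw [← LinearMap.ker_eq_bot, LinearMap.ker_eq_bot']
    intro b hb
    have h := eq_zero_of_partialD_eq Metric.isOpen_ball hpre
      (fun i j l z hz =>
        (hG'.contDiffAt_killingCoeff hz κ i j l).continuousAt.continuousWithinAt)
      (hsold b) (hsolp b) hq hb p hpb
    ext j
    have hj := congrFun h j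
    rw [hval, hσ0, hσ0, hσ0] at hj
    fin_cases j <;> simpa using hj
  obtain ⟨b, hb⟩ := (LinearMap.injective_iff_surjective.1 hinj) c
  obtain ⟨hk, hj⟩ := isKillingOn_raised hG' (hsold b) (hsolp b)
  exact ⟨raised G (sol b), hk, by rw [hj q hq]; exact hb⟩

end KillingFields

/-! ### Metric, 1-form and Randers metric in a chart -/

section Charts

set_option maxSynthPendingDepth 3

universe u

variable {M : Type u} [TopologicalSpace M] [ChartedSpace Plane M] [IsManifold (𝓡 2) ∞ M]
  {e : OpenPartialHomeomorph M Plane}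

omit [IsManifold (𝓡 2) ∞ M] in
theorem mdifferentiableAt_chart_symm (he : e ∈ IsManifold.maximalAtlas (𝓡 2) ∞ M) {z : Plane}
    (hz : z ∈ e.target) : MDifferentiableAt (𝓡 2) (𝓡 2) e.symm z :=
  (contMDiffAt_symm_of_mem_maximalAtlas he hz).mdifferentiableAt (by simp)

omit [IsManifold (𝓡 2) ∞ M] in
theorem mdifferentiableAt_chart (he : e ∈ IsManifold.maximalAtlas (𝓡 2) ∞ M) {x : M}
    (hx : x ∈ e.source) : MDifferentiableAt (𝓡 2) (𝓡 2) e x :=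
  (contMDiffAt_of_mem_maximalAtlas he hx).mdifferentiableAt (by simp)

omit [IsManifold (𝓡 2) ∞ M] in
theorem mfderiv_chart_symm (he : e ∈ IsManifold.maximalAtlas (𝓡 2) ∞ M) {z : Plane}
    (hz : z ∈ e.target) (v : Plane) :
    mfderiv (𝓡 2) (𝓡 2) e (e.symm z) (mfderiv (𝓡 2) (𝓡 2) e.symm z v) = v := by
  have h1 := mdifferentiableAt_chart he (e.map_target hz)
  have h2 := mdifferentiableAt_chart_symm he hz
  have h3 := (h1.hasMFDerivAt.comp z h2.hasMFDerivAt).congr_of_eventuallyEq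
    (f₁ := id) (by
      filter_upwards [e.open_target.mem_nhds hz] with w hw
      simp [e.right_inv hw])
  have h4 := hasMFDerivAt_unique h3 (hasMFDerivAt_id z)
  exact congrArg (fun A : Plane →L[ℝ] Plane => A v) h4

omit [IsManifold (𝓡 2) ∞ M] in
theorem mfderiv_symm_chart (he : e ∈ IsManifold.maximalAtlas (𝓡 2) ∞ M) {x : M}
    (hx : x ∈ e.source) (v : TangentSpace (𝓡 2) x) :
    mfderiv (𝓡 2) (𝓡 2) e.symm (e x) (mfderiv (𝓡 2) (𝓡 2) e x v) = v := by
  have h1 := mdifferentiableAt_chart he hx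
  have h2 := mdifferentiableAt_chart_symm he (e.map_source hx)
  have h3 := (h2.hasMFDerivAt.comp x h1.hasMFDerivAt).congr_of_eventuallyEq
    (f₁ := id) (by
      filter_upwards [e.open_source.mem_nhds hx] with w hw
      simp [e.left_inv hw])
  have h4 := hasMFDerivAt_unique h3 (hasMFDerivAt_id x)
  exact congrArg (fun A : Plane →L[ℝ] Plane => A v) h4

/-- The section is the smooth field k followed by the tangent map of the inverse chart. Applied to
constant fields it gives smoothness of the coordinate frame. -/
theorem contMDiffAt_pushforward (he : e ∈ IsManifold.maximalAtlas (𝓡 2) ∞ M) {z : Plane}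
    (hz : z ∈ e.target) {k : Plane → Plane} (hk : ContDiffAt ℝ ∞ k z) :
    ContMDiffAt (𝓡 2) (𝓡 2).tangent ∞
      (fun w => (⟨e.symm w, mfderiv (𝓡 2) (𝓡 2) e.symm w (k w)⟩ : TangentBundle (𝓡 2) M)) z := by
  have h1 := (contMDiffOn_symm_of_mem_maximalAtlas he).contMDiffOn_tangentMapWithin
    (m := ∞) (by simp) e.open_target.uniqueMDiffOn
  have h2 : ContMDiffAt (𝓡 2) (𝓡 2).tangent ∞ (fun w => (⟨w, k w⟩ : TangentBundle (𝓡 2) Plane)) z :=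
    contMDiffAt_vectorSpace_iff_contDiffAt.2 hk
  have h3 : ContMDiffAt (𝓡 2).tangent (𝓡 2).tangent ∞
      (tangentMapWithin (𝓡 2) (𝓡 2) e.symm e.target) (⟨z, k z⟩ : TangentBundle (𝓡 2) Plane) :=
    h1.contMDiffAt ((e.open_target.preimage
      (FiberBundle.continuous_proj Plane (TangentSpace (𝓡 2)))).mem_nhds hz)
  refine (h3.comp z h2).congr_of_eventuallyEq ?_
  filter_upwards [e.open_target.mem_nhds hz] with w hw
  simp only [Function.comp, tangentMapWithin]
  rw [mfderivWithin_of_isOpen e.open_target hw]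

variable (g : SurfaceMetric M) (τ : OneForm M)

theorem contDiffAt_metricMatrix (he : e ∈ IsManifold.maximalAtlas (𝓡 2) ∞ M) {z : Plane}
    (hz : z ∈ e.target) (i j : Fin 2) :
    ContDiffAt ℝ ∞ (fun w => metricMatrix g e w i j) z := by
  have h : ∀ i, ContMDiffAt (𝓡 2) (𝓡 2).tangent ∞
      (fun w => (⟨e.symm w, coordVec e i w⟩ : TangentBundle (𝓡 2) M)) z := fun i =>
    contMDiffAt_pushforward he hz (k := fun _ => EuclideanSpace.single i (1 : ℝ)) contDiffAt_const
  have h2 := ((g.contMDiff (e.symm z)).comp z (contMDiffAt_symm_of_mem_maximalAtlas he hz))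
  have h3 := ContMDiffAt.clm_bundle_apply₂ (F₁ := Plane) (F₂ := Plane) (F₃ := ℝ)
    (E₃ := Bundle.Trivial M ℝ) h2 (h i) (h j)
  have h4 := (Bundle.contMDiffAt_totalSpace).1 h3
  exact contMDiffAt_iff_contDiffAt.1 h4.2

theorem contDiffAt_formCoeff (he : e ∈ IsManifold.maximalAtlas (𝓡 2) ∞ M) {z : Plane}
    (hz : z ∈ e.target) (i : Fin 2) :
    ContDiffAt ℝ ∞ (formCoeff τ e i) z := by
  have h : ContMDiffAt (𝓡 2) (𝓡 2).tangent ∞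
      (fun w => (⟨e.symm w, coordVec e i w⟩ : TangentBundle (𝓡 2) M)) z :=
    contMDiffAt_pushforward he hz (k := fun _ => EuclideanSpace.single i (1 : ℝ)) contDiffAt_const
  have h2 := ((τ.contMDiff_toFun (e.symm z)).comp z (contMDiffAt_symm_of_mem_maximalAtlas he hz))
  have h3 := ContMDiffAt.clm_bundle_apply (F₁ := Plane) (F₂ := ℝ)
    (E₂ := Bundle.Trivial M ℝ) h2 h
  have h4 := (Bundle.contMDiffAt_totalSpace).1 h3
  exact contMDiffAt_iff_contDiffAt.1 h4.2

/-- The inner product of tangent vectors in coordinates. -/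
def metricForm (G : Plane → Matrix (Fin 2) (Fin 2) ℝ) (z v w : Plane) : ℝ :=
  v 0 * (w 0 * G z 0 0 + w 1 * G z 0 1) + v 1 * (w 0 * G z 1 0 + w 1 * G z 1 1)

/-- The Randers metric in coordinates. -/
def chartRanders (G : Plane → Matrix (Fin 2) (Fin 2) ℝ) (a : Fin 2 → Plane → ℝ) (z v : Plane) :
    ℝ := √(metricForm G z v v) + (v 0 * a 0 z + v 1 * a 1 z)

/-- The coordinate data `(G, a)` of a Randers metric on an open set. -/
structure IsRandersOn (G : Plane → Matrix (Fin 2) (Fin 2) ℝ) (a : Fin 2 → Plane → ℝ)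
    (Ω : Set Plane) : Prop where
  metric : IsMetricOn G Ω
  smooth : ∀ z ∈ Ω, ∀ i, ContDiffAt ℝ ∞ (a i) z
  form_pos : ∀ z ∈ Ω, ∀ v, v ≠ 0 → 0 < metricForm G z v v
  pos : ∀ z ∈ Ω, ∀ v, v ≠ 0 → 0 < chartRanders G a z v

theorem plane_eq_sum (v : Plane) :
    v = v 0 • EuclideanSpace.single 0 (1 : ℝ) + v 1 • EuclideanSpace.single 1 (1 : ℝ) := by
  ext i
  obtain rfl | rfl : i = 0 ∨ i = 1 := by omega
  all_goals simp

theorem inner_mfderiv_symm (z v w : Plane) :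
    g.inner (e.symm z) (mfderiv (𝓡 2) (𝓡 2) e.symm z v) (mfderiv (𝓡 2) (𝓡 2) e.symm z w)
      = metricForm (metricMatrix g e) z v w := by
  have h : ∀ v : Plane, (mfderiv (𝓡 2) (𝓡 2) e.symm z v : TangentSpace (𝓡 2) (e.symm z))
      = v 0 • coordVec e 0 z + v 1 • coordVec e 1 z := fun v => by
    conv_lhs => rw [plane_eq_sum v]
    exact (map_add _ _ _).trans (congrArg₂ _ (map_smul _ _ _) (map_smul _ _ _))
  rw [h v, h w]
  simp only [map_add, map_smul, add_apply, smul_apply, smul_eq_mul]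
  simp only [metricForm, metricMatrix, Matrix.of_apply]
  ring

theorem form_mfderiv_symm (z v : Plane) :
    τ (e.symm z) (mfderiv (𝓡 2) (𝓡 2) e.symm z v)
      = v 0 * formCoeff τ e 0 z + v 1 * formCoeff τ e 1 z := by
  have h : (mfderiv (𝓡 2) (𝓡 2) e.symm z v : TangentSpace (𝓡 2) (e.symm z))
      = v 0 • coordVec e 0 z + v 1 • coordVec e 1 z := by
    conv_lhs => rw [plane_eq_sum v]
    exact (map_add _ _ _).trans (congrArg₂ _ (map_smul _ _ _) (map_smul _ _ _))
  rw [h, map_add, map_smul, map_smul]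
  rfl

theorem randers_mfderiv_symm (z v : Plane) :
    randers g τ (e.symm z) (mfderiv (𝓡 2) (𝓡 2) e.symm z v)
      = chartRanders (metricMatrix g e) (formCoeff τ e) z v := by
  rw [randers, inner_mfderiv_symm, form_mfderiv_symm, chartRanders]

theorem randers_eq_chartRanders (he : e ∈ IsManifold.maximalAtlas (𝓡 2) ∞ M) {x : M}
    (hx : x ∈ e.source) (v : TangentSpace (𝓡 2) x) : randers g τ x v
      = chartRanders (metricMatrix g e) (formCoeff τ e) (e x) (mfderiv (𝓡 2) (𝓡 2) e x v) := by
  -- Parametrising x by z avoids transporting v between the tangent spaces at `e.symm (e x)` and at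
  -- x. What is left are identities of linear maps on the model plane.
  obtain ⟨z, hz, rfl⟩ : ∃ z ∈ e.target, e.symm z = x := ⟨e x, e.map_source hx, e.left_inv hx⟩
  have h := mfderiv_symm_chart he hx v
  have h' : (mfderiv (𝓡 2) (𝓡 2) e.symm z (mfderiv (𝓡 2) (𝓡 2) e (e.symm z) v : Plane) :
      TangentSpace (𝓡 2) (e.symm z)) = v := by
    have h2 : ∀ y, y = z → (mfderiv (𝓡 2) (𝓡 2) e.symm y : Plane →L[ℝ] Plane)
      = (mfderiv (𝓡 2) (𝓡 2) e.symm z : Plane →L[ℝ] Plane) := by rintro _ rfl; rfl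
    refine Eq.trans ?_ h
    exact (congrArg (fun A : Plane →L[ℝ] Plane => A (mfderiv (𝓡 2) (𝓡 2) e (e.symm z) v))
      (h2 _ (e.right_inv hz))).symm
  have h3 := randers_mfderiv_symm (e := e) g τ z (mfderiv (𝓡 2) (𝓡 2) e (e.symm z) v : Plane)
  rw [h'] at h3
  rw [h3]
  exact congrArg (fun y => chartRanders (metricMatrix g e) (formCoeff τ e) y
    (mfderiv (𝓡 2) (𝓡 2) e (e.symm z) v : Plane)) (e.right_inv hz).symm

theorem isMetricOn_metricMatrix (he : e ∈ IsManifold.maximalAtlas (𝓡 2) ∞ M) :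
    IsMetricOn (metricMatrix g e) e.target ∧
      ∀ z ∈ e.target, ∀ v, v ≠ 0 → 0 < metricForm (metricMatrix g e) z v v := by
  have hs : ∀ z i j, metricMatrix g e z i j = metricMatrix g e z j i := fun z i j => g.symm _ _ _
  have hpos : ∀ z ∈ e.target, ∀ v, v ≠ 0 → 0 < metricForm (metricMatrix g e) z v v := by
    intro z hz v hv
    rw [← inner_mfderiv_symm]
    refine g.pos _ _ fun h0 => hv ?_
    rw [← mfderiv_chart_symm he hz v, h0]
    exact map_zero _
  refine ⟨⟨e.open_target, fun z hz i j => contDiffAt_metricMatrix g he hz i j, hs,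
    fun z hz => ?_⟩, hpos⟩
  have h0 := hpos z hz (EuclideanSpace.single 0 1) (by simp)
  simp only [metricForm, PiLp.single_apply] at h0
  norm_num at h0
  -- On the vector (−g₀₁, g₀₀) the quadratic form takes the value g₀₀·det g.
  have h1 := hpos z hz (!₂[-metricMatrix g e z 0 1, metricMatrix g e z 0 0]) (by
    intro h
    have := congrArg (fun v : Plane => v 1) h
    simp at this
    exact h0.ne' this)
  simp only [metricForm] at h1
  simp at h1
  rw [Matrix.det_fin_two]
  rw [hs z 1 0] at h1 ⊢
  nlinarith [pos_of_mul_pos_right (a := metricMatrix g e z 0 0)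
    (b := metricMatrix g e z 0 0 * metricMatrix g e z 1 1
      - metricMatrix g e z 0 1 * metricMatrix g e z 0 1) (by linarith) h0.le]

/-- An unbounded set of reals has `sSup` equal to 0, so boundedness is needed before |τ| < 1 says
anything about τ. It comes from the boundedness of the open unit ball of g. -/
theorem bddAbove_oneFormNorm (x : M) :
    BddAbove {s : ℝ | ∃ v : TangentSpace (𝓡 2) x, g.inner x v v ≤ 1 ∧ s = |τ x v|} := by
  have h1 : Bornology.IsVonNBounded ℝ (τ x '' {v | g.inner x v v < 1}) :=
    (g.isVonNBounded x).image (τ x)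
  rw [NormedSpace.isVonNBounded_iff, isBounded_iff_forall_norm_le] at h1
  obtain ⟨C, hC⟩ := h1
  -- The factor 2 passes from the open unit ball to the closed one by halving the vector.
  refine ⟨2 * C, ?_⟩
  rintro s ⟨v, hv, rfl⟩
  have := hC (τ x ((1 / 2 : ℝ) • v)) ⟨_, by
    simp only [mem_ofPred_eq, map_smul, smul_apply, smul_eq_mul]
    nlinarith, rfl⟩
  rw [map_smul, norm_smul, Real.norm_eq_abs (τ x v)] at this
  norm_num at this
  linarith

theorem randers_pos (hτ : ∀ x : M, oneFormNorm g τ x < 1) {x : M} {v : TangentSpace (𝓡 2) x}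
    (hv : v ≠ 0) : 0 < randers g τ x v := by
  have h0 := g.pos x v hv
  set r := √(g.inner x v v) with hr
  have hr0 : 0 < r := Real.sqrt_pos.2 h0
  have hrr : r * r = g.inner x v v := Real.mul_self_sqrt h0.le
  have h1 : |τ x (r⁻¹ • v)| ≤ oneFormNorm g τ x := by
    refine le_csSup (bddAbove_oneFormNorm g τ x) ⟨r⁻¹ • v, ?_, rfl⟩
    simp only [map_smul, smul_apply, smul_eq_mul, ← hrr]
    field_simp
    exact le_refl _
  have h2 := h1.trans_lt (hτ x)
  rw [map_smul, smul_eq_mul, abs_mul, abs_of_pos (inv_pos.2 hr0), inv_mul_lt_iff₀ hr0] at h2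
  rw [randers, ← hr]
  linarith [neg_abs_le (τ x v)]

theorem randers_nonneg (hτ : ∀ x : M, oneFormNorm g τ x < 1) (x : M) (v : TangentSpace (𝓡 2) x) :
    0 ≤ randers g τ x v := by
  by_cases hv : v = 0
  · subst hv
    simp [randers]
  · exact (randers_pos g τ hτ hv).le

theorem isRandersOn_chart (hτ : ∀ x : M, oneFormNorm g τ x < 1)
    (he : e ∈ IsManifold.maximalAtlas (𝓡 2) ∞ M) :
    IsRandersOn (metricMatrix g e) (formCoeff τ e) e.target where
  metric := (isMetricOn_metricMatrix g he).1
  smooth z hz i := contDiffAt_formCoeff τ he hz i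
  form_pos := (isMetricOn_metricMatrix g he).2
  pos z hz v hv := by
    rw [← randers_mfderiv_symm]
    refine randers_pos g τ hτ fun h0 => hv ?_
    rw [← mfderiv_chart_symm he hz v, h0]
    exact map_zero _

end Charts

/-! ### Estimates for the Randers norm in coordinates -/

section ChartRanders

variable {G : Plane → Matrix (Fin 2) (Fin 2) ℝ} {a : Fin 2 → Plane → ℝ} {Ω : Set Plane}

theorem metricForm_smul_smul (s : ℝ) (z v : Plane) :
    metricForm G z (s • v) (s • v) = s ^ 2 * metricForm G z v v := by
  simp [metricForm]
  ring

theorem chartRanders_smul {s : ℝ} (hs : 0 ≤ s) (z v : Plane) :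
    chartRanders G a z (s • v) = s * chartRanders G a z v := by
  rw [chartRanders, metricForm_smul_smul, Real.sqrt_mul (sq_nonneg s), Real.sqrt_sq hs,
    chartRanders]
  simp
  ring

theorem continuousAt_coord_snd (i : Fin 2) (p : Plane × Plane) :
    ContinuousAt (fun p : Plane × Plane => p.2 i) p :=
  ((EuclideanSpace.proj i : Plane →L[ℝ] ℝ).continuous.comp continuous_snd).continuousAt

theorem IsMetricOn.continuousAt_metricForm (hG : IsMetricOn G Ω) {z : Plane} (hz : z ∈ Ω)
    (v : Plane) : ContinuousAt (fun p : Plane × Plane => metricForm G p.1 p.2 p.2) (z, v) := by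
  have h : ∀ i j, ContinuousAt (fun p : Plane × Plane => G p.1 i j) (z, v) := fun i j =>
    ContinuousAt.comp (g := fun w => G w i j) (f := Prod.fst) (hG.smooth z hz i j).continuousAt
      continuousAt_fst
  have h0 := h 0 0
  have h1 := h 0 1
  have h2 := h 1 0
  have h3 := h 1 1
  have hv0 := continuousAt_coord_snd 0 (z, v)
  have hv1 := continuousAt_coord_snd 1 (z, v)
  exact (hv0.mul ((hv0.mul h0).add (hv1.mul h1))).add (hv1.mul ((hv0.mul h2).add (hv1.mul h3)))

theorem IsRandersOn.continuousAt (h : IsRandersOn G a Ω) {z : Plane} (hz : z ∈ Ω) (v : Plane) :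
    ContinuousAt (fun p : Plane × Plane => chartRanders G a p.1 p.2) (z, v) := by
  have ha : ∀ i, ContinuousAt (fun p : Plane × Plane => a i p.1) (z, v) := fun i =>
    ContinuousAt.comp (g := fun w => a i w) (f := Prod.fst) (h.smooth z hz i).continuousAt
      continuousAt_fst
  have h0 := ha 0
  have h1 := ha 1
  have h2 := h.metric.continuousAt_metricForm hz v
  have hv0 := continuousAt_coord_snd 0 (z, v)
  have hv1 := continuousAt_coord_snd 1 (z, v)
  exact h2.sqrt.add ((hv0.mul h0).add (hv1.mul h1))

theorem IsRandersOn.nonneg (h : IsRandersOn G a Ω) {z : Plane} (hz : z ∈ Ω) (v : Plane) :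
    0 ≤ chartRanders G a z v := by
  by_cases hv : v = 0
  · subst hv
    simp [chartRanders, metricForm]
  · exact (h.pos z hz v hv).le

/-- By positive homogeneity only unit vectors matter, and joint continuity is uniform on the compact
unit sphere. -/
theorem IsRandersOn.eventually_abs_sub_le (h : IsRandersOn G a Ω) {z₀ : Plane} (hz : z₀ ∈ Ω)
    {η : ℝ} (hη : 0 < η) : ∀ᶠ z in 𝓝 z₀, ∀ v,
      |chartRanders G a z v - chartRanders G a z₀ v| ≤ η * ‖v‖ := by
  have h1 : ∀ᶠ z in 𝓝 z₀, ∀ v ∈ Metric.sphere (0 : Plane) 1,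
      |chartRanders G a z v - chartRanders G a z₀ v| < η := by
    refine (isCompact_sphere (0 : Plane) 1).eventually_forall_of_forall_eventually fun v _ => ?_
    have h2 : ContinuousAt (fun p : Plane × Plane => chartRanders G a z₀ p.2) (z₀, v) :=
      ContinuousAt.comp (g := fun p : Plane × Plane => chartRanders G a p.1 p.2)
        (f := fun p : Plane × Plane => (z₀, p.2)) (x := (z₀, v)) (h.continuousAt hz v) (by fun_prop)
    have h3 := ((h.continuousAt hz v).sub h2).abs
    exact h3.eventually_lt continuousAt_const (by simpa using hη)
  filter_upwards [h1] with z hz v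
  rcases eq_or_ne v 0 with rfl | hv
  · simp [chartRanders, metricForm]
  · have hn : 0 < ‖v‖ := norm_pos_iff.2 hv
    have h4 := hz (‖v‖⁻¹ • v) (by simp [norm_smul, hn.ne'])
    rw [chartRanders_smul (by positivity), chartRanders_smul (by positivity), ← mul_sub, abs_mul,
      abs_of_pos (inv_pos.2 hn), inv_mul_lt_iff₀ hn] at h4
    linarith

/-- Extrema on the unit sphere bound the norm at z₀; moving the base point costs at most m/2. -/
theorem IsRandersOn.exists_bounds (h : IsRandersOn G a Ω) {z₀ : Plane} (hz : z₀ ∈ Ω) :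
    ∃ m L : ℝ, 0 < m ∧ 0 < L ∧ ∀ᶠ z in 𝓝 z₀, ∀ v,
      m * ‖v‖ ≤ chartRanders G a z v ∧ chartRanders G a z v ≤ L * ‖v‖ := by
  have hc : ContinuousOn (fun v => chartRanders G a z₀ v) (Metric.sphere (0 : Plane) 1) :=
    fun v _ => (ContinuousAt.comp (g := fun p : Plane × Plane => chartRanders G a p.1 p.2)
      (f := fun v : Plane => (z₀, v)) (x := v) (h.continuousAt hz v)
        (by fun_prop)).continuousWithinAt
  have hne : (Metric.sphere (0 : Plane) 1).Nonempty :=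
    ⟨EuclideanSpace.single 0 1, by simp⟩
  obtain ⟨v₁, hv₁, h₁⟩ := (isCompact_sphere (0 : Plane) 1).exists_isMinOn hne hc
  obtain ⟨v₂, hv₂, h₂⟩ := (isCompact_sphere (0 : Plane) 1).exists_isMaxOn hne hc
  have hp : ∀ v ∈ Metric.sphere (0 : Plane) 1, 0 < chartRanders G a z₀ v := fun v hv =>
    h.pos z₀ hz v fun h0 => by simp [h0] at hv
  have hm := hp v₁ hv₁
  have hM := hp v₂ hv₂
  set m := chartRanders G a z₀ v₁
  set L := chartRanders G a z₀ v₂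
  refine ⟨m / 2, L + m / 2, by positivity, by positivity, ?_⟩
  filter_upwards [h.eventually_abs_sub_le hz (half_pos hm)] with z hz v
  have h3 := abs_le.1 (hz v)
  have h4 : m * ‖v‖ ≤ chartRanders G a z₀ v ∧ chartRanders G a z₀ v ≤ L * ‖v‖ := by
    rcases eq_or_ne v 0 with rfl | hv
    · simp [chartRanders, metricForm]
    · have hn : 0 < ‖v‖ := norm_pos_iff.2 hv
      have h5 : ‖v‖⁻¹ • v ∈ Metric.sphere (0 : Plane) 1 := by simp [norm_smul, hn.ne']
      have h6 := h₁ h5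
      have h7 := h₂ h5
      simp only [mem_ofPred_eq] at h6 h7
      rw [chartRanders_smul (by positivity)] at h6 h7
      rw [← div_eq_inv_mul, le_div_iff₀ hn] at h6
      rw [← div_eq_inv_mul, div_le_iff₀ hn] at h7
      exact ⟨h6, h7⟩
  constructor <;> linarith [h4.1, h4.2, h3.1, h3.2]

/-- The Gram determinant identity. It yields Cauchy–Schwarz, and later the Jacobian of a map that
preserves the metric. -/
theorem IsMetricOn.metricForm_mul_sub_sq (hG : IsMetricOn G Ω) (z v w : Plane) :
    metricForm G z v v * metricForm G z w w - metricForm G z v w ^ 2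
      = (G z).det * (v 0 * w 1 - v 1 * w 0) ^ 2 := by
  rw [Matrix.det_fin_two]
  simp only [metricForm]
  rw [hG.symm z 1 0]
  ring

/-- The norm is convex, and its supporting functional at v is g(v, ·)/|v| + τ, by Cauchy–Schwarz.
Such functionals bound lengths of curves from below. -/
theorem IsRandersOn.exists_support (h : IsRandersOn G a Ω) {z : Plane} (hz : z ∈ Ω) (v : Plane) :
    ∃ ℓ : Plane →L[ℝ] ℝ, ℓ v = chartRanders G a z v ∧ ∀ w, ℓ w ≤ chartRanders G a z w := by
  rcases eq_or_ne v 0 with rfl | hv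
  · exact ⟨0, by simp [chartRanders, metricForm], fun w => h.nonneg hz w⟩
  have h0 := h.form_pos z hz v hv
  set r := √(metricForm G z v v) with hr
  have hr0 : 0 < r := Real.sqrt_pos.2 h0
  have hrr : r * r = metricForm G z v v := Real.mul_self_sqrt h0.le
  let c : Fin 2 → ℝ := fun j => (v 0 * G z 0 j + v 1 * G z 1 j) / r + a j z
  refine ⟨c 0 • EuclideanSpace.proj 0 + c 1 • EuclideanSpace.proj 1, ?_, fun w => ?_⟩
  · simp only [add_apply, smul_apply, PiLp.proj_apply, smul_eq_mul, c]
    rw [chartRanders, ← hr]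
    have h1 : metricForm G z v v / r = r := by rw [← hrr, mul_div_cancel_right₀ _ hr0.ne']
    conv_rhs => rw [← h1, metricForm]
    ring
  · have h1 : (c 0 • EuclideanSpace.proj 0 + c 1 • EuclideanSpace.proj 1 : Plane →L[ℝ] ℝ) w
        = metricForm G z v w / r + (w 0 * a 0 z + w 1 * a 1 z) := by
      simp only [add_apply, smul_apply, PiLp.proj_apply, smul_eq_mul, c, metricForm]
      ring
    rw [h1, chartRanders, add_le_add_iff_right, div_le_iff₀ hr0]
    rw [hr, ← Real.sqrt_mul' _ h0.le]
    refine Real.le_sqrt_of_sq_le ?_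
    have h2 := h.metric.metricForm_mul_sub_sq z v w
    have h3 := mul_nonneg (h.metric.det_pos z hz).le (sq_nonneg (v 0 * w 1 - v 1 * w 0))
    linarith

end ChartRanders

/-! ### Lengths of curves and confinement to a chart -/

section Curves

set_option maxSynthPendingDepth 3

universe u

variable {M : Type u} [TopologicalSpace M] [ChartedSpace Plane M] [IsManifold (𝓡 2) ∞ M]
  {e : OpenPartialHomeomorph M Plane} {g : SurfaceMetric M} {τ : OneForm M}

/-- The velocity of a curve defined on `[0, 1]`. -/
def velocity (γ : ℝ → M) (t : ℝ) : TangentSpace (𝓡 2) (γ t) :=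
  mfderivWithin 𝓘(ℝ, ℝ) (𝓡 2) γ (Icc 0 1) t (1 : ℝ)

theorem continuousOn_randers_velocity {γ : ℝ → M}
    (hγ : ContMDiffOn 𝓘(ℝ, ℝ) (𝓡 2) 1 γ (Icc 0 1)) :
    ContinuousOn (fun t => randers g τ (γ t) (velocity γ t)) (Icc 0 1) := by
  have h1 := hγ.contMDiffOn_tangentMapWithin (m := 0) (by simp)
    (uniqueDiffOn_Icc zero_lt_one).uniqueMDiffOn
  have h2 : ContMDiff 𝓘(ℝ, ℝ) 𝓘(ℝ, ℝ).tangent 0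
      (fun t : ℝ => (⟨t, (1 : ℝ)⟩ : TangentBundle 𝓘(ℝ, ℝ) ℝ)) :=
    contMDiff_vectorSpace_iff_contDiff.2 contDiff_const
  have h3 : ContMDiffOn 𝓘(ℝ, ℝ) (𝓡 2).tangent 0
      (fun t => (⟨γ t, velocity γ t⟩ : TangentBundle (𝓡 2) M)) (Icc 0 1) :=
    h1.comp h2.contMDiffOn (fun t ht => ht)
  have hγ0 := hγ.of_le (m := 0) (by simp)
  intro t ht
  have h5 := ((g.contMDiff (γ t)).of_le (m := 0) (by simp)).comp_contMDiffWithinAt t (hγ0 t ht)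
  have h6 := ContMDiffWithinAt.clm_bundle_apply₂ (F₁ := Plane) (F₂ := Plane) (F₃ := ℝ)
    (E₃ := Bundle.Trivial M ℝ) h5 (h3 t ht) (h3 t ht)
  have h7 := ((Bundle.contMDiffWithinAt_totalSpace).1 h6).2.continuousWithinAt
  have h8 := ((τ.contMDiff_toFun (γ t)).of_le (m := 0) (by simp)).comp_contMDiffWithinAt t (hγ0 t ht)
  have h9 := ContMDiffWithinAt.clm_bundle_apply (F₁ := Plane) (F₂ := ℝ)
    (E₂ := Bundle.Trivial M ℝ) h8 (h3 t ht)
  have h10 := ((Bundle.contMDiffWithinAt_totalSpace).1 h9).2.continuousWithinAt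
  exact h7.sqrt.add h10

omit [IsManifold (𝓡 2) ∞ M] in
theorem hasDerivWithinAt_chart_comp (he : e ∈ IsManifold.maximalAtlas (𝓡 2) ∞ M) {γ : ℝ → M}
    (hγ : ContMDiffOn 𝓘(ℝ, ℝ) (𝓡 2) 1 γ (Icc 0 1)) {t : ℝ} (ht : t ∈ Icc (0 : ℝ) 1)
    (hs : γ t ∈ e.source) :
    HasDerivWithinAt (fun s => e (γ s)) (mfderiv (𝓡 2) (𝓡 2) e (γ t) (velocity γ t) : Plane)
      (Icc 0 1) t := by
  have h1 := ((hγ t ht).mdifferentiableWithinAt (by simp)).hasMFDerivWithinAt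
  have h2 := (mdifferentiableAt_chart he hs).hasMFDerivAt.comp_hasMFDerivWithinAt t h1
  have h3 : HasFDerivWithinAt (fun s => e (γ s))
      ((mfderiv (𝓡 2) (𝓡 2) e (γ t) : Plane →L[ℝ] Plane).comp
        (mfderivWithin 𝓘(ℝ, ℝ) (𝓡 2) γ (Icc 0 1) t : ℝ →L[ℝ] Plane)) (Icc 0 1) t :=
    hasMFDerivWithinAt_iff_hasFDerivWithinAt.1 h2
  have h4 : ∀ (c : ℝ → Plane) (A : ℝ →L[ℝ] Plane), HasFDerivWithinAt c A (Icc 0 1) t →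
      HasDerivWithinAt c (A 1) (Icc 0 1) t := fun _ _ h => h.hasDerivWithinAt
  exact h4 _ _ h3

/-- Calibration: the derivative of ℓ along the curve is at most the speed. -/
theorem le_integral_randers (he : e ∈ IsManifold.maximalAtlas (𝓡 2) ∞ M) {γ : ℝ → M}
    (hγ : ContMDiffOn 𝓘(ℝ, ℝ) (𝓡 2) 1 γ (Icc 0 1)) {t₁ : ℝ} (ht₁ : t₁ ∈ Icc (0 : ℝ) 1)
    (hs : ∀ t ∈ Icc 0 t₁, γ t ∈ e.source) (ℓ : Plane →L[ℝ] ℝ)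
    (hℓ : ∀ t ∈ Icc 0 t₁, ∀ v,
      ℓ v ≤ chartRanders (metricMatrix g e) (formCoeff τ e) (e (γ t)) v) :
    ℓ (e (γ t₁) - e (γ 0)) ≤ ∫ t in (0 : ℝ)..t₁, randers g τ (γ t) (velocity γ t) := by
  have hsub : Icc 0 t₁ ⊆ Icc (0 : ℝ) 1 := Icc_subset_Icc_right ht₁.2
  have hd : ∀ t ∈ Icc 0 t₁, HasDerivWithinAt (fun s => ℓ (e (γ s)))
      (ℓ (mfderiv (𝓡 2) (𝓡 2) e (γ t) (velocity γ t) : Plane)) (Icc 0 1) t := fun t ht =>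
    ℓ.hasFDerivAt.comp_hasDerivWithinAt t (hasDerivWithinAt_chart_comp he hγ (hsub ht) (hs t ht))
  rw [map_sub]
  refine intervalIntegral.sub_le_integral_of_hasDeriv_right_of_le (g := fun s => ℓ (e (γ s)))
    (g' := fun t => ℓ (mfderiv (𝓡 2) (𝓡 2) e (γ t) (velocity γ t) : Plane)) ht₁.1
    (fun t ht => ((hd t ht).mono hsub).continuousWithinAt) (fun t ht => ?_)
    ((continuousOn_randers_velocity hγ).mono hsub).integrableOn_Icc (fun t ht => ?_)
  · exact ((hd t (Ioo_subset_Icc_self ht)).hasDerivAt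
      (Icc_mem_nhds ht.1 (ht.2.trans_le ht₁.2))).hasDerivWithinAt
  · rw [randers_eq_chartRanders g τ he (hs t (Ioo_subset_Icc_self ht))]
    exact hℓ t (Ioo_subset_Icc_self ht) _

omit [ChartedSpace Plane M] [IsManifold (𝓡 2) ∞ M] in
-- If the curve does not stay in the ball, take the first time at which it lies outside the
-- corresponding open subset of M.
theorem stays_or_exits [T2Space M] {γ : ℝ → M} (hγ : ContinuousOn γ (Icc 0 1)) {z₀ : Plane} {ρ : ℝ}
    (hρ : Metric.closedBall z₀ ρ ⊆ e.target) (h0 : γ 0 ∈ e.source)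
    (h0' : e (γ 0) ∈ Metric.ball z₀ ρ) :
    (∀ t ∈ Icc (0 : ℝ) 1, γ t ∈ e.source ∧ e (γ t) ∈ Metric.ball z₀ ρ) ∨
      ∃ t₁ ∈ Icc (0 : ℝ) 1, (∀ t ∈ Icc 0 t₁, γ t ∈ e.source ∧ e (γ t) ∈ Metric.closedBall z₀ ρ) ∧
        dist (e (γ t₁)) z₀ = ρ := by
  set B : Set M := e.source ∩ e ⁻¹' Metric.ball z₀ ρ with hB
  have hBo : IsOpen B := e.isOpen_inter_preimage Metric.isOpen_ball
  set S : Set ℝ := Icc (0 : ℝ) 1 ∩ γ ⁻¹' Bᶜ with hS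
  have hSc : IsClosed S := hγ.preimage_isClosed_of_isClosed isClosed_Icc hBo.isClosed_compl
  by_cases hne : S.Nonempty
  · right
    have hbd : BddBelow S := ⟨0, fun t ht => ht.1.1⟩
    set t₁ := sInf S with ht₁
    have h1 : t₁ ∈ S := hSc.csInf_mem hne hbd
    have h2 : ∀ t ∈ Ico 0 t₁, γ t ∈ B := fun t ht => by
      by_contra hc
      exact absurd (csInf_le hbd (⟨⟨ht.1, ht.2.le.trans h1.1.2⟩, hc⟩ : t ∈ S)) (not_le.2 ht.2)
    have hpos : 0 < t₁ := by
      refine lt_of_le_of_ne h1.1.1 fun h => h1.2 ?_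
      rw [← h]
      exact ⟨h0, h0'⟩
    -- In a Hausdorff space the compact preimage of the closed coordinate ball is closed, so the
    -- curve cannot have left the chart domain at the exit time.
    set C : Set M := e.symm '' Metric.closedBall z₀ ρ with hC
    have hCc : IsClosed C := ((isCompact_closedBall z₀ ρ).image_of_continuousOn
      (e.continuousOn_symm.mono hρ)).isClosed
    have hBC : B ⊆ C := fun x hx => ⟨e x, Metric.ball_subset_closedBall hx.2, e.left_inv hx.1⟩
    have hmem : γ t₁ ∈ C := by
      have h3 : t₁ ∈ closure (Ico 0 t₁) := by
        rw [closure_Ico hpos.ne]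
        exact right_mem_Icc.2 hpos.le
      have h4 : ContinuousWithinAt γ (Ico 0 t₁) t₁ := (hγ t₁ h1.1).mono fun t ht =>
        ⟨ht.1, ht.2.le.trans h1.1.2⟩
      exact hCc.closure_subset (h4.mem_closure h3 fun t ht => hBC (h2 t ht))
    have hCs : ∀ x ∈ C, x ∈ e.source ∧ e x ∈ Metric.closedBall z₀ ρ := by
      rintro x ⟨z, hz, rfl⟩
      refine ⟨e.map_target (hρ hz), ?_⟩
      rw [e.right_inv (hρ hz)]
      exact hz
    refine ⟨t₁, h1.1, fun t ht => ?_, ?_⟩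
    · rcases ht.2.eq_or_lt with h | h
      · rw [h]
        exact hCs _ hmem
      · exact hCs _ (hBC (h2 t ⟨ht.1, h⟩))
    · refine le_antisymm (hCs _ hmem).2 ?_
      by_contra hc
      exact h1.2 ⟨(hCs _ hmem).1, not_le.1 hc⟩
  · left
    intro t ht
    by_contra hc
    exact hne ⟨t, ht, hc⟩

theorem IsRandersOn.mono {G : Plane → Matrix (Fin 2) (Fin 2) ℝ} {a : Fin 2 → Plane → ℝ}
    {Ω Ω' : Set Plane} (h : IsRandersOn G a Ω) (hs : Ω' ⊆ Ω) (ho : IsOpen Ω') :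
    IsRandersOn G a Ω' :=
  ⟨h.metric.mono hs ho, fun z hz => h.smooth z (hs hz), fun z hz => h.form_pos z (hs hz),
    fun z hz => h.pos z (hs hz)⟩

theorem integral_randers_nonneg (hτ : ∀ x : M, oneFormNorm g τ x < 1) {γ : ℝ → M} {t : ℝ}
    (ht : 0 ≤ t) : 0 ≤ ∫ t in (0 : ℝ)..t, randers g τ (γ t) (velocity γ t) :=
  intervalIntegral.integral_nonneg ht fun _ _ => randers_nonneg g τ hτ _ _

/-- Reaching the sphere of radius ρ costs length at least m times the coordinate distance to it. -/
theorem curve_mem_ball [T2Space M] (hτ : ∀ x : M, oneFormNorm g τ x < 1)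
    (he : e ∈ IsManifold.maximalAtlas (𝓡 2) ∞ M) {γ : ℝ → M}
    (hγ : ContMDiffOn 𝓘(ℝ, ℝ) (𝓡 2) 1 γ (Icc 0 1)) {z₀ : Plane} {ρ m : ℝ}
    (hρ : Metric.closedBall z₀ ρ ⊆ e.target) (hm : 0 < m)
    (hb : ∀ z ∈ Metric.closedBall z₀ ρ, ∀ v,
      m * ‖v‖ ≤ chartRanders (metricMatrix g e) (formCoeff τ e) z v)
    (h0 : γ 0 ∈ e.source) (h0' : e (γ 0) ∈ Metric.ball z₀ ρ)
    (hl : ∫ t in (0 : ℝ)..1, randers g τ (γ t) (velocity γ t) < m * (ρ - dist (e (γ 0)) z₀)) :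
    ∀ t ∈ Icc (0 : ℝ) 1, γ t ∈ e.source ∧ e (γ t) ∈ Metric.ball z₀ ρ := by
  refine (stays_or_exits hγ.continuousOn hρ h0 h0').resolve_right ?_
  rintro ⟨t₁, ht₁, hst, hd⟩
  -- A norming functional of the coordinate displacement, scaled by m, calibrates the curve up to
  -- its exit time.
  obtain ⟨f, hf1, hf2⟩ := exists_dual_vector'' ℝ (e (γ t₁) - e (γ 0))
  have h1 := le_integral_randers he hγ ht₁ (fun t ht => (hst t ht).1) (m • f) (fun t ht v => by
    refine le_trans ?_ (hb _ (hst t ht).2 v)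
    simp only [smul_apply, smul_eq_mul]
    refine mul_le_mul_of_nonneg_left ?_ hm.le
    exact (le_abs_self _).trans ((f.le_opNorm v).trans
      (mul_le_of_le_one_left (norm_nonneg _) hf1)) : _)
  have h2 : ∫ t in (0 : ℝ)..t₁, randers g τ (γ t) (velocity γ t)
      ≤ ∫ t in (0 : ℝ)..1, randers g τ (γ t) (velocity γ t) := by
    refine intervalIntegral.integral_mono_interval le_rfl ht₁.1 ht₁.2
      (Filter.Eventually.of_forall fun t => randers_nonneg g τ hτ _ _) ?_
    exact (continuousOn_randers_velocity hγ).intervalIntegrable_of_Icc zero_le_one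
  have h3 : (m • f) (e (γ t₁) - e (γ 0)) = m * dist (e (γ t₁)) (e (γ 0)) := by
    rw [smul_apply, hf2, dist_eq_norm]
    rfl
  have h4 := dist_triangle (e (γ t₁)) (e (γ 0)) z₀
  rw [h3] at h1
  have h5 : m * (ρ - dist (e (γ 0)) z₀) ≤ m * dist (e (γ t₁)) (e (γ 0)) :=
    mul_le_mul_of_nonneg_left (by linarith) hm.le
  linarith

end Curves

/-! ### The Finsler distance at small scale -/

section LocalDistance

set_option maxSynthPendingDepth 3

universe u

variable {M : Type u} [TopologicalSpace M] [ChartedSpace Plane M] [IsManifold (𝓡 2) ∞ M]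
  {e : OpenPartialHomeomorph M Plane} {g : SurfaceMetric M} {τ : OneForm M}

theorem finslerDist_le_integral (hτ : ∀ x : M, oneFormNorm g τ x < 1) {γ : ℝ → M}
    (hγ : ContMDiffOn 𝓘(ℝ, ℝ) (𝓡 2) 1 γ (Icc 0 1)) :
    finslerDist (randers g τ) (γ 0) (γ 1)
      ≤ ∫ t in (0 : ℝ)..1, randers g τ (γ t) (velocity γ t) := by
  refine csInf_le ⟨0, ?_⟩ ⟨γ, hγ, rfl, rfl, rfl⟩
  rintro _ ⟨γ, -, -, -, rfl⟩
  exact integral_randers_nonneg hτ zero_le_one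

theorem finslerDist_nonneg (hτ : ∀ x : M, oneFormNorm g τ x < 1) (p q : M) :
    0 ≤ finslerDist (randers g τ) p q := by
  refine Real.sInf_nonneg ?_
  rintro _ ⟨γ, -, -, -, rfl⟩
  exact integral_randers_nonneg hτ zero_le_one

omit [IsManifold (𝓡 2) ∞ M] in
theorem contMDiffOn_symm_comp (he : e ∈ IsManifold.maximalAtlas (𝓡 2) ∞ M) {c : ℝ → Plane}
    (hc : ContDiffOn ℝ 1 c (Icc 0 1)) (hct : ∀ t ∈ Icc (0 : ℝ) 1, c t ∈ e.target) :
    ContMDiffOn 𝓘(ℝ, ℝ) (𝓡 2) 1 (fun t => e.symm (c t)) (Icc 0 1) :=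
  ((contMDiffOn_symm_of_mem_maximalAtlas he).of_le (m := 1) (mod_cast le_top)).comp
    hc.contMDiffOn hct

theorem randers_symm_comp (he : e ∈ IsManifold.maximalAtlas (𝓡 2) ∞ M) {c : ℝ → Plane}
    (hc : ContDiffOn ℝ 1 c (Icc 0 1)) (hct : ∀ t ∈ Icc (0 : ℝ) 1, c t ∈ e.target) {t : ℝ}
    (ht : t ∈ Icc (0 : ℝ) 1) {v : Plane} (hv : HasDerivWithinAt c v (Icc 0 1) t) :
    randers g τ (e.symm (c t)) (velocity (fun t => e.symm (c t)) t)
      = chartRanders (metricMatrix g e) (formCoeff τ e) (c t) v := by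
  have hs := e.map_target (hct t ht)
  rw [randers_eq_chartRanders g τ he hs]
  have h1 := hasDerivWithinAt_chart_comp he (contMDiffOn_symm_comp he hc hct) ht hs
  have h2 : HasDerivWithinAt (fun s => e (e.symm (c s))) v (Icc 0 1) t :=
    hv.congr_of_mem (fun s hs => e.right_inv (hct s hs)) ht
  have h3 := (uniqueDiffOn_Icc zero_lt_one t ht).eq_deriv _ h1 h2
  exact congrArg₂ (chartRanders (metricMatrix g e) (formCoeff τ e)) (e.right_inv (hct t ht)) h3

/-- The coordinate segment is the competitor. Its existence is recorded as well, because it shows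
that the infimum is over a nonempty set. -/
theorem finslerDist_le_of_segment (hτ : ∀ x : M, oneFormNorm g τ x < 1)
    (he : e ∈ IsManifold.maximalAtlas (𝓡 2) ∞ M) {B : Set Plane} (hB : Convex ℝ B)
    (hBt : B ⊆ e.target) {z z' : Plane} (hz : z ∈ B) (hz' : z' ∈ B) {C : ℝ}
    (hC : ∀ w ∈ B, chartRanders (metricMatrix g e) (formCoeff τ e) w (z' - z) ≤ C) :
    finslerDist (randers g τ) (e.symm z) (e.symm z') ≤ C ∧
      ∃ γ : ℝ → M, ContMDiffOn 𝓘(ℝ, ℝ) (𝓡 2) 1 γ (Icc 0 1) ∧ γ 0 = e.symm z ∧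
        γ 1 = e.symm z' := by
  set c : ℝ → Plane := fun t => AffineMap.lineMap z z' t with hcdef
  have hmem : ∀ t ∈ Icc (0 : ℝ) 1, c t ∈ B := fun t ht => hB.lineMap_mem hz hz' ht
  have hd : ∀ t, HasDerivAt c (z' - z) t := fun t => AffineMap.hasDerivAt_lineMap
  have hc : ContDiffOn ℝ 1 c (Icc 0 1) := by
    have : c = fun t => t • (z' - z) + z := by
      ext1 t
      simp [c, AffineMap.lineMap_apply]
    rw [this]
    fun_prop
  have hct : ∀ t ∈ Icc (0 : ℝ) 1, c t ∈ e.target := fun t ht => hBt (hmem t ht)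
  have hγ := contMDiffOn_symm_comp he hc hct
  have h0 : e.symm (c 0) = e.symm z := by simp [c]
  have h1 : e.symm (c 1) = e.symm z' := by simp [c]
  refine ⟨?_, _, hγ, h0, h1⟩
  rw [← h0, ← h1]
  refine (finslerDist_le_integral hτ hγ).trans ?_
  have h2 : ∫ t in (0 : ℝ)..1, randers g τ (e.symm (c t)) (velocity (fun t => e.symm (c t)) t)
      ≤ ∫ _ in (0 : ℝ)..1, C := by
    refine intervalIntegral.integral_mono_on zero_le_one
      ((continuousOn_randers_velocity hγ).intervalIntegrable_of_Icc zero_le_one)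
      (by simp) fun t ht => ?_
    rw [randers_symm_comp he hc hct ht (hd t).hasDerivWithinAt]
    exact hC _ (hmem t ht)
  simpa using h2

/-- The infimum of the empty set is 0, so the segment is needed to extract a curve from a bound on
the distance. -/
theorem exists_curve_of_finslerDist_lt (he : e ∈ IsManifold.maximalAtlas (𝓡 2) ∞ M)
    (hτ : ∀ x : M, oneFormNorm g τ x < 1) {B : Set Plane} (hB : Convex ℝ B)
    (hBt : B ⊆ e.target) {z z' : Plane} (hz : z ∈ B) (hz' : z' ∈ B) {C l : ℝ}
    (hC : ∀ w ∈ B, chartRanders (metricMatrix g e) (formCoeff τ e) w (z' - z) ≤ C)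
    (hl : finslerDist (randers g τ) (e.symm z) (e.symm z') < l) :
    ∃ γ : ℝ → M, ContMDiffOn 𝓘(ℝ, ℝ) (𝓡 2) 1 γ (Icc 0 1) ∧ γ 0 = e.symm z ∧
        γ 1 = e.symm z' ∧ ∫ t in (0 : ℝ)..1, randers g τ (γ t) (velocity γ t) < l := by
  obtain ⟨-, γ, hγ, h0, h1⟩ := finslerDist_le_of_segment hτ he hB hBt hz hz' hC
  obtain ⟨_, ⟨γ, hγ, h0, h1, rfl⟩, h⟩ := exists_lt_of_csInf_lt
    (by exact ⟨_, γ, hγ, h0, h1, rfl⟩) hl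
  exact ⟨γ, hγ, h0, h1, h⟩

theorem finslerDist_self (hτ : ∀ x : M, oneFormNorm g τ x < 1)
    (he : e ∈ IsManifold.maximalAtlas (𝓡 2) ∞ M) {x : M} (hx : x ∈ e.source) :
    finslerDist (randers g τ) x x = 0 := by
  have hz := e.map_source hx
  have h := (finslerDist_le_of_segment (g := g) hτ he (convex_singleton (𝕜 := ℝ) (e x))
    (singleton_subset_iff.2 hz) rfl rfl (C := 0) (fun w _ => by simp [chartRanders, metricForm])).1
  rw [e.left_inv hx] at h
  exact le_antisymm h (finslerDist_nonneg hτ _ _)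

theorem exists_ball_bounds (hτ : ∀ x : M, oneFormNorm g τ x < 1)
    (he : e ∈ IsManifold.maximalAtlas (𝓡 2) ∞ M) {z₀ : Plane} (hz : z₀ ∈ e.target) :
    ∃ m L : ℝ, 0 < m ∧ 0 < L ∧ ∀ᶠ ρ in 𝓝[>] (0 : ℝ), Metric.closedBall z₀ ρ ⊆ e.target ∧
      ∀ z ∈ Metric.closedBall z₀ ρ, ∀ v,
        m * ‖v‖ ≤ chartRanders (metricMatrix g e) (formCoeff τ e) z v ∧
        chartRanders (metricMatrix g e) (formCoeff τ e) z v ≤ L * ‖v‖ := by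
  obtain ⟨m, L, hm, hL, h⟩ := (isRandersOn_chart g τ hτ he).exists_bounds hz
  refine ⟨m, L, hm, hL, ?_⟩
  obtain ⟨r, hr, hr'⟩ := Metric.mem_nhds_iff.1 (Filter.inter_mem (e.open_target.mem_nhds hz) h)
  filter_upwards [Ioo_mem_nhdsGT hr] with ρ hρ
  have h1 := (Metric.closedBall_subset_ball hρ.2).trans hr'
  exact ⟨fun z hz => (h1 hz).1, fun z hz => (h1 hz).2⟩

/-- Uniformly near z₀, the distance is the norm frozen at z₀. The upper bound is the length of a
segment; the lower bound calibrates a short curve, confined to a ball, by a slightly shrunken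
supporting functional. -/
theorem abs_finslerDist_sub_le [T2Space M] (hτ : ∀ x : M, oneFormNorm g τ x < 1)
    (he : e ∈ IsManifold.maximalAtlas (𝓡 2) ∞ M) {z₀ : Plane} (hz₀ : z₀ ∈ e.target) {ε : ℝ}
    (hε : 0 < ε) : ∃ δ > 0, ∀ z ∈ Metric.ball z₀ δ, ∀ z' ∈ Metric.ball z₀ δ,
      |finslerDist (randers g τ) (e.symm z) (e.symm z')
        - chartRanders (metricMatrix g e) (formCoeff τ e) z₀ (z' - z)| ≤ ε * ‖z' - z‖ := by
  have hR := isRandersOn_chart g τ hτ he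
  obtain ⟨m, L, hm, hL, hb⟩ := exists_ball_bounds hτ he hz₀
  -- Chosen so that near z₀ the norm is at least (1 − θ) times the frozen norm, while the loss θ·L
  -- stays below ε.
  set θ := min (ε / L) 1 with hθ
  have hθ0 : 0 < θ := lt_min (by positivity) one_pos
  have hθ1 : θ ≤ 1 := min_le_right _ _
  have hθL : θ * L ≤ ε := by
    have := min_le_left (ε / L) 1
    rwa [le_div_iff₀ hL] at this
  obtain ⟨r, hr, hr'⟩ := Metric.mem_nhds_iff.1 (Filter.inter_mem
    (hR.eventually_abs_sub_le hz₀ hε) (hR.eventually_abs_sub_le hz₀ (mul_pos hθ0 hm)))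
  obtain ⟨ρ, hb, hρ⟩ := (hb.and (Ioo_mem_nhdsGT hr)).exists
  obtain ⟨hρt, hb⟩ := hb
  have hρr : Metric.closedBall z₀ ρ ⊆ Metric.ball z₀ r := Metric.closedBall_subset_ball hρ.2
  -- This δ solves L·2δ = m(ρ − δ): segments between points of the δ-ball are too short to reach the
  -- sphere of radius ρ.
  refine ⟨m * ρ / (2 * L + m), by have := hρ.1; positivity, fun z hz z' hz' => ?_⟩
  set δ := m * ρ / (2 * L + m) with hδ
  have hδ' : δ * (2 * L + m) = m * ρ := div_mul_cancel₀ _ (by positivity)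
  have hδρ : δ ≤ ρ := by
    rw [hδ, div_le_iff₀ (by positivity)]
    nlinarith [hρ.1]
  have hballs : Metric.ball z₀ δ ⊆ Metric.ball z₀ ρ := Metric.ball_subset_ball hδρ
  have hd : ‖z' - z‖ < 2 * δ := by
    rw [← dist_eq_norm]
    have := dist_triangle_right z' z z₀
    have h1 := Metric.mem_ball.1 hz
    have h2 := Metric.mem_ball.1 hz'
    linarith
  have hz₀ρ : z₀ ∈ Metric.closedBall z₀ ρ := Metric.mem_closedBall_self hρ.1.le
  have hup : ∀ w ∈ Metric.ball z₀ ρ,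
      chartRanders (metricMatrix g e) (formCoeff τ e) w (z' - z)
        ≤ chartRanders (metricMatrix g e) (formCoeff τ e) z₀ (z' - z) + ε * ‖z' - z‖ := by
    intro w hw
    have := (abs_le.1 ((hr' (hρr (Metric.ball_subset_closedBall hw))).1 (z' - z))).2
    linarith
  have hBt := Metric.ball_subset_closedBall.trans hρt
  have h1 := (finslerDist_le_of_segment hτ he (convex_ball z₀ ρ) hBt (hballs hz) (hballs hz')
    hup).1
  rw [abs_le]
  refine ⟨?_, by linarith⟩
  by_contra! hlt
  obtain ⟨γ, hγ, hγ0, hγ1, hl⟩ := exists_curve_of_finslerDist_lt he hτ (convex_ball z₀ ρ)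
    hBt (hballs hz) (hballs hz') hup
    (l := chartRanders (metricMatrix g e) (formCoeff τ e) z₀ (z' - z) - ε * ‖z' - z‖) (by linarith)
  have hzt := hBt (hballs hz)
  have hzt' := hBt (hballs hz')
  have he0 : e (γ 0) = z := by rw [hγ0, e.right_inv hzt]
  have he1 : e (γ 1) = z' := by rw [hγ1, e.right_inv hzt']
  have hst := curve_mem_ball hτ he hγ hρt hm (fun z hz v => (hb z hz v).1)
    (by rw [hγ0]; exact e.map_target hzt) (by rw [he0]; exact hballs hz) (by
      rw [he0]
      have h2 := (hb z₀ hz₀ρ (z' - z)).2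
      have h3 := Metric.mem_ball.1 hz
      have h4 := mul_nonneg hε.le (norm_nonneg (z' - z))
      nlinarith)
  obtain ⟨ℓ, hℓ, hℓ'⟩ := hR.exists_support hz₀ (z' - z)
  have h5 := le_integral_randers he hγ (right_mem_Icc.2 zero_le_one) (fun t ht => (hst t ht).1)
    ((1 - θ) • ℓ) (fun t ht v => by
      have h6 := (abs_le.1 ((hr' (hρr (Metric.ball_subset_closedBall (hst t ht).2))).2 v)).1
      have h7 := (hb z₀ hz₀ρ v).1
      have h8 := mul_le_mul_of_nonneg_left (hℓ' v) (sub_nonneg.2 hθ1)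
      rw [smul_apply, smul_eq_mul]
      nlinarith)
  rw [he0, he1, smul_apply, smul_eq_mul, hℓ] at h5
  have h9 := (hb z₀ hz₀ρ (z' - z)).2
  nlinarith [norm_nonneg (z' - z)]

/-- Adding the norms of w and −w cancels the linear term τ. The symmetrised distance therefore sees
only the Riemannian length. -/
theorem tendsto_finslerDist_add [T2Space M] (hτ : ∀ x : M, oneFormNorm g τ x < 1)
    (he : e ∈ IsManifold.maximalAtlas (𝓡 2) ∞ M) {c : ℝ → Plane} {v : Plane}
    (hc : HasDerivAt c v 0) (h0 : c 0 ∈ e.target) :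
    Filter.Tendsto (fun h : ℝ => h⁻¹ * (finslerDist (randers g τ) (e.symm (c 0)) (e.symm (c h))
      + finslerDist (randers g τ) (e.symm (c h)) (e.symm (c 0)))) (𝓝[>] 0)
      (𝓝 (2 * √(metricForm (metricMatrix g e) (c 0) v v))) := by
  set N : Plane → ℝ := fun w => 2 * √(metricForm (metricMatrix g e) (c 0) w w) with hN
  have hNc : Continuous N := by
    refine continuous_const.mul (Real.continuous_sqrt.comp ?_)
    rw [continuous_iff_continuousAt]
    intro w
    exact ContinuousAt.comp
      (g := fun p : Plane × Plane => metricForm (metricMatrix g e) p.1 p.2 p.2)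
      (f := fun w : Plane => (c 0, w))
      ((isMetricOn_metricMatrix g he).1.continuousAt_metricForm h0 w) (by fun_prop)
  have hFN : ∀ w, chartRanders (metricMatrix g e) (formCoeff τ e) (c 0) w
      + chartRanders (metricMatrix g e) (formCoeff τ e) (c 0) (-w) = N w := by
    intro w
    have h1 : metricForm (metricMatrix g e) (c 0) (-w) (-w)
        = metricForm (metricMatrix g e) (c 0) w w := by
      simp only [metricForm, PiLp.neg_apply]
      ring
    simp only [chartRanders, h1, hN, PiLp.neg_apply]
    ring
  have hNs : ∀ s : ℝ, 0 ≤ s → ∀ w, N (s • w) = s * N w := by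
    intro s hs w
    simp only [hN]
    rw [metricForm_smul_smul, Real.sqrt_mul (sq_nonneg s), Real.sqrt_sq hs]
    ring
  have hslope : Filter.Tendsto (fun h : ℝ => h⁻¹ • (c h - c 0)) (𝓝[>] 0) (𝓝 v) := by
    simpa only [zero_add] using hc.tendsto_slope_zero_right
  have hlim := (hNc.tendsto v).comp hslope
  suffices h : Filter.Tendsto (fun h : ℝ => h⁻¹ * (finslerDist (randers g τ) (e.symm (c 0))
      (e.symm (c h)) + finslerDist (randers g τ) (e.symm (c h)) (e.symm (c 0)))
      - N (h⁻¹ • (c h - c 0))) (𝓝[>] 0) (𝓝 0) by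
    simpa using h.add hlim
  rw [Metric.tendsto_nhds]
  intro ε hε
  have hv : 0 < ‖v‖ + 1 := by positivity
  obtain ⟨δ, hδ, hD⟩ := abs_finslerDist_sub_le hτ he h0
    (ε := ε / (4 * (‖v‖ + 1))) (by positivity)
  have hcb : ∀ᶠ h in 𝓝[>] (0 : ℝ), c h ∈ Metric.ball (c 0) δ :=
    nhdsWithin_le_nhds (hc.continuousAt (Metric.ball_mem_nhds _ hδ))
  have hsb : ∀ᶠ h in 𝓝[>] (0 : ℝ), ‖h⁻¹ • (c h - c 0)‖ < ‖v‖ + 1 :=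
    hslope.norm.eventually (gt_mem_nhds (by linarith))
  filter_upwards [hcb, hsb, self_mem_nhdsWithin] with h h1 h2 h3
  have h3' : 0 < h := h3
  have h4 := hD _ (Metric.mem_ball_self hδ) _ h1
  have h5 := hD _ h1 _ (Metric.mem_ball_self hδ)
  rw [norm_sub_rev (c 0) (c h), ← neg_sub (c h) (c 0)] at h5
  set η := ε / (4 * (‖v‖ + 1)) with hη
  have hη0 : 0 < η := by positivity
  have hηv : η * (‖v‖ + 1) * 4 = ε := by rw [hη]; field_simp
  rw [dist_zero_right, Real.norm_eq_abs, hNs _ (by positivity), ← mul_sub, ← hFN, abs_mul,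
    abs_of_pos (inv_pos.2 h3')]
  rw [norm_smul, norm_inv, Real.norm_of_nonneg h3'.le] at h2
  have h6 : |finslerDist (randers g τ) (e.symm (c 0)) (e.symm (c h))
      + finslerDist (randers g τ) (e.symm (c h)) (e.symm (c 0))
      - (chartRanders (metricMatrix g e) (formCoeff τ e) (c 0) (c h - c 0)
      + chartRanders (metricMatrix g e) (formCoeff τ e) (c 0) (-(c h - c 0)))|
      ≤ 2 * (η * ‖c h - c 0‖) := by
    rw [abs_le] at h4 h5 ⊢
    constructor <;> linarith [h4.1, h4.2, h5.1, h5.2]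
  have h7 := mul_le_mul_of_nonneg_left h6 (inv_nonneg.2 h3'.le)
  have h8 : h⁻¹ * (2 * (η * ‖c h - c 0‖)) = 2 * η * (h⁻¹ * ‖c h - c 0‖) := by ring
  nlinarith

/-- A map which preserves the triangular function preserves the underlying Riemannian metric. -/
theorem metricForm_eq_of_triangular [T2Space M] (hτ : ∀ x : M, oneFormNorm g τ x < 1)
    (he : e ∈ IsManifold.maximalAtlas (𝓡 2) ∞ M) {ψ : Plane → Plane} {z : Plane}
    (hψ : DifferentiableAt ℝ ψ z) (hz : z ∈ e.target) (hψz : ψ z ∈ e.target)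
    (hT : ∀ᶠ w in 𝓝 z, triangular (randers g τ) (e.symm z) (e.symm w) (e.symm z)
      = triangular (randers g τ) (e.symm (ψ z)) (e.symm (ψ w)) (e.symm (ψ z))) (v : Plane) :
    metricForm (metricMatrix g e) (ψ z) (fderiv ℝ ψ z v) (fderiv ℝ ψ z v)
      = metricForm (metricMatrix g e) z v v := by
  set c : ℝ → Plane := fun h => z + h • v with hcdef
  have hc0 : c 0 = z := by simp [c]
  have hc : HasDerivAt c v 0 := by
    have := (hasDerivAt_id (0 : ℝ)).smul_const v
    rw [one_smul] at this
    exact this.const_add z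
  have hψc : HasDerivAt (fun h => ψ (c h)) (fderiv ℝ ψ z v) 0 := by
    have h1 : HasFDerivAt ψ (fderiv ℝ ψ z) (c 0) := by rw [hc0]; exact hψ.hasFDerivAt
    exact h1.comp_hasDerivAt 0 hc
  have h1 := tendsto_finslerDist_add (g := g) hτ he hc (by rw [hc0]; exact hz)
  have h2 := tendsto_finslerDist_add (g := g) hτ he hψc (by simp only [hc0]; exact hψz)
  have hT' : ∀ᶠ h in 𝓝[>] (0 : ℝ), triangular (randers g τ) (e.symm z) (e.symm (c h)) (e.symm z)
      = triangular (randers g τ) (e.symm (ψ z)) (e.symm (ψ (c h))) (e.symm (ψ z)) := by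
    have h3 := hc.continuousAt
    rw [ContinuousAt, hc0] at h3
    exact nhdsWithin_le_nhds (h3.eventually hT)
  simp only [hc0] at h1 h2
  -- As d(p,p) = 0, T(p,q,p) is the symmetrised distance. Its rates along c and along the image of c
  -- agree.
  have h4 := tendsto_nhds_unique (h1.congr' (by
    filter_upwards [hT'] with h hh
    simp only [triangular, finslerDist_self hτ he (e.map_target hz),
      finslerDist_self hτ he (e.map_target hψz), sub_zero] at hh
    rw [hh])) h2
  have h5 : ∀ y ∈ e.target, ∀ w, 0 ≤ metricForm (metricMatrix g e) y w w := fun y hy w => by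
    by_cases hw : w = 0
    · subst hw
      simp [metricForm]
    · exact ((isMetricOn_metricMatrix g he).2 y hy w hw).le
  have h6 := mul_left_cancel₀ two_ne_zero h4
  exact ((Real.sqrt_inj (h5 _ hz _) (h5 _ hψz _)).1 h6).symm

/-- A map which multiplies lengths up to an exact form changes short distances by the difference of
the values of a primitive. -/
theorem finslerDist_map_le [T2Space M] (hτ : ∀ x : M, oneFormNorm g τ x < 1)
    (he : e ∈ IsManifold.maximalAtlas (𝓡 2) ∞ M) {z₀ : Plane} {ρ m L δ : ℝ}
    (hρ : Metric.closedBall z₀ ρ ⊆ e.target) (hm : 0 < m) (hL : 0 < L)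
    (hb : ∀ z ∈ Metric.closedBall z₀ ρ, ∀ v,
        m * ‖v‖ ≤ chartRanders (metricMatrix g e) (formCoeff τ e) z v ∧
        chartRanders (metricMatrix g e) (formCoeff τ e) z v ≤ L * ‖v‖)
    (hδρ : δ ≤ ρ) (hδ : δ * (2 * L + m) ≤ m * ρ)
    {ψ : Plane → Plane} (hψ : ContDiff ℝ ∞ ψ) (hψt : ∀ z ∈ Metric.ball z₀ ρ, ψ z ∈ e.target)
    {f : Plane → ℝ} {f' : Plane → Plane →L[ℝ] ℝ}
    (hf : ∀ z ∈ Metric.ball z₀ ρ, HasFDerivAt f (f' z) z)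
    (hψf : ∀ z ∈ Metric.ball z₀ ρ, ∀ v,
      chartRanders (metricMatrix g e) (formCoeff τ e) (ψ z) (fderiv ℝ ψ z v)
        = chartRanders (metricMatrix g e) (formCoeff τ e) z v + f' z v)
    {z z' : Plane} (hz : z ∈ Metric.ball z₀ δ) (hz' : z' ∈ Metric.ball z₀ δ) :
    finslerDist (randers g τ) (e.symm (ψ z)) (e.symm (ψ z'))
      ≤ finslerDist (randers g τ) (e.symm z) (e.symm z') + (f z' - f z) := by
  have hballs : Metric.ball z₀ δ ⊆ Metric.ball z₀ ρ := Metric.ball_subset_ball hδρ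
  have hd : ‖z' - z‖ < 2 * δ := by
    rw [← dist_eq_norm]
    have := dist_triangle_right z' z z₀
    have h1 := Metric.mem_ball.1 hz
    have h2 := Metric.mem_ball.1 hz'
    linarith
  have hBt := Metric.ball_subset_closedBall.trans hρ
  have hup : ∀ w ∈ Metric.ball z₀ ρ,
      chartRanders (metricMatrix g e) (formCoeff τ e) w (z' - z) ≤ L * ‖z' - z‖ := fun w hw =>
    (hb w (Metric.ball_subset_closedBall hw) _).2
  have h1 := (finslerDist_le_of_segment hτ he (convex_ball z₀ ρ) hBt (hballs hz) (hballs hz')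
    hup).1
  have hmδ : L * ‖z' - z‖ < m * (ρ - dist z z₀) := by
    have h3 := Metric.mem_ball.1 hz
    nlinarith
  have hzt := hBt (hballs hz)
  have hzt' := hBt (hballs hz')
  refine le_of_forall_gt_imp_ge_of_dense fun l hl => ?_
  -- The first entry of the minimum makes γ nearly minimising; the second confines it to the ball
  -- where ψ and f are controlled.
  obtain ⟨γ, hγ, hγ0, hγ1, hlt⟩ := exists_curve_of_finslerDist_lt he hτ (convex_ball z₀ ρ)
    hBt (hballs hz) (hballs hz') hup (l := min (l - (f z' - f z)) (m * (ρ - dist z z₀)))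
    (lt_min (by linarith) (by linarith))
  obtain ⟨hl1, hl2⟩ := lt_min_iff.1 hlt
  have he0 : e (γ 0) = z := by rw [hγ0, e.right_inv hzt]
  have he1 : e (γ 1) = z' := by rw [hγ1, e.right_inv hzt']
  have hst := curve_mem_ball hτ he hγ hρ hm (fun z hz v => (hb z hz v).1)
    (by rw [hγ0]; exact e.map_target hzt) (by rw [he0]; exact hballs hz) (by
      rw [he0]; exact hl2)
  set c' : ℝ → Plane := fun t => (mfderiv (𝓡 2) (𝓡 2) e (γ t) (velocity γ t) : Plane) with hc'
  have hcd : ∀ t ∈ Icc (0 : ℝ) 1, HasDerivWithinAt (fun s => e (γ s)) (c' t) (Icc 0 1) t :=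
    fun t ht => hasDerivWithinAt_chart_comp he hγ ht (hst t ht).1
  have hc1 : ContDiffOn ℝ 1 (fun s => e (γ s)) (Icc 0 1) :=
    contMDiffOn_iff_contDiffOn.1 (((contMDiffOn_of_mem_maximalAtlas he).of_le (m := 1)
      (mod_cast le_top)).comp hγ fun t ht => (hst t ht).1)
  have hd1 : ContDiffOn ℝ 1 (fun s => ψ (e (γ s))) (Icc 0 1) :=
    (hψ.of_le (mod_cast le_top)).comp_contDiffOn hc1
  have hdt : ∀ t ∈ Icc (0 : ℝ) 1, ψ (e (γ t)) ∈ e.target := fun t ht => hψt _ (hst t ht).2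
  have hdd : ∀ t ∈ Icc (0 : ℝ) 1, HasDerivWithinAt (fun s => ψ (e (γ s)))
      (fderiv ℝ ψ (e (γ t)) (c' t)) (Icc 0 1) t := fun t ht =>
    ((hψ.differentiable (by simp)) _).hasFDerivAt.comp_hasDerivWithinAt t (hcd t ht)
  have hint : ∀ t ∈ Icc (0 : ℝ) 1,
      randers g τ (e.symm (ψ (e (γ t)))) (velocity (fun s => e.symm (ψ (e (γ s)))) t)
        = randers g τ (γ t) (velocity γ t) + f' (e (γ t)) (c' t) := fun t ht => by
    rw [randers_symm_comp he hd1 hdt ht (hdd t ht), hψf _ (hst t ht).2,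
      randers_eq_chartRanders g τ he (hst t ht).1]
  have hg := contMDiffOn_symm_comp he hd1 hdt
  have hi1 := (continuousOn_randers_velocity (g := g) (τ := τ) hγ).intervalIntegrable_of_Icc
    (μ := MeasureTheory.volume) zero_le_one
  have hi2 := (continuousOn_randers_velocity (g := g) (τ := τ) hg).intervalIntegrable_of_Icc
    (μ := MeasureTheory.volume) zero_le_one
  have hi3 : IntervalIntegrable (fun t => f' (e (γ t)) (c' t)) MeasureTheory.volume 0 1 := by
    refine (hi2.sub hi1).congr ?_
    intro t ht
    rw [uIoc_of_le zero_le_one] at ht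
    simp only
    rw [hint t (Ioc_subset_Icc_self ht)]
    ring
  have hfd : ∀ t ∈ Icc (0 : ℝ) 1, HasDerivWithinAt (fun s => f (e (γ s)))
      (f' (e (γ t)) (c' t)) (Icc 0 1) t := fun t ht =>
    (hf _ (hst t ht).2).comp_hasDerivWithinAt t (hcd t ht)
  have hftc : ∫ t in (0 : ℝ)..1, f' (e (γ t)) (c' t) = f (e (γ 1)) - f (e (γ 0)) :=
    intervalIntegral.integral_eq_sub_of_hasDeriv_right_of_le (f := fun s => f (e (γ s))) zero_le_one
      (fun t ht => (hfd t ht).continuousWithinAt)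
      (fun t ht => ((hfd t (Ioo_subset_Icc_self ht)).hasDerivAt
        (Icc_mem_nhds ht.1 ht.2)).hasDerivWithinAt) hi3
  have hle := finslerDist_le_integral hτ hg
  have hsum : ∫ t in (0 : ℝ)..1,
      randers g τ (e.symm (ψ (e (γ t)))) (velocity (fun s => e.symm (ψ (e (γ s)))) t)
      = (∫ t in (0 : ℝ)..1, randers g τ (γ t) (velocity γ t)) + (f z' - f z) := by
    rw [← he0, ← he1, ← hftc, ← intervalIntegral.integral_add hi1 hi3]
    refine intervalIntegral.integral_congr fun t ht => ?_
    rw [uIcc_of_le zero_le_one] at ht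
    exact hint t ht
  simp only [he0, he1] at hle
  rw [hsum] at hle
  linarith

end LocalDistance

/-! ### Flows of Killing fields: metric, area form and the closed form φ*τ − τ -/

section KillingFlow

set_option maxSynthPendingDepth 3

variable {G : Plane → Matrix (Fin 2) (Fin 2) ℝ} {a : Fin 2 → Plane → ℝ} {Ω : Set Plane}
  {k : Plane → Plane} {ψ : ℝ → Plane → Plane}

theorem fderiv_coord {z : Plane} (hk : DifferentiableAt ℝ k z) (v : Plane) (i : Fin 2) :
    (fderiv ℝ k z v) i = v 0 * partialD 0 (fun w => k w i) z
      + v 1 * partialD 1 (fun w => k w i) z := by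
  rw [← fderiv_plane_apply]
  have h := ((EuclideanSpace.proj i : Plane →L[ℝ] ℝ).hasFDerivAt (x := k z)).comp z
    hk.hasFDerivAt
  have h2 : fderiv ℝ (fun w => k w i) z
    = (EuclideanSpace.proj i : Plane →L[ℝ] ℝ).comp (fderiv ℝ k z) := h.fderiv
  rw [h2]
  rfl

theorem hasDerivAt_coord {c : ℝ → Plane} {v : Plane} {t : ℝ} (h : HasDerivAt c v t) (i : Fin 2) :
    HasDerivAt (fun s => c s i) (v i) t :=
  (EuclideanSpace.proj i : Plane →L[ℝ] ℝ).hasFDerivAt.comp_hasDerivAt t h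

/-- The contraction of `lieMetric` with two vectors. -/
def lieForm (G : Plane → Matrix (Fin 2) (Fin 2) ℝ) (k : Plane → Plane) (z v w : Plane) : ℝ :=
  v 0 * (w 0 * lieMetric G k 0 0 z + w 1 * lieMetric G k 0 1 z)
    + v 1 * (w 0 * lieMetric G k 1 0 z + w 1 * lieMetric G k 1 1 z)

/-- The identity d/dt ψ_t*g = ψ_t*(L_k g), obtained from the variational equation. -/
theorem IsMetricOn.hasDerivAt_metricForm_flow (hG : IsMetricOn G Ω) (hk : ContDiff ℝ ∞ k)
    (hc : HasCompactSupport k) (hψ : IsFlowOf ψ k) {t : ℝ} {z : Plane} (hz : ψ t z ∈ Ω)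
    (v w : Plane) :
    HasDerivAt (fun s => metricForm G (ψ s z) (fderiv ℝ (ψ s) z v) (fderiv ℝ (ψ s) z w))
      (lieForm G k (ψ t z) (fderiv ℝ (ψ t) z v) (fderiv ℝ (ψ t) z w)) t := by
  have hV := fun i => hasDerivAt_coord (hψ.hasDerivAt_fderiv hk hc t z v) i
  have hW := fun i => hasDerivAt_coord (hψ.hasDerivAt_fderiv hk hc t z w) i
  have hkd : DifferentiableAt ℝ k (ψ t z) := hk.differentiable (by simp) _
  simp only [fderiv_coord hkd] at hV hW
  have hGd : ∀ i j, HasDerivAt (fun s => G (ψ s z) i j)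
      (k (ψ t z) 0 * partialD 0 (fun w => G w i j) (ψ t z)
        + k (ψ t z) 1 * partialD 1 (fun w => G w i j) (ψ t z)) t := fun i j => by
    rw [← fderiv_plane_apply]
    exact (hG.differentiableAt hz i j).hasFDerivAt.comp_hasDerivAt t (hψ.deriv t z)
  have h := ((hV 0).fun_mul (((hW 0).fun_mul (hGd 0 0)).fun_add ((hW 1).fun_mul (hGd 0 1)))).fun_add
    ((hV 1).fun_mul (((hW 0).fun_mul (hGd 1 0)).fun_add ((hW 1).fun_mul (hGd 1 1))))
  refine h.congr_deriv ?_
  simp only [lieForm, lieMetric]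
  ring

theorem IsKillingOn.metricForm_flow (hG : IsMetricOn G Ω) (hkk : IsKillingOn G k Ω)
    (hk : ContDiff ℝ ∞ k) (hc : HasCompactSupport k) (hψ : IsFlowOf ψ k) {ε : ℝ} {z : Plane}
    (hz : ∀ s ∈ Ioo (-ε) ε, ψ s z ∈ Ω) {t : ℝ} (ht : t ∈ Ioo (-ε) ε) (v w : Plane) :
    metricForm G (ψ t z) (fderiv ℝ (ψ t) z v) (fderiv ℝ (ψ t) z w) = metricForm G z v w := by
  have hd : ∀ s ∈ Ioo (-ε) ε, HasDerivAt
      (fun s => metricForm G (ψ s z) (fderiv ℝ (ψ s) z v) (fderiv ℝ (ψ s) z w)) 0 s :=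
    fun s hs => (hG.hasDerivAt_metricForm_flow hk hc hψ (hz s hs) v w).congr_deriv (by
      simp [lieForm, hkk.lie_eq _ (hz s hs)])
  have h0 : (0 : ℝ) ∈ Ioo (-ε) ε := by
    have := ht.1.trans ht.2
    constructor <;> linarith
  have h1 := isOpen_Ioo.is_const_of_deriv_eq_zero isPreconnected_Ioo
    (fun s hs => (hd s hs).differentiableAt.differentiableWithinAt)
    (fun s hs => (hd s hs).deriv) ht h0
  have h2 : ψ 0 = id := funext hψ.zero
  simpa [h2] using h1

/-- The Jacobian determinant of a linear map of the plane. -/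
def jac (A : Plane →L[ℝ] Plane) : ℝ :=
  A (EuclideanSpace.single 0 1) 0 * A (EuclideanSpace.single 1 1) 1
    - A (EuclideanSpace.single 0 1) 1 * A (EuclideanSpace.single 1 1) 0

theorem cross_map (A : Plane →L[ℝ] Plane) (v w : Plane) :
    A v 0 * A w 1 - A v 1 * A w 0 = jac A * (v 0 * w 1 - v 1 * w 0) := by
  have h : ∀ v : Plane, ∀ i, A v i
      = v 0 * A (EuclideanSpace.single 0 1) i + v 1 * A (EuclideanSpace.single 1 1) i := fun v i => by
    conv_lhs => rw [plane_eq_sum v, map_add, map_smul, map_smul]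
    rfl
  rw [h v 0, h v 1, h w 0, h w 1, jac]
  ring

/-- Preservation of g determines only the square of the Jacobian, by the Gram identity. The Jacobian
is continuous in t, never zero, and 1 at t = 0, so it is positive. An orientation-reversing isometry
would change the sign of the area form. -/
theorem IsKillingOn.volDensity_flow (hG : IsMetricOn G Ω) (hkk : IsKillingOn G k Ω)
    (hk : ContDiff ℝ ∞ k) (hc : HasCompactSupport k) (hψ : IsFlowOf ψ k) {ε : ℝ} {z : Plane}
    (hz : ∀ s ∈ Ioo (-ε) ε, ψ s z ∈ Ω) {t : ℝ} (ht : t ∈ Ioo (-ε) ε) :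
    volDensity G (ψ t z) * jac (fderiv ℝ (ψ t) z) = volDensity G z := by
  have h0 : (0 : ℝ) ∈ Ioo (-ε) ε := by
    have := ht.1.trans ht.2
    constructor <;> linarith
  have hψ0 : ψ 0 = id := funext hψ.zero
  have hz0 : z ∈ Ω := by simpa [hψ0] using hz 0 h0
  have hsq : ∀ s ∈ Ioo (-ε) ε, (G (ψ s z)).det * jac (fderiv ℝ (ψ s) z) ^ 2 = (G z).det := by
    intro s hs
    have h1 := hG.metricForm_mul_sub_sq (ψ s z) (fderiv ℝ (ψ s) z (EuclideanSpace.single 0 1))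
      (fderiv ℝ (ψ s) z (EuclideanSpace.single 1 1))
    have h2 := hG.metricForm_mul_sub_sq z (EuclideanSpace.single 0 1) (EuclideanSpace.single 1 1)
    rw [cross_map] at h1
    simp only [hkk.metricForm_flow hG hk hc hψ hz hs] at h1
    rw [h2] at h1
    simpa using h1.symm
  have hcont : ContinuousOn (fun s => jac (fderiv ℝ (ψ s) z)) (Ioo (-ε) ε) := by
    have h1 : ∀ (v : Plane) (i : Fin 2), Continuous fun s => fderiv ℝ (ψ s) z v i := fun v i => by
      rw [continuous_iff_continuousAt]
      exact fun s => (hasDerivAt_coord (hψ.hasDerivAt_fderiv hk hc s z v) i).continuousAt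
    exact (((h1 _ 0).mul (h1 _ 1)).sub ((h1 _ 1).mul (h1 _ 0))).continuousOn
  have hne : ∀ s ∈ Ioo (-ε) ε, jac (fderiv ℝ (ψ s) z) ≠ 0 := fun s hs h => by
    have h1 := hsq s hs
    rw [h] at h1
    have h2 := hG.det_pos z hz0
    simp at h1
    exact h2.ne h1
  have hj0 : jac (fderiv ℝ (ψ 0) z) = 1 := by
    rw [hψ0, fderiv_id]
    simp [jac]
  have hpos : 0 < jac (fderiv ℝ (ψ t) z) := by
    by_contra! hle
    obtain ⟨s, hs, hs'⟩ := isPreconnected_Ioo.intermediate_value ht h0 hcont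
      (show (0 : ℝ) ∈ Icc _ _ from ⟨hle, by simp only [hj0]; exact zero_le_one⟩)
    exact hne s hs hs'
  have h1 := hsq t ht
  rw [volDensity, volDensity, ← h1, Real.sqrt_mul (hG.det_pos _ (hz t ht)).le,
    Real.sqrt_sq hpos.le]

/-- The 1-form with coefficients `a`. -/
def coordForm (a : Fin 2 → Plane → ℝ) (z : Plane) : Plane →L[ℝ] ℝ :=
  a 0 z • EuclideanSpace.proj 0 + a 1 z • EuclideanSpace.proj 1

theorem coordForm_apply (z v : Plane) : coordForm a z v = v 0 * a 0 z + v 1 * a 1 z := by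
  simp only [coordForm, add_apply, smul_apply, PiLp.proj_apply, smul_eq_mul]
  ring

/-- Since dτ = c·Vol and φ preserves the area form, φ*τ − τ is closed, and closed forms on a ball
are exact. -/
theorem exists_primitive_pullback {c r : ℝ} {z₀ : Plane}
    (ha : ∀ z ∈ Ω, ∀ i, ContDiffAt ℝ ∞ (a i) z)
    (hac : ∀ z ∈ Ω, partialD 0 (a 1) z - partialD 1 (a 0) z = c * volDensity G z)
    {φ : Plane → Plane} (hφ : ContDiff ℝ ∞ φ) (hr : Metric.ball z₀ r ⊆ Ω)
    (hφr : ∀ z ∈ Metric.ball z₀ r, φ z ∈ Ω)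
    (hvol : ∀ z ∈ Metric.ball z₀ r, volDensity G (φ z) * jac (fderiv ℝ φ z) = volDensity G z) :
    ∃ f : Plane → ℝ, ∀ z ∈ Metric.ball z₀ r,
      HasFDerivAt f ((coordForm a (φ z)).comp (fderiv ℝ φ z) - coordForm a z) z := by
  have hA : ∀ z ∈ Ω, HasFDerivAt (coordForm a)
      ((fderiv ℝ (a 0) z).smulRight (EuclideanSpace.proj 0 : Plane →L[ℝ] ℝ)
        + (fderiv ℝ (a 1) z).smulRight (EuclideanSpace.proj 1 : Plane →L[ℝ] ℝ)) z := fun z hz =>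
    (((ha z hz 0).differentiableAt (by simp)).hasFDerivAt.smul_const _).add
      (((ha z hz 1).differentiableAt (by simp)).hasFDerivAt.smul_const _)
  have hDφ : Differentiable ℝ (fderiv ℝ φ) :=
    (hφ.fderiv_right (m := ∞) (by simp)).differentiable (by simp)
  have hφd : Differentiable ℝ φ := hφ.differentiable (by simp)
  have hform : ∀ z ∈ Metric.ball z₀ r, HasFDerivAt
      (fun z => (coordForm a (φ z)).comp (fderiv ℝ φ z) - coordForm a z) _ z := fun z hz =>
    (((hA _ (hφr z hz)).comp z (hφd z).hasFDerivAt).clm_comp (hDφ z).hasFDerivAt).sub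
      (hA z (hr hz))
  obtain ⟨f, hf⟩ := (convex_ball z₀ r).exists_forall_hasFDerivAt_of_fderiv_symmetric
    Metric.isOpen_ball (fun z hz => (hform z hz).differentiableAt.differentiableWithinAt)
    (fun z hz v w => by
      rw [(hform z hz).fderiv]
      have hsymm : fderiv ℝ (fderiv ℝ φ) z v w = fderiv ℝ (fderiv ℝ φ) z w v :=
        (hφ.contDiffAt.isSymmSndFDerivAt (by
          simpa using WithTop.coe_le_coe.2 (le_top (a := (2 : ℕ∞))))) v w
      have e1 : ∀ x ∈ Ω, ∀ v w : Plane, fderiv ℝ (a 0) x v * w 0 + fderiv ℝ (a 1) x v * w 1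
          - (fderiv ℝ (a 0) x w * v 0 + fderiv ℝ (a 1) x w * v 1)
          = c * volDensity G x * (v 0 * w 1 - v 1 * w 0) := fun x hx v w => by
        rw [← hac x hx, fderiv_plane_apply, fderiv_plane_apply, fderiv_plane_apply,
          fderiv_plane_apply]
        ring
      have e2 := e1 _ (hφr z hz) (fderiv ℝ φ z v) (fderiv ℝ φ z w)
      have e3 := e1 _ (hr hz) v w
      rw [cross_map, ← mul_assoc, mul_assoc c, hvol z hz] at e2
      -- The derivative of the pulled back form has a term with the second derivative of φ, which is
      -- symmetric. The remaining terms skew-symmetrise to the difference of the two area terms.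
      have e4 : ∀ v w : Plane, (coordForm a (φ z)) (fderiv ℝ (fderiv ℝ φ) z v w)
        + (fderiv ℝ (a 0) (φ z) (fderiv ℝ φ z v) * (fderiv ℝ φ z w) 0
          + fderiv ℝ (a 1) (φ z) (fderiv ℝ φ z v) * (fderiv ℝ φ z w) 1)
        - (fderiv ℝ (a 0) z v * w 0 + fderiv ℝ (a 1) z v * w 1)
        = (coordForm a (φ z)) (fderiv ℝ (fderiv ℝ φ) z w v)
        + (fderiv ℝ (a 0) (φ z) (fderiv ℝ φ z w) * (fderiv ℝ φ z v) 0
          + fderiv ℝ (a 1) (φ z) (fderiv ℝ φ z w) * (fderiv ℝ φ z v) 1)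
        - (fderiv ℝ (a 0) z w * v 0 + fderiv ℝ (a 1) z w * v 1) → _ := fun v w h => h
      refine e4 v w ?_
      rw [hsymm]
      linarith)
  exact ⟨f, hf⟩

/-- An isometry of g changes the Randers norm only through its linear part. -/
theorem chartRanders_pullback {φ : Plane → Plane} {z : Plane}
    (h : ∀ v, metricForm G (φ z) (fderiv ℝ φ z v) (fderiv ℝ φ z v) = metricForm G z v v)
    (v : Plane) : chartRanders G a (φ z) (fderiv ℝ φ z v) = chartRanders G a z v
      + ((coordForm a (φ z)).comp (fderiv ℝ φ z) - coordForm a z) v := by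
  rw [chartRanders, chartRanders, h v]
  have : ((coordForm a (φ z)).comp (fderiv ℝ φ z) - coordForm a z) v
    = coordForm a (φ z) (fderiv ℝ φ z v) - coordForm a z v := rfl
  rw [this, coordForm_apply, coordForm_apply]
  ring

theorem IsFlowOf.norm_sub_le (hψ : IsFlowOf ψ k) {L : ℝ} (hL : ∀ x, ‖k x‖ ≤ L) (t : ℝ)
    (z : Plane) : ‖ψ t z - z‖ ≤ L * |t| := by
  have h := convex_univ.norm_image_sub_le_of_norm_hasDerivWithin_le
    (f := fun s => ψ s z) (f' := fun s => k (ψ s z)) (s := (univ : Set ℝ)) (x := 0) (y := t)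
    (fun s _ => (hψ.deriv s z).hasDerivWithinAt) (fun s _ => hL _) (mem_univ _) (mem_univ _)
  simpa [hψ.zero] using h

end KillingFlow

/-! ### Killing flows act by almost isometries -/

section AlmostIsometries

set_option maxSynthPendingDepth 3

universe u

variable {M : Type u} [TopologicalSpace M] [ChartedSpace Plane M] [IsManifold (𝓡 2) ∞ M]
  {e : OpenPartialHomeomorph M Plane} {g : SurfaceMetric M} {τ : OneForm M}
  {k : Plane → Plane} {ψ : ℝ → Plane → Plane} {Ω : Set Plane}

/-- Two applications of `finslerDist_map_le`: to ψ_t with the primitive f, and to its inverse ψ_{−t}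
with the primitive −f ∘ ψ_{−t}. The second gives the reverse inequality. -/
theorem exists_triangular_flow [T2Space M] (hτ : ∀ x : M, oneFormNorm g τ x < 1)
    (he : e ∈ IsManifold.maximalAtlas (𝓡 2) ∞ M) {c : ℝ}
    (hdτ : ∀ z ∈ e.target, partialD 0 (formCoeff τ e 1) z - partialD 1 (formCoeff τ e 0) z
      = c * √(metricMatrix g e z).det)
    (hΩ : IsOpen Ω) (hΩe : Ω ⊆ e.target) (hk : ContDiff ℝ ∞ k) (hc : HasCompactSupport k)
    (hkk : IsKillingOn (metricMatrix g e) k Ω) (hψ : IsFlowOf ψ k) {z₀ : Plane} (hz₀ : z₀ ∈ Ω) :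
    ∃ δ > 0, ∃ ε > 0, Metric.ball z₀ δ ⊆ Ω ∧ ∀ t ∈ Ioo (-ε) ε, (∀ z ∈ Metric.ball z₀ δ, ψ t z ∈ Ω) ∧
      ∃ f : Plane → ℝ, ∀ z ∈ Metric.ball z₀ δ, ∀ z' ∈ Metric.ball z₀ δ,
        finslerDist (randers g τ) (e.symm (ψ t z)) (e.symm (ψ t z'))
          = finslerDist (randers g τ) (e.symm z) (e.symm z') + (f z' - f z) := by
  have hR := (isRandersOn_chart g τ hτ he).mono hΩe hΩ
  obtain ⟨⟨K, hK⟩, L', hL'⟩ := exists_lipschitz_bound (hk.of_le (mod_cast le_top)) hc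
  obtain ⟨m, L, hm, hL, hb⟩ := exists_ball_bounds (g := g) (τ := τ) hτ he (hΩe hz₀)
  obtain ⟨r, hr, hrΩ⟩ := Metric.isOpen_iff.1 hΩ z₀ hz₀
  obtain ⟨ρ, ⟨hρe, hρb⟩, hρ⟩ := (hb.and (Ioo_mem_nhdsGT hr)).exists
  have hρ0 : 0 < ρ := hρ.1
  have hρΩ : Metric.ball z₀ ρ ⊆ Ω := (Metric.ball_subset_ball hρ.2.le).trans hrΩ
  -- The distance comparison runs on the ball of radius ρ/4, while f lives on radius ρ/2, leaving
  -- room for ψ_{−t} of the smaller ball. Points start in radius δ₁/2 and move by less than δ₁/2, so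
  -- images stay in radius δ₁.
  set δ₁ := m * (ρ / 4) / (2 * L + m) with hδ₁
  have hδ₁0 : 0 < δ₁ := by positivity
  have hδ' : δ₁ * (2 * L + m) = m * (ρ / 4) := div_mul_cancel₀ _ (by positivity)
  have hδρ : δ₁ ≤ ρ / 4 := by
    rw [hδ₁, div_le_iff₀ (by positivity)]
    nlinarith
  have hL'0 : (0 : ℝ) < L' + 1 := by positivity
  set ε := δ₁ / 2 / (L' + 1) with hε
  have hε0 : 0 < ε := by positivity
  have hmove : ∀ t ∈ Ioo (-ε) ε, ∀ z, dist (ψ t z) z < δ₁ / 2 := by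
    intro t ht z
    rw [dist_eq_norm]
    have h1 := hψ.norm_sub_le hL' t z
    have h2 : |t| < ε := abs_lt.2 ht
    have h3 : ε * (L' + 1) = δ₁ / 2 := div_mul_cancel₀ _ hL'0.ne'
    have h4 : (0 : ℝ) ≤ L' := L'.2
    nlinarith [abs_nonneg t]
  have hmem : ∀ t ∈ Ioo (-ε) ε, ∀ r' z, z ∈ Metric.ball z₀ r' →
      ψ t z ∈ Metric.ball z₀ (r' + δ₁ / 2) := fun t ht r' z hz => by
    have h1 := hmove t ht z
    have h2 := dist_triangle (ψ t z) z z₀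
    rw [Metric.mem_ball] at hz ⊢
    linarith
  have hsub : ∀ r' ≤ ρ, Metric.ball z₀ r' ⊆ Ω := fun r' h => (Metric.ball_subset_ball h).trans hρΩ
  have hb4 : ∀ z ∈ Metric.closedBall z₀ (ρ / 4), ∀ v,
        m * ‖v‖ ≤ chartRanders (metricMatrix g e) (formCoeff τ e) z v ∧
        chartRanders (metricMatrix g e) (formCoeff τ e) z v ≤ L * ‖v‖ := fun z hz =>
    hρb z (Metric.closedBall_subset_closedBall (by linarith) hz)
  have hρ4 : Metric.closedBall z₀ (ρ / 4) ⊆ e.target :=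
    (Metric.closedBall_subset_closedBall (by linarith)).trans hρe
  refine ⟨δ₁ / 2, by positivity, ε, hε0, hsub _ (by linarith), fun t ht => ⟨fun z hz =>
    hsub _ (by linarith) (hmem t ht _ z hz), ?_⟩⟩
  have hnt : -t ∈ Ioo (-ε) ε := ⟨by linarith [ht.2], by linarith [ht.1]⟩
  have hstay : ∀ z ∈ Metric.ball z₀ (ρ / 2), ∀ s ∈ Ioo (-ε) ε, ψ s z ∈ Ω := fun z hz s hs =>
    hsub _ (by linarith) (hmem s hs _ z hz)
  have hψs : ∀ s, ContDiff ℝ ∞ (ψ s) := fun s => hψ.contDiff hk hc s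
  have hψd : ∀ s, Differentiable ℝ (ψ s) := fun s => (hψs s).differentiable (by simp)
  obtain ⟨f, hf⟩ := exists_primitive_pullback (φ := ψ t) (r := ρ / 2) (z₀ := z₀) hR.smooth
    (fun z hz => hdτ z (hΩe hz)) (hψs t) (hsub _ (by linarith)) (fun z hz => hstay z hz t ht)
    (fun z hz => hkk.volDensity_flow hR.metric hk hc hψ (hstay z hz) ht)
  have hpull : ∀ z ∈ Metric.ball z₀ (ρ / 2), ∀ v, _ := fun z hz v =>
    chartRanders_pullback (a := formCoeff τ e) (fun v =>
      hkk.metricForm_flow hR.metric hk hc hψ (hstay z hz) ht v v) v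
  have h42 : Metric.ball z₀ (ρ / 4) ⊆ Metric.ball z₀ (ρ / 2) :=
    Metric.ball_subset_ball (by linarith)
  have hinv : ∀ w, ψ t (ψ (-t) w) = w := fun w => by
    rw [← hψ.add hK, add_neg_cancel, hψ.zero]
  have hinv' : ∀ w, ψ (-t) (ψ t w) = w := fun w => by
    rw [← hψ.add hK, neg_add_cancel, hψ.zero]
  have hback : ∀ w ∈ Metric.ball z₀ (ρ / 4), ψ (-t) w ∈ Metric.ball z₀ (ρ / 2) := fun w hw =>
    Metric.ball_subset_ball (by linarith) (hmem _ hnt _ w hw)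
  refine ⟨f, fun z hz z' hz' => le_antisymm ?_ ?_⟩
  · exact finslerDist_map_le hτ he hρ4 hm hL hb4 hδρ hδ'.le (hψs t)
      (fun z hz => hΩe (hstay z (h42 hz) t ht)) (fun z hz => hf z (h42 hz))
      (fun z hz => hpull z (h42 hz)) (Metric.ball_subset_ball (by linarith) hz)
      (Metric.ball_subset_ball (by linarith) hz')
  · have h1 := finslerDist_map_le (ψ := ψ (-t)) (f := fun w => -f (ψ (-t) w))
      (f' := fun w => -(((coordForm (formCoeff τ e) (ψ t (ψ (-t) w))).comp
        (fderiv ℝ (ψ t) (ψ (-t) w)) - coordForm (formCoeff τ e) (ψ (-t) w)).comp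
          (fderiv ℝ (ψ (-t)) w))) (z := ψ t z) (z' := ψ t z') hτ he hρ4 hm hL hb4 hδρ hδ'.le (hψs (-t))
      (fun w hw => hΩe (hsub _ (by linarith) (hback w hw)))
      (fun w hw => ((hf _ (hback w hw)).comp w (hψd (-t) w).hasFDerivAt).neg)
      (fun w hw v => by
        have h2 := hpull _ (hback w hw) (fderiv ℝ (ψ (-t)) w v)
        have h3 : fderiv ℝ (ψ t) (ψ (-t) w) (fderiv ℝ (ψ (-t)) w v) = v := by
          have h4 := (hψd t (ψ (-t) w)).hasFDerivAt.comp w (hψd (-t) w).hasFDerivAt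
          have h5 : ψ t ∘ ψ (-t) = id := funext hinv
          rw [h5] at h4
          exact congrArg (fun A : Plane →L[ℝ] Plane => A v) (h4.unique (hasFDerivAt_id w))
        rw [h3, hinv] at h2
        rw [h2, hinv]
        exact (add_neg_cancel_right _ _).symm)
      (by have := hmem t ht _ z hz; rwa [add_halves] at this)
      (by have := hmem t ht _ z' hz'; rwa [add_halves] at this)
    simp only [hinv'] at h1
    linarith

/-- The local diffeomorphism of a surface which a diffeomorphism of the plane induces in a chart. -/
def chartConj (e : OpenPartialHomeomorph M Plane) (ψ : Plane ≃ₜ Plane) (W : Set M) (hW : IsOpen W) :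
    OpenPartialHomeomorph M M :=
  ((e.trans ψ.toOpenPartialHomeomorph).trans e.symm).restrOpen W hW

/-- Conjugating the planar flow by the chart gives the local diffeomorphisms. The distance changes
by f(q) − f(p), which telescopes to 0 in T. -/
theorem exists_almostIsometry_flow [T2Space M] (hτ : ∀ x : M, oneFormNorm g τ x < 1)
    (he : e ∈ IsManifold.maximalAtlas (𝓡 2) ∞ M) {c : ℝ}
    (hdτ : ∀ z ∈ e.target, partialD 0 (formCoeff τ e 1) z - partialD 1 (formCoeff τ e 0) z
      = c * √(metricMatrix g e z).det)
    (hΩ : IsOpen Ω) (hΩe : Ω ⊆ e.target) (hk : ContDiff ℝ ∞ k) (hc : HasCompactSupport k)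
    (hkk : IsKillingOn (metricMatrix g e) k Ω) {x₀ : M} (hx₀ : x₀ ∈ e.source) (hz₀ : e x₀ ∈ Ω) :
    ∃ W : Opens M, x₀ ∈ W ∧ (∀ x ∈ W, x ∈ e.source ∧ e x ∈ Ω) ∧ ∃ ε > 0, ∃ ψ : ℝ → Plane → Plane,
      IsFlowOf ψ k ∧ ∃ Φ : ℝ → OpenPartialHomeomorph M M,
        (∀ t x, Φ t x = e.symm (ψ t (e x))) ∧
        (∀ t ∈ Ioo (-ε) ε, ∀ x ∈ W, ψ t (e x) ∈ Ω) ∧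
        ∀ t ∈ Ioo (-ε) ε, (Φ t).source = (W : Set M) ∧ IsAlmostIsometry (randers g τ) (Φ t) := by
  obtain ⟨ψ, hψ⟩ := exists_isFlowOf (hk.of_le (m := 1) (mod_cast le_top)) hc
  obtain ⟨⟨K, hK⟩, -⟩ := exists_lipschitz_bound (hk.of_le (mod_cast le_top)) hc
  obtain ⟨δ, hδ, ε, hε, hδΩ, h⟩ := exists_triangular_flow hτ he hdτ hΩ hΩe hk hc hkk hψ hz₀
  let W : Opens M := ⟨e.source ∩ e ⁻¹' Metric.ball (e x₀) δ,
    e.isOpen_inter_preimage Metric.isOpen_ball⟩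
  let H : ℝ → Plane ≃ₜ Plane := fun t =>
    { toFun := ψ t
      invFun := ψ (-t)
      left_inv := fun x => by rw [← hψ.add hK, neg_add_cancel, hψ.zero]
      right_inv := fun x => by rw [← hψ.add hK, add_neg_cancel, hψ.zero]
      continuous_toFun := (hψ.contDiff hk hc t).continuous
      continuous_invFun := (hψ.contDiff hk hc (-t)).continuous }
  refine ⟨W, ⟨hx₀, Metric.mem_ball_self hδ⟩, fun x hx => ⟨hx.1, hδΩ hx.2⟩, ε, hε, ψ, hψ,
    fun t => chartConj e (H t) W W.2, fun t x => rfl, fun t ht x hx => (h t ht).1 _ hx.2,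
    fun t ht => ?_⟩
  obtain ⟨hm, f, hf⟩ := h t ht
  have hsrc : (chartConj e (H t) W W.2).source = (W : Set M) := by
    simp only [chartConj, OpenPartialHomeomorph.restrOpen_source, OpenPartialHomeomorph.trans_source]
    refine inter_eq_right.2 fun x hx => ⟨⟨hx.1, mem_univ _⟩, ?_⟩
    exact hΩe (hm _ hx.2)
  refine ⟨hsrc, ?_, ?_, ?_⟩
  · rw [hsrc]
    refine (contMDiffOn_symm_of_mem_maximalAtlas he).comp
      (t := e.target) (f := fun x => ψ t (e x)) ?_ fun x hx => hΩe (hm _ hx.2)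
    exact (hψ.contDiff hk hc t).contMDiff.comp_contMDiffOn
      ((contMDiffOn_of_mem_maximalAtlas he).mono fun x hx => hx.1)
  · have hy : ∀ y ∈ (chartConj e (H t) W W.2).target, y ∈ e.source ∧ ψ (-t) (e y) ∈ e.target := by
      intro y hy
      have h1 := (chartConj e (H t) W W.2).map_target hy
      rw [hsrc] at h1
      have h2 := (chartConj e (H t) W W.2).right_inv hy
      set x := (chartConj e (H t) W W.2).symm y
      have h3 : e.symm (ψ t (e x)) = y := h2
      rw [← h3]
      have h4 := hΩe (hm _ h1.2)
      refine ⟨e.map_target h4, ?_⟩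
      rw [e.right_inv h4, ← hψ.add hK, neg_add_cancel, hψ.zero]
      exact e.map_source h1.1
    refine (contMDiffOn_symm_of_mem_maximalAtlas he).comp
      (t := e.target) (f := fun x => ψ (-t) (e x)) ?_ fun y h => (hy y h).2
    exact (hψ.contDiff hk hc (-t)).contMDiff.comp_contMDiffOn
      ((contMDiffOn_of_mem_maximalAtlas he).mono fun y h => (hy y h).1)
  · rw [hsrc]
    have hd : ∀ p ∈ W, ∀ q ∈ W, finslerDist (randers g τ) (e.symm (ψ t (e p)))
        (e.symm (ψ t (e q))) = finslerDist (randers g τ) p q + (f (e q) - f (e p)) := by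
      intro p hp q hq
      rw [hf _ hp.2 _ hq.2, e.left_inv hp.1, e.left_inv hq.1]
    intro p hp q hq r hr
    change _ = triangular (randers g τ) (e.symm (ψ t (e p))) (e.symm (ψ t (e q)))
      (e.symm (ψ t (e r)))
    rw [triangular, triangular, hd p hp q hq, hd q hq r hr, hd p hp r hr]
    ring

end AlmostIsometries

/-! ### Vector fields on the surface and in the chart -/

section CoordField

set_option maxSynthPendingDepth 3

universe u

variable {M : Type u} [TopologicalSpace M] [ChartedSpace Plane M]

open scoped Classical in
/-- The coordinate representation of a vector field in the chart `e`. -/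
def coordField (e : OpenPartialHomeomorph M Plane) {U : Opens M}
    (K : (x : U) → TangentSpace (𝓡 2) (x : M)) (z : Plane) : Plane :=
  if h : e.symm z ∈ U then mfderiv (𝓡 2) (𝓡 2) e (e.symm z) (K ⟨e.symm z, h⟩) else 0

/-- The vector field on `U` with coordinate representation `k` in the chart `e`. -/
def fieldOfCoord (e : OpenPartialHomeomorph M Plane) (U : Opens M) (k : Plane → Plane) (x : U) :
    TangentSpace (𝓡 2) (x : M) :=
  (mfderiv (𝓡 2) (𝓡 2) e.symm (e x) (k (e x)) : Plane)

variable {e : OpenPartialHomeomorph M Plane} {U : Opens M}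
  {K : (x : U) → TangentSpace (𝓡 2) (x : M)} {k : Plane → Plane}

theorem coordField_of_mem {z : Plane} (h : e.symm z ∈ U) : coordField e K z
    = (mfderiv (𝓡 2) (𝓡 2) e (e.symm z) (K ⟨e.symm z, h⟩) : Plane) := dif_pos h

theorem coordField_apply {x : M} (hx : x ∈ e.source) (h : x ∈ U) :
    coordField e K (e x) = (mfderiv (𝓡 2) (𝓡 2) e x (K ⟨x, h⟩) : Plane) := by
  have key : ∀ y (hy : y ∈ U), y = x → (mfderiv (𝓡 2) (𝓡 2) e y (K ⟨y, hy⟩) : Plane)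
      = (mfderiv (𝓡 2) (𝓡 2) e x (K ⟨x, h⟩) : Plane) := by
    rintro _ _ rfl
    rfl
  have h' : e.symm (e x) ∈ U := by rwa [e.left_inv hx]
  exact (coordField_of_mem h').trans (key _ h' (e.left_inv hx))

variable [IsManifold (𝓡 2) ∞ M]

omit [IsManifold (𝓡 2) ∞ M] in
theorem mfderiv_symm_coordField (he : e ∈ IsManifold.maximalAtlas (𝓡 2) ∞ M) {x : M}
    (hx : x ∈ e.source) (h : x ∈ U) :
    (mfderiv (𝓡 2) (𝓡 2) e.symm (e x) (coordField e K (e x)) : Plane) = K ⟨x, h⟩ := by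
  rw [coordField_apply hx h]
  exact mfderiv_symm_chart he hx (K ⟨x, h⟩)

omit [IsManifold (𝓡 2) ∞ M] in
theorem mfderiv_symm_coordField' (he : e ∈ IsManifold.maximalAtlas (𝓡 2) ∞ M) {z : Plane}
    (hz : z ∈ e.target) (h : e.symm z ∈ U) :
    (mfderiv (𝓡 2) (𝓡 2) e.symm z (coordField e K z) : Plane) = K ⟨e.symm z, h⟩ := by
  refine Eq.trans ?_ (mfderiv_symm_coordField (K := K) he (e.map_target hz) h)
  have key : ∀ y, y = z → (mfderiv (𝓡 2) (𝓡 2) e.symm z (coordField e K z) : Plane)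
      = (mfderiv (𝓡 2) (𝓡 2) e.symm y (coordField e K y) : Plane) := by
    rintro _ rfl
    rfl
  exact key _ (e.right_inv hz)

omit [IsManifold (𝓡 2) ∞ M] in
theorem coordField_fieldOfCoord (he : e ∈ IsManifold.maximalAtlas (𝓡 2) ∞ M) {z : Plane}
    (hz : z ∈ e.target) (h : e.symm z ∈ U) : coordField e (fieldOfCoord e U k) z = k z := by
  refine (coordField_of_mem h).trans ?_
  have key : ∀ y, y = z → (mfderiv (𝓡 2) (𝓡 2) e (e.symm z)
      (mfderiv (𝓡 2) (𝓡 2) e.symm y (k y) : Plane) : Plane) = k z := by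
    rintro _ rfl
    exact mfderiv_chart_symm he hz _
  exact key _ (e.right_inv hz)

omit [ChartedSpace Plane M] [IsManifold (𝓡 2) ∞ M] in
theorem isOpen_coordDomain : IsOpen (e.target ∩ e.symm ⁻¹' (U : Set M)) :=
  e.isOpen_inter_preimage_symm U.2

/-- All tangent spaces are definitionally the model plane. This allows a base point to be replaced
by an equal one without a cast on the vector. -/
theorem tangentBundle_mk_eq {N : Type*} [TopologicalSpace N] [ChartedSpace Plane N] {x y : N}
    (h : x = y) (v : Plane) :
    (⟨x, v⟩ : TangentBundle (𝓡 2) N) = (⟨y, v⟩ : TangentBundle (𝓡 2) N) := by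
  subst h
  rfl

open scoped Classical in
theorem contDiffAt_coordField (he : e ∈ IsManifold.maximalAtlas (𝓡 2) ∞ M)
    (hK : ContMDiff (𝓡 2) (𝓡 2).tangent ∞
      (fun x : U => (⟨(x : M), K x⟩ : TangentBundle (𝓡 2) M))) {z : Plane}
    (hz : z ∈ e.target) (h : e.symm z ∈ U) : ContDiffAt ℝ ∞ (coordField e K) z := by
  -- Extension by zero turns the field on the subtype U into a section over M, smooth at points of
  -- the open set U.
  set s : M → TangentBundle (𝓡 2) M := fun x =>
    ⟨x, if h : x ∈ U then K ⟨x, h⟩ else 0⟩ with hs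
  have h1 : ContMDiffAt (𝓡 2) (𝓡 2).tangent ∞ s (e.symm z) := by
    refine (contMDiffAt_subtype_iff (U := U) (x := ⟨e.symm z, h⟩)).1 ?_
    refine (hK ⟨e.symm z, h⟩).congr_of_eventuallyEq (Filter.Eventually.of_forall fun x => ?_)
    simp only [hs]
    rw [dif_pos x.2]
  have h2 : ContMDiffAt (𝓡 2).tangent (𝓡 2).tangent ∞
      (tangentMapWithin (𝓡 2) (𝓡 2) e e.source) (s (e.symm z)) :=
    ((contMDiffOn_of_mem_maximalAtlas he).contMDiffOn_tangentMapWithin (m := ∞) (by simp)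
      e.open_source.uniqueMDiffOn).contMDiffAt ((e.open_source.preimage
      (FiberBundle.continuous_proj Plane (TangentSpace (𝓡 2)))).mem_nhds (e.map_target hz))
  have h3 := h2.comp z (h1.comp z (contMDiffAt_symm_of_mem_maximalAtlas he hz))
  refine contMDiffAt_vectorSpace_iff_contDiffAt.1 (h3.congr_of_eventuallyEq ?_)
  filter_upwards [isOpen_coordDomain.mem_nhds (⟨hz, h⟩ : z ∈ e.target ∩ e.symm ⁻¹' (U : Set M))]
    with w hw
  simp only [Function.comp, tangentMapWithin]
  rw [mfderivWithin_of_isOpen e.open_source (e.map_target hw.1)]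
  refine Eq.trans ?_ (tangentBundle_mk_eq (e.right_inv hw.1) _).symm
  have h4 : (s (e.symm w)).snd = K ⟨e.symm w, hw.2⟩ := dif_pos hw.2
  refine congrArg (fun v : Plane => (⟨w, v⟩ : TangentBundle (𝓡 2) Plane))
    ((coordField_of_mem hw.2).trans ?_)
  exact congrArg (fun v => (mfderiv (𝓡 2) (𝓡 2) e (e.symm w) v : Plane)) h4.symm

theorem contMDiff_of_coordField (he : e ∈ IsManifold.maximalAtlas (𝓡 2) ∞ M)
    (hU : (U : Set M) ⊆ e.source)
    (hk : ∀ z ∈ e.target ∩ e.symm ⁻¹' (U : Set M), ContDiffAt ℝ ∞ (coordField e K) z) :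
    ContMDiff (𝓡 2) (𝓡 2).tangent ∞
      (fun x : U => (⟨(x : M), K x⟩ : TangentBundle (𝓡 2) M)) := by
  intro x
  have hx := hU x.2
  have h1 := contMDiffAt_pushforward he (e.map_source hx) (hk (e x) ⟨e.map_source hx, by
    simp [e.left_inv hx]⟩)
  have h2 := h1.comp (x : M) (contMDiffAt_of_mem_maximalAtlas he hx)
  have h3 := (contMDiffAt_subtype_iff (U := U) (x := x)).2 h2
  refine h3.congr_of_eventuallyEq (Filter.Eventually.of_forall fun y => ?_)
  have h4 := mfderiv_symm_coordField (K := K) he (hU y.2) y.2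
  simp only [Function.comp]
  refine Eq.trans ?_ (tangentBundle_mk_eq (e.left_inv (hU y.2)) _).symm
  exact congrArg (fun v => (⟨(y : M), v⟩ : TangentBundle (𝓡 2) M)) h4.symm

theorem lieMetric_congr {G : Plane → Matrix (Fin 2) (Fin 2) ℝ} {k k' : Plane → Plane} {z : Plane}
    (h : k =ᶠ[𝓝 z] k') (i j : Fin 2) : lieMetric G k i j z = lieMetric G k' i j z := by
  have h1 : ∀ m, (fun w => k w m) =ᶠ[𝓝 z] (fun w => k' w m) := fun m =>
    h.mono fun w hw => by simp only [hw]
  simp only [lieMetric, fun m l => partialD_congr m (h1 l), h.eq_of_nhds]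

/-- Multiplication by a bump function. It provides a global flow while keeping the field unchanged
near z₀. -/
theorem exists_compactSupport_extension {Ω : Set Plane} (hΩ : IsOpen Ω) {k : Plane → Plane}
    (hk : ∀ z ∈ Ω, ContDiffAt ℝ ∞ k z) {z₀ : Plane} (hz₀ : z₀ ∈ Ω) :
    ∃ k' : Plane → Plane, ContDiff ℝ ∞ k' ∧ HasCompactSupport k' ∧ ∃ r > 0,
      Metric.ball z₀ r ⊆ Ω ∧ ∀ z ∈ Metric.ball z₀ r, k' z = k z := by
  obtain ⟨R, hR, hRΩ⟩ := Metric.isOpen_iff.1 hΩ z₀ hz₀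
  let χ : ContDiffBump z₀ := ⟨R / 4, R / 2, by positivity, by linarith⟩
  refine ⟨fun z => χ z • k z, ?_, χ.hasCompactSupport.smul_right, R / 4, by positivity,
    (Metric.ball_subset_ball (by linarith)).trans hRΩ, fun z hz => ?_⟩
  · rw [contDiff_iff_contDiffAt]
    intro z
    by_cases hz : z ∈ Metric.ball z₀ R
    · exact χ.contDiff.contDiffAt.smul (hk z (hRΩ hz))
    · have h1 : z ∈ (tsupport χ)ᶜ := by
        rw [χ.tsupport_eq]
        intro h
        exact hz (Metric.closedBall_subset_ball (by change R / 2 < R; linarith) h)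
      refine (contDiffAt_const (c := (0 : Plane))).congr_of_eventuallyEq ?_
      filter_upwards [(isClosed_tsupport χ).isOpen_compl.mem_nhds h1] with w hw
      rw [image_eq_zero_of_notMem_tsupport hw, zero_smul]
  · change χ z • k z = k z
    rw [χ.one_of_mem_closedBall (Metric.ball_subset_closedBall hz), one_smul]

omit [IsManifold (𝓡 2) ∞ M] in
theorem hasMFDerivAt_symm_comp (he : e ∈ IsManifold.maximalAtlas (𝓡 2) ∞ M) {c : ℝ → Plane}
    {v : Plane} {t : ℝ} (hc : HasDerivAt c v t) (ht : c t ∈ e.target) :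
    HasMFDerivAt 𝓘(ℝ, ℝ) (𝓡 2) (fun s => e.symm (c s)) t
      ((1 : ℝ →L[ℝ] ℝ).smulRight (mfderiv (𝓡 2) (𝓡 2) e.symm (c t) v)) := by
  have h1 := (mdifferentiableAt_chart_symm he ht).hasMFDerivAt.comp t
    (hasMFDerivAt_iff_hasFDerivAt.2 (show HasFDerivAt c ((1 : ℝ →L[ℝ] ℝ).smulRight v) t from
      hc.hasFDerivAt))
  refine h1.congr_mfderiv ?_
  have key : ∀ (A : Plane →L[ℝ] Plane), A.comp ((1 : ℝ →L[ℝ] ℝ).smulRight v)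
      = (1 : ℝ →L[ℝ] ℝ).smulRight (A v) := fun A => by
    ext
    simp
  exact key _

/-- Being almost Killing is local, so the field may be replaced near each point by a compactly
supported one with a global flow. The trajectories used stay in the ball where the two fields agree.
-/
theorem isAlmostKilling_of_isKillingOn [T2Space M] {g : SurfaceMetric M} {τ : OneForm M}
    (hτ : ∀ x : M, oneFormNorm g τ x < 1) (he : e ∈ IsManifold.maximalAtlas (𝓡 2) ∞ M) {c : ℝ}
    (hdτ : ∀ z ∈ e.target, partialD 0 (formCoeff τ e 1) z - partialD 1 (formCoeff τ e 0) z
      = c * √(metricMatrix g e z).det) (hU : (U : Set M) ⊆ e.source)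
    (hK : IsKillingOn (metricMatrix g e) (coordField e K) (e.target ∩ e.symm ⁻¹' (U : Set M))) :
    IsAlmostKilling (randers g τ) U K := by
  refine ⟨contMDiff_of_coordField he hU hK.smooth, fun x₀ hx₀ => ?_⟩
  have hx₀e := hU hx₀
  have hz₀ : e x₀ ∈ e.target ∩ e.symm ⁻¹' (U : Set M) :=
    ⟨e.map_source hx₀e, by simpa [e.left_inv hx₀e] using hx₀⟩
  obtain ⟨k', hk', hc', r, hr, hrΩ, hkr⟩ :=
    exists_compactSupport_extension isOpen_coordDomain hK.smooth hz₀
  have hKill : IsKillingOn (metricMatrix g e) k' (Metric.ball (e x₀) r) :=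
    ⟨fun z _ => hk'.contDiffAt, fun z hz i j => by
      rw [← hK.lie_eq z (hrΩ hz) i j]
      refine lieMetric_congr ?_ i j
      filter_upwards [Metric.isOpen_ball.mem_nhds hz] with w hw using hkr w hw⟩
  obtain ⟨W, hxW, hW, ε, hε, ψ, hψ, Φ, hΦ, hΦW, hiso⟩ := exists_almostIsometry_flow hτ he hdτ
    Metric.isOpen_ball (fun z hz => (hrΩ hz).1) hk' hc' hKill hx₀e (Metric.mem_ball_self hr)
  refine ⟨W, hxW, fun x hx => ?_, ε, hε, Φ, fun x hx => ?_, fun t ht x hx => ?_, hiso⟩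
  · have h1 := (hrΩ (hW x hx).2).2
    rwa [mem_preimage, e.left_inv (hW x hx).1] at h1
  · rw [hΦ, hψ.zero, e.left_inv (hW x hx).1]
  · have h1 := hΦW t ht x hx
    have h2 : Φ t x ∈ U := by
      rw [hΦ]
      exact (hrΩ h1).2
    refine ⟨h2, ?_⟩
    have h3 := hasMFDerivAt_symm_comp he (hψ.deriv t (e x)) (hrΩ h1).1
    have h4 : (fun s : ℝ => Φ s x) = fun s => e.symm (ψ s (e x)) := funext fun s => hΦ s x
    have h5 := mfderiv_symm_coordField' (K := K) he (hrΩ h1).1 (hrΩ h1).2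
    rw [← hkr _ h1] at h5
    have h6 : ∀ (f : ℝ → M) (hf : f = fun s => e.symm (ψ s (e x))) (h : f t ∈ U),
        HasMFDerivAt 𝓘(ℝ, ℝ) (𝓡 2) f t ((1 : ℝ →L[ℝ] ℝ).smulRight (K ⟨f t, h⟩)) := by
      rintro _ rfl h
      refine h3.congr_mfderiv ?_
      exact congrArg (fun v : Plane => (1 : ℝ →L[ℝ] ℝ).smulRight v) h5
    exact h6 _ h4 h2

end CoordField

/-! ### Almost Killing fields are Killing -/

section Converse

set_option maxSynthPendingDepth 3

universe u

variable {M : Type u} [TopologicalSpace M] [ChartedSpace Plane M] [IsManifold (𝓡 2) ∞ M]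
  {e : OpenPartialHomeomorph M Plane} {U : Opens M}
  {K : (x : U) → TangentSpace (𝓡 2) (x : M)} {k : Plane → Plane} {ψ : ℝ → Plane → Plane}

omit [IsManifold (𝓡 2) ∞ M] in
theorem hasDerivAt_chart_of_integral (he : e ∈ IsManifold.maximalAtlas (𝓡 2) ∞ M) {β : ℝ → M}
    {t : ℝ} (h : β t ∈ U) (hs : β t ∈ e.source)
    (hβ : HasMFDerivAt 𝓘(ℝ, ℝ) (𝓡 2) β t ((1 : ℝ →L[ℝ] ℝ).smulRight (K ⟨β t, h⟩))) :
    HasDerivAt (fun s => e (β s)) (coordField e K (e (β t))) t := by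
  have h1 := (mdifferentiableAt_chart he hs).hasMFDerivAt.comp t hβ
  have h2 : HasFDerivAt (fun s => e (β s)) ((mfderiv (𝓡 2) (𝓡 2) e (β t) : Plane →L[ℝ] Plane).comp
      ((1 : ℝ →L[ℝ] ℝ).smulRight (K ⟨β t, h⟩ : Plane))) t := hasMFDerivAt_iff_hasFDerivAt.1 h1
  have h3 : ∀ (A : Plane →L[ℝ] Plane) (v : Plane) (c : ℝ → Plane),
      HasFDerivAt c (A.comp ((1 : ℝ →L[ℝ] ℝ).smulRight v)) t → HasDerivAt c (A v) t := by
    intro A v c hc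
    simpa using hc.hasDerivAt
  rw [coordField_apply hs h]
  exact h3 _ _ _ h2

omit [IsManifold (𝓡 2) ∞ M] in
-- Nothing keeps β inside the chart a priori, so uniqueness is applied to germs. The times at which
-- the germs agree form an open set, relatively closed because M is Hausdorff, and the interval is
-- connected.
theorem integralCurve_eq_flow [T2Space M] (he : e ∈ IsManifold.maximalAtlas (𝓡 2) ∞ M)
    {B : Set Plane} (hB : IsOpen B) (hBe : B ⊆ e.target)
    (hkB : ∀ z ∈ B, k z = coordField e K z) {L : NNReal} (hL : LipschitzWith L k)
    (hψ : IsFlowOf ψ k) {ε : ℝ} {y : Plane} {β : ℝ → M}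
    (hβ : ∀ t ∈ Ioo (-ε) ε, ∃ h : β t ∈ U, HasMFDerivAt 𝓘(ℝ, ℝ) (𝓡 2) β t
      ((1 : ℝ →L[ℝ] ℝ).smulRight (K ⟨β t, h⟩)))
    (hβ0 : β 0 = e.symm y) (hy : ∀ t ∈ Ioo (-ε) ε, ψ t y ∈ B) :
    ∀ t ∈ Ioo (-ε) ε, β t = e.symm (ψ t y) := by
  intro t ht
  have h0 : (0 : ℝ) ∈ Ioo (-ε) ε := by
    have := ht.1.trans ht.2
    constructor <;> linarith
  have hcβ : ∀ s ∈ Ioo (-ε) ε, ContinuousAt β s := fun s hs => (hβ s hs).2.continuousAt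
  have hcψ : ∀ s, ContinuousAt (fun s => ψ s y) s := fun s => (hψ.deriv s y).continuousAt
  have hcα : ∀ s ∈ Ioo (-ε) ε, ContinuousAt (fun s => e.symm (ψ s y)) s := fun s hs =>
    ContinuousAt.comp (g := e.symm) (f := fun s => ψ s y)
      (e.symm.continuousAt (hBe (hy s hs))) (hcψ s)
  have hloc : ∀ s ∈ Ioo (-ε) ε, β s = e.symm (ψ s y) → β =ᶠ[𝓝 s] fun s => e.symm (ψ s y) := by
    intro s hs heq
    have hBs : β s ∈ e.source ∩ e ⁻¹' B := by
      rw [heq]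
      exact ⟨e.map_target (hBe (hy s hs)), by
        rw [mem_preimage, e.right_inv (hBe (hy s hs))]
        exact hy s hs⟩
    have h1 : ∀ᶠ r in 𝓝 s, β r ∈ e.source ∩ e ⁻¹' B :=
      (hcβ s hs) ((e.isOpen_inter_preimage hB).mem_nhds hBs)
    have hI : ∀ᶠ r in 𝓝 s, r ∈ Ioo (-ε) ε := isOpen_Ioo.mem_nhds hs
    have h2 : (fun r => e (β r)) =ᶠ[𝓝 s] fun r => ψ r y := by
      refine ODE_solution_unique_of_eventually (v := fun _ => k) (s := fun _ => univ) (K := L)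
        (Filter.Eventually.of_forall fun r => hL.lipschitzOnWith) ?_
        (Filter.Eventually.of_forall fun r => ⟨hψ.deriv r y, mem_univ _⟩) ?_
      · filter_upwards [h1, hI] with r hr hrI
        obtain ⟨h, h'⟩ := hβ r hrI
        rw [hkB _ hr.2]
        exact ⟨hasDerivAt_chart_of_integral he h hr.1 h', mem_univ _⟩
      · simp only [heq]
        exact e.right_inv (hBe (hy s hs))
    filter_upwards [h1, h2] with r hr hr'
    rw [← hr', e.left_inv hr.1]
  have hsub := isPreconnected_Ioo.subset_of_closure_inter_subset
    (u := {s | β =ᶠ[𝓝 s] fun s => e.symm (ψ s y)}) isOpen_setOfPred_eventually_nhds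
    ⟨0, h0, hloc 0 h0 (by rw [hβ0, hψ.zero])⟩ (by
      rintro s ⟨hs, hsI⟩
      refine hloc s hsI ?_
      by_contra hne
      have h1 := ((hcβ s hsI).ne_iff_eventually_ne (hcα s hsI)).1 hne
      obtain ⟨r, hr, hr'⟩ := ((mem_closure_iff_frequently.1 hs).and_eventually h1).exists
      exact hr' (Filter.EventuallyEq.eq_of_nhds hr))
  exact Filter.EventuallyEq.eq_of_nhds (hsub ht)

theorem lieMetric_symm {G : Plane → Matrix (Fin 2) (Fin 2) ℝ} (hG : ∀ z i j, G z i j = G z j i)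
    (i j : Fin 2) (z : Plane) : lieMetric G k i j z = lieMetric G k j i z := by
  simp only [lieMetric]
  rw [show (fun w => G w i j) = fun w => G w j i from funext fun w => hG w i j, hG z 0 j, hG z 1 j,
    hG z i 0, hG z i 1]
  ring

/-- Near z₀ the given flow is the chart image of a smooth planar flow ψ. Preservation of T makes
ψ_t*g constant in t at z₀, and the derivative at t = 0 is the Lie derivative of the metric. -/
theorem isKillingOn_of_isAlmostKilling [T2Space M] {g : SurfaceMetric M} {τ : OneForm M}
    (hτ : ∀ x : M, oneFormNorm g τ x < 1) (he : e ∈ IsManifold.maximalAtlas (𝓡 2) ∞ M)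
    (hK : IsAlmostKilling (randers g τ) U K) :
    IsKillingOn (metricMatrix g e) (coordField e K) (e.target ∩ e.symm ⁻¹' (U : Set M)) := by
  obtain ⟨hKs, hK⟩ := hK
  have hs : ∀ z ∈ e.target ∩ e.symm ⁻¹' (U : Set M), ContDiffAt ℝ ∞ (coordField e K) z :=
    fun z hz => contDiffAt_coordField he hKs hz.1 hz.2
  refine ⟨hs, fun z₀ hz₀ => ?_⟩
  have hG := (isMetricOn_metricMatrix g he).1
  obtain ⟨W, hW, hWU, ε, hε, Φ, hΦ0, hΦ, hiso⟩ := hK (e.symm z₀) hz₀.2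
  obtain ⟨k, hk, hc, r, hr, hrΩ, hkr⟩ := exists_compactSupport_extension isOpen_coordDomain hs hz₀
  obtain ⟨⟨Lk, hLk⟩, L, hL⟩ := exists_lipschitz_bound (hk.of_le (mod_cast le_top)) hc
  obtain ⟨ψ, hψ⟩ := exists_isFlowOf (hk.of_le (m := 1) (mod_cast le_top)) hc
  -- Up to this time, points starting within r/2 of z₀ remain in the r-ball, where the cut-off field
  -- equals the original one.
  set ε' := min ε (r / 2 / (L + 1)) with hε'
  have hL0 : (0 : ℝ) < L + 1 := by positivity
  have hε'0 : 0 < ε' := lt_min hε (by positivity)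
  have hε'r : ε' * (L + 1) ≤ r / 2 := by
    have := min_le_right ε (r / 2 / (L + 1))
    rwa [le_div_iff₀ hL0] at this
  have hstay : ∀ y ∈ Metric.ball z₀ (r / 2), ∀ t ∈ Ioo (-ε') ε', ψ t y ∈ Metric.ball z₀ r := by
    intro y hy t ht
    have h1 := hψ.norm_sub_le hL t y
    have h2 : |t| < ε' := abs_lt.2 ht
    have h3 := dist_triangle (ψ t y) y z₀
    rw [Metric.mem_ball] at hy ⊢
    rw [← dist_eq_norm] at h1
    have h4 : (0 : ℝ) ≤ L := L.2
    nlinarith [abs_nonneg t]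
  have hsubε : Ioo (-ε') ε' ⊆ Ioo (-ε) ε :=
    Ioo_subset_Ioo (neg_le_neg (min_le_left _ _)) (min_le_left _ _)
  have hWn : ∀ᶠ y in 𝓝 z₀, y ∈ Metric.ball z₀ (r / 2) ∧ e.symm y ∈ W :=
    Filter.Eventually.and (Metric.ball_mem_nhds z₀ (by positivity))
      ((e.symm.continuousAt hz₀.1) (W.2.mem_nhds hW))
  have hid : ∀ y ∈ Metric.ball z₀ (r / 2), e.symm y ∈ W → ∀ t ∈ Ioo (-ε') ε',
      Φ t (e.symm y) = e.symm (ψ t y) := fun y hy hyW =>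
    integralCurve_eq_flow (K := K) (β := fun t => Φ t (e.symm y)) he Metric.isOpen_ball
      (fun z hz => (hrΩ hz).1) hkr hLk hψ (fun t ht => hΦ t (hsubε ht) _ hyW) (hΦ0 _ hyW)
      (hstay y hy)
  have hz₀r : z₀ ∈ Metric.ball z₀ (r / 2) := Metric.mem_ball_self (by positivity)
  have h0 : (0 : ℝ) ∈ Ioo (-ε') ε' := ⟨by linarith, hε'0⟩
  have hform : ∀ t ∈ Ioo (-ε') ε', ∀ v, metricForm (metricMatrix g e) (ψ t z₀)
      (fderiv ℝ (ψ t) z₀ v) (fderiv ℝ (ψ t) z₀ v) = metricForm (metricMatrix g e) z₀ v v := by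
    intro t ht v
    refine metricForm_eq_of_triangular hτ he ((hψ.contDiff hk hc t).differentiable (by simp) z₀)
      hz₀.1 (hrΩ (hstay z₀ hz₀r t ht)).1 ?_ v
    filter_upwards [hWn] with w hw
    obtain ⟨hsrc, -, -, hT⟩ := hiso t (hsubε ht)
    rw [← hid _ hz₀r hW t ht, ← hid _ hw.1 hw.2 t ht]
    have h1 : e.symm z₀ ∈ (Φ t).source := by rw [hsrc]; exact hW
    have h2 : e.symm w ∈ (Φ t).source := by rw [hsrc]; exact hw.2
    exact hT _ h1 _ h2 _ h1
  have hlie : ∀ v, lieForm (metricMatrix g e) k z₀ v v = 0 := by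
    intro v
    have h1 := hG.hasDerivAt_metricForm_flow hk hc hψ (t := 0) (z := z₀)
      (by rw [hψ.zero]; exact hz₀.1) v v
    have h2 : HasDerivAt (fun s => metricForm (metricMatrix g e) (ψ s z₀)
        (fderiv ℝ (ψ s) z₀ v) (fderiv ℝ (ψ s) z₀ v)) 0 0 := by
      refine (hasDerivAt_const (0 : ℝ) (metricForm (metricMatrix g e) z₀ v v)).congr_of_eventuallyEq ?_
      filter_upwards [isOpen_Ioo.mem_nhds h0] with s hs using hform s hs v
    have h3 := h1.unique h2
    have h4 : ψ 0 = id := funext hψ.zero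
    simpa [h4] using h3
  -- Polarisation: the quadratic form on ∂₀, ∂₁ and ∂₀ + ∂₁ determines all components of the
  -- symmetric tensor.
  have h00 := hlie (EuclideanSpace.single 0 1)
  have h11 := hlie (EuclideanSpace.single 1 1)
  have h01 := hlie (EuclideanSpace.single 0 1 + EuclideanSpace.single 1 1)
  simp [lieForm] at h00 h11 h01
  have hsym := lieMetric_symm (k := k) hG.symm 0 1 z₀
  have hz : ∀ i j, lieMetric (metricMatrix g e) k i j z₀ = 0 := by
    intro i j
    obtain rfl | rfl : i = 0 ∨ i = 1 := by omega
    all_goals obtain rfl | rfl : j = 0 ∨ j = 1 := by omega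
    all_goals linarith
  intro i j
  rw [← hz i j]
  refine lieMetric_congr ?_ i j
  filter_upwards [Metric.ball_mem_nhds z₀ hr] with w hw using (hkr w hw).symm

end Converse

/-! ### The space of Killing fields has dimension three -/

section Dimension

variable {G : Plane → Matrix (Fin 2) (Fin 2) ℝ} {Ω : Set Plane} {k k' : Plane → Plane}

theorem IsMetricOn.isKillingOn_linear (hG : IsMetricOn G Ω) (hk : IsKillingOn G k Ω)
    (hk' : IsKillingOn G k' Ω) (s : ℝ) : IsKillingOn G (fun z => s • k z + k' z) Ω ∧
      ∀ z ∈ Ω, killingJet G (fun z => s • k z + k' z) z = s • killingJet G k z + killingJet G k' z := by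
  have hp : ∀ z ∈ Ω, ∀ i m, partialD i (fun w => s * k w m + k' w m) z
      = s * partialD i (fun w => k w m) z + partialD i (fun w => k' w m) z := by
    intro z hz i m
    have h1 := differentiableAt_coord (hk.smooth z hz) m
    have h2 := differentiableAt_coord (hk'.smooth z hz) m
    rw [partialD_add i (h1.const_mul s) h2, partialD_mul i (differentiableAt_const s) h1,
      partialD_const]
    ring
  have hs : ∀ z ∈ Ω, ContDiffAt ℝ ∞ (fun z => s • k z + k' z) z := fun z hz =>
    ((hk.smooth z hz).const_smul s).add (hk'.smooth z hz)
  refine ⟨⟨hs, fun z hz i j => ?_⟩, fun z hz => ?_⟩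
  · have h1 := hk.lie_eq z hz i j
    have h2 := hk'.lie_eq z hz i j
    simp only [lieMetric] at h1 h2 ⊢
    simp only [PiLp.add_apply, PiLp.smul_apply, smul_eq_mul, hp z hz]
    linear_combination s * h1 + h2
  · have hl : ∀ j, lowered G (fun z => s • k z + k' z) j z
        = s * lowered G k j z + lowered G k' j z := fun j => by
      simp only [lowered, PiLp.add_apply, PiLp.smul_apply, smul_eq_mul]
      ring
    have hpl : ∀ i j, partialD i (lowered G (fun z => s • k z + k' z) j) z
        = s * partialD i (lowered G k j) z + partialD i (lowered G k' j) z := fun i j => by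
      rw [hG.partialD_lowered hz (hs z hz), hG.partialD_lowered hz (hk.smooth z hz),
        hG.partialD_lowered hz (hk'.smooth z hz)]
      simp only [PiLp.add_apply, PiLp.smul_apply, smul_eq_mul, hp z hz]
      ring
    funext l
    fin_cases l
    · exact hl 0
    · exact hl 1
    · change (partialD 0 (lowered G (fun z => s • k z + k' z) 1) z
        - partialD 1 (lowered G (fun z => s • k z + k' z) 0) z) / (2 * volDensity G z)
        = s * ((partialD 0 (lowered G k 1) z - partialD 1 (lowered G k 0) z)
          / (2 * volDensity G z))
          + (partialD 0 (lowered G k' 1) z - partialD 1 (lowered G k' 0) z)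
          / (2 * volDensity G z)
      rw [hpl, hpl]
      ring

theorem IsKillingOn.congr (hk : IsKillingOn G k Ω) {Ω' : Set Plane} (hΩ : IsOpen Ω')
    (hs : Ω' ⊆ Ω) (h : ∀ z ∈ Ω', k' z = k z) : IsKillingOn G k' Ω' := by
  have h1 : ∀ z ∈ Ω', k' =ᶠ[𝓝 z] k := fun z hz => by
    filter_upwards [hΩ.mem_nhds hz] with w hw using h w hw
  exact ⟨fun z hz => (hk.smooth z (hs hz)).congr_of_eventuallyEq (h1 z hz), fun z hz i j =>
    (lieMetric_congr (h1 z hz) i j).trans (hk.lie_eq z (hs hz) i j)⟩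

theorem killingJet_congr {z : Plane} (h : k' =ᶠ[𝓝 z] k) : killingJet G k' z = killingJet G k z := by
  have h1 : ∀ j, lowered G k' j =ᶠ[𝓝 z] lowered G k j := fun j =>
    h.mono fun w hw => by simp only [lowered, hw]
  simp only [killingJet, fun i j => partialD_congr i (h1 j), (h1 _).eq_of_nhds]

theorem isKillingOn_zero : IsKillingOn G (fun _ => 0) Ω :=
  ⟨fun _ _ => contDiffAt_const, fun z _ i j => by simp [lieMetric, partialD_const]⟩

variable {M : Type*} [TopologicalSpace M] [ChartedSpace Plane M]
  {e : OpenPartialHomeomorph M Plane} {U : Opens M}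

theorem coordField_linear (K K' : (x : U) → TangentSpace (𝓡 2) (x : M)) (s : ℝ) :
    coordField e (s • K + K') = fun z => s • coordField e K z + coordField e K' z := by
  funext z
  by_cases h : e.symm z ∈ U
  · rw [coordField_of_mem h, coordField_of_mem h, coordField_of_mem h]
    have key : ∀ (A : Plane →L[ℝ] Plane) (v w : Plane), A (s • v + w) = s • A v + A w :=
      fun A v w => by rw [map_add, map_smul]
    exact key (mfderiv (𝓡 2) (𝓡 2) e (e.symm z)) (K ⟨_, h⟩) (K' ⟨_, h⟩)
  · simp [coordField, h]

theorem coordField_zero : coordField e (0 : (x : U) → TangentSpace (𝓡 2) (x : M)) = fun _ => 0 := by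
  have h := coordField_linear (e := e) (0 : (x : U) → TangentSpace (𝓡 2) (x : M)) 0 (-1)
  simp only [smul_zero, add_zero] at h
  funext z
  have := congrFun h z
  simpa using this

/-- The vector fields on `U` whose coordinate representation in the chart `e` is a Killing field. -/
def killingSubmodule (hG : IsMetricOn G (e.target ∩ e.symm ⁻¹' (U : Set M))) :
    Submodule ℝ ((x : U) → TangentSpace (𝓡 2) (x : M)) where
  carrier := {K | IsKillingOn G (coordField e K) (e.target ∩ e.symm ⁻¹' (U : Set M))}
  add_mem' {K K'} hK hK' := by
    have h := (hG.isKillingOn_linear hK hK' 1).1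
    rw [← coordField_linear, one_smul] at h
    exact h
  zero_mem' := by
    rw [mem_ofPred_eq, coordField_zero]
    exact isKillingOn_zero
  smul_mem' s K hK := by
    have h := (hG.isKillingOn_linear hK isKillingOn_zero s).1
    have h2 := coordField_linear (e := e) K 0 s
    rw [coordField_zero, add_zero] at h2
    rw [← h2] at h
    exact h

/-- The 1-jet of a Killing field at a point, as a linear map. -/
def killingJetMap (hG : IsMetricOn G (e.target ∩ e.symm ⁻¹' (U : Set M))) {q : Plane}
    (hq : q ∈ e.target ∩ e.symm ⁻¹' (U : Set M)) : killingSubmodule hG →ₗ[ℝ] (Fin 3 → ℝ) where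
  toFun K := killingJet G (coordField e K.1) q
  map_add' K K' := by
    have h := (hG.isKillingOn_linear K.2 K'.2 1).2 q hq
    rw [← coordField_linear, one_smul, one_smul] at h
    exact h
  map_smul' s K := by
    have h := (hG.isKillingOn_linear K.2 (killingSubmodule hG).zero_mem s).2 q hq
    rw [← coordField_linear, add_zero] at h
    have h0 := (hG.isKillingOn_linear (killingSubmodule hG).zero_mem
      (killingSubmodule hG).zero_mem 1).2 q hq
    rw [← coordField_linear, add_zero, one_smul, one_smul, left_eq_add] at h0
    rw [h0, add_zero] at h
    exact h

/-- The jet at one point of U is an isomorphism onto ℝ³: injective since U is connected, surjective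
since fields with any jet exist on B and restrict to U. The fields come from B because U itself need
not be simply connected. -/
theorem finrank_killingSubmodule [IsManifold (𝓡 2) ∞ M]
    (he : e ∈ IsManifold.maximalAtlas (𝓡 2) ∞ M)
    (hG : IsMetricOn G (e.target ∩ e.symm ⁻¹' (U : Set M))) {κ : ℝ}
    (hκ : ∀ z ∈ e.target ∩ e.symm ⁻¹' (U : Set M), sectionalCurvature G z = κ)
    (hU : (U : Set M) ⊆ e.source) (hc : IsConnected (U : Set M)) {B : Set Plane}
    (hB : e.target ∩ e.symm ⁻¹' (U : Set M) ⊆ B)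
    (hex : ∀ q ∈ B, ∀ c, ∃ k, IsKillingOn G k B ∧ killingJet G k q = c) :
    Module.finrank ℝ (killingSubmodule hG) = 3 := by
  obtain ⟨x, hx⟩ := hc.nonempty
  have hmem : ∀ x ∈ U, e x ∈ e.target ∩ e.symm ⁻¹' (U : Set M) := fun x hx =>
    ⟨e.map_source (hU hx), by simpa [e.left_inv (hU hx)] using hx⟩
  have hq := hmem x hx
  have hpre : IsPreconnected (e.target ∩ e.symm ⁻¹' (U : Set M)) := by
    have h1 : e.target ∩ e.symm ⁻¹' (U : Set M) = e '' (U : Set M) := by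
      ext z
      constructor
      · intro hz
        exact ⟨e.symm z, hz.2, e.right_inv hz.1⟩
      · rintro ⟨y, hy, rfl⟩
        exact hmem y hy
    rw [h1]
    exact hc.isPreconnected.image e (e.continuousOn.mono hU)
  have hbij : Function.Bijective (killingJetMap hG hq) := by
    constructor
    · rw [← LinearMap.ker_eq_bot, LinearMap.ker_eq_bot']
      intro K hK
      have h0 := IsKillingOn.eq_zero hG hpre hκ K.2 hq hK
      ext1
      funext y
      have h1 := mfderiv_symm_coordField (K := K.1) he (hU y.2) y.2
      rw [h0 _ (hmem y y.2)] at h1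
      exact h1.symm.trans (map_zero (mfderiv (𝓡 2) (𝓡 2) e.symm (e y)))
    · intro c
      obtain ⟨k, hk, hkc⟩ := hex _ (hB hq) c
      have h1 : ∀ z ∈ e.target ∩ e.symm ⁻¹' (U : Set M), coordField e (fieldOfCoord e U k) z = k z :=
        fun z hz => coordField_fieldOfCoord he hz.1 hz.2
      refine ⟨⟨fieldOfCoord e U k, hk.congr isOpen_coordDomain hB h1⟩, ?_⟩
      refine (killingJet_congr ?_).trans hkc
      filter_upwards [isOpen_coordDomain.mem_nhds hq] with w hw using h1 w hw
  rw [(LinearEquiv.ofBijective _ hbij).finrank_eq]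
  simp

end Dimension

end AlmostKilling

end
-- The main theorem
theorem mainTheorem6 {M : Type*} [TopologicalSpace M] [T2Space M] [ConnectedSpace M]
    [ChartedSpace (EuclideanSpace ℝ (Fin 2)) M] [IsManifold (𝓡 2) ∞ M]
    (g : AlmostKilling.SurfaceMetric M) (hg : AlmostKilling.HasConstantCurvature g)
    (τ : AlmostKilling.OneForm M) (c : ℝ) (hdτ : AlmostKilling.ExtDerivEqSmulVol g τ c)
    (hτ : ∀ x : M, AlmostKilling.oneFormNorm g τ x < 1) (p : M) :
    ∃ U₀ : TopologicalSpace.Opens M, p ∈ U₀ ∧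
      ∀ U : TopologicalSpace.Opens M, U ≤ U₀ → IsConnected (U : Set M) →
        ∃ V : Submodule ℝ ((x : U) → TangentSpace (𝓡 2) (x : M)),
          (∀ K : (x : U) → TangentSpace (𝓡 2) (x : M),
            K ∈ V ↔ AlmostKilling.IsAlmostKilling (AlmostKilling.randers g τ) U K) ∧
          Module.finrank ℝ V = 3 := by
  obtain ⟨κ, hκ⟩ := hg
  obtain ⟨e, he, hpe, hde⟩ := hdτ p
  have hG := (AlmostKilling.isMetricOn_metricMatrix g he).1
  -- U₀ is the coordinate ball on which Killing fields with arbitrary jet exist at every point. This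
  -- covers connected U that do not contain p.
  obtain ⟨r, hr, hr0⟩ := ((hG.exists_isKillingOn (hκ e he) (e.map_source hpe)).and
    self_mem_nhdsWithin).exists
  refine ⟨⟨e.source ∩ e ⁻¹' Metric.ball (e p) r, e.isOpen_inter_preimage Metric.isOpen_ball⟩,
    ⟨hpe, Metric.mem_ball_self hr0⟩, fun U hU hc => ?_⟩
  have hUe : (U : Set M) ⊆ e.source := fun x hx => (hU hx).1
  have hGU := hG.mono (Ω' := e.target ∩ e.symm ⁻¹' (U : Set M)) (fun z hz => hz.1)
    AlmostKilling.isOpen_coordDomain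
  refine ⟨AlmostKilling.killingSubmodule hGU, fun K => ⟨fun hK => ?_, fun hK => ?_⟩, ?_⟩
  · exact AlmostKilling.isAlmostKilling_of_isKillingOn hτ he hde hUe hK
  · exact AlmostKilling.isKillingOn_of_isAlmostKilling hτ he hK
  · refine AlmostKilling.finrank_killingSubmodule he hGU (fun z hz => hκ e he z hz.1) hUe hc
      (B := Metric.ball (e p) r) (fun z hz => ?_) hr
    have h := (hU hz.2).2
    rwa [Set.mem_preimage, e.right_inv hz.1] at h
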